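/- Let $\mathfrak C=\{X=\sum_I X_I\sigma^I : X_I\in\mathbb C\}$ be the algebra of formal sums over the finite sets $I$ of countably many anticommuting generators $\sigma_1,\sigma_2,\dots$, with the Grassmann product and the topology of coefficientwise convergence. Write $X_{\mathrm B}=X_\emptyset$ and $X_{\mathrm S}=X-X_{\mathrm B}$ for body and soul, $\mathfrak R=\{X\in\mathfrak C: X_{\mathrm B}\in\mathbb R\}$, $\mathfrak R_{\mathrm{ev}}$ and $\mathfrak R_{\mathrm{od}}$ for its even and odd parts, and $\mathfrak R^{m|n}=\mathfrak R_{\mathrm{ev}}^m\times\mathfrak R_{\mathrm{od}}^n\ni X=(x,\theta)=(X_A)_{1\le A\le m+n}$, with body map $\pi_{\mathrm B}:\mathfrak R^{m|n}\to\mathbb R^m$, $\pi_{\mathrm B}(x,\theta)=(x_{1,\mathrm B},\dots,x_{m,\mathrm B})$. Let $\mathfrak U\subset\mathfrak R^{m|n}$ be open and convex and let $W=\mathfrak C$ or $W=\mathfrak R$. A function $f:\mathfrak U\to W$ is in $\mathcal G^1_{SD}(\mathfrak U:W)$ if there are continuous $F_A:\mathfrak U\to W$, $1\le A\le m+n$,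 with $\frac{d}{dt}f(X+tH)|_{t=0}=\sum_A H_AF_A(X)$ for all $X\in\mathfrak U$, $H\in\mathfrak R^{m|n}$. For $r\ge2$ it is in $\mathcal G^r_{SD}(\mathfrak U:W)$ if moreover the $F_A$ are in $\mathcal G^{r-1}_{SD}(\mathfrak U:W)$, and $\mathcal G^\infty_{SD}=\bigcap_{r\ge1}\mathcal G^r_{SD}$. A function $u:\pi_{\mathrm B}(\mathfrak U)\to\mathfrak C$ is $C^\infty$ if all its coefficients $u_I$ are; its Grassmann continuation is $\tilde u(x)=\sum_{\alpha\in\mathbb N^m}\frac1{\alpha!}\,\partial^\alpha u(x_{\mathrm B})\,x_{\mathrm S}^\alpha$, a sum which is finite in each coefficient. A superfield expansion of $f$ with values in $W$ is a representation $$f(x,\theta)=\sum_{a\in\{0,1\}^n}\theta^a\,\tilde u_a(x)\qquad\text{for all }(x,\theta)\in\mathfrak U,\qquad \theta^a=\theta_1^{a_1}\cdots\theta_n^{a_n},$$ where each $u_a:\pi_{\mathrm B}(\mathfrak U)\to W$ is $C^\infty$. Theorem. Let $f:\mathfrak U\to\mathfrak C$. (i) The following are equivalent: (a) $f\in\mathcal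 G^\infty_{SD}(\mathfrak U:\mathfrak C)$; (d) $f$ is infinitely Gâteaux differentiable on $\mathfrak U$, i.e. all iterated Gâteaux differentials $d^kf(X)\{Y_1,\dots,Y_k\}$ exist and are continuous on $\mathfrak U\times(\mathfrak R^{m|n})^k$, and $f$ satisfies the Cauchy–Riemann equations $$\frac{\partial f}{\partial X_{A,I}}=\sigma^I\frac{\partial f}{\partial X_{A,\emptyset}}\ (A\le m,\ |I|\text{ even}),\qquad \sigma^K\frac{\partial f}{\partial X_{A,J}}+\sigma^J\frac{\partial f}{\partial X_{A,K}}=0\ (A>m,\ |J|,|K|\text{ odd}),$$ where $X_A=\sum_I X_{A,I}\sigma^I$ and $\partial/\partial X_{A,I}$ is the derivative in the real variable $X_{A,\emptyset}$ for $I=\emptyset$ and in the complex variable $X_{A,I}$ for $I\ne\emptyset$ (its existence being part of the condition); (e) $f$ has a superfield expansion with values in $\mathfrak C$. (ii) $f\in\mathcal G^\infty_{SD}(\mathfrak U:\mathfrak R)$ if and only if $f$ has a superfield expansion with values in $\mathfrak R$. (iii) The functions $u_a$ on $\pi_{\mathrm B}(\mathfrak U)$ in a superfield expansion of $f$ are uniquely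 determined by $f$. -/

import Mathlib

open Filter Topology Set
open scoped ContDiff

/-- Supernumbers: formal sums `∑ X_I σ^I` with complex coefficients, indexed by the finite sets `I`
of generators `σ_0, σ_1, σ_2, …`; here `σ^I` is the product of the `σ_i`, `i ∈ I`, taken in
increasing order of `i`. -/
def SuperNumber : Type := Finset ℕ → ℂ

namespace SuperNumber

noncomputable instance : AddCommGroup SuperNumber := inferInstanceAs (AddCommGroup (Finset ℕ → ℂ))
noncomputable instance : Module ℂ SuperNumber := inferInstanceAs (Module ℂ (Finset ℕ → ℂ))

/-- The topology of coefficientwise convergence. -/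
noncomputable instance : TopologicalSpace SuperNumber := inferInstanceAs (TopologicalSpace (Finset ℕ → ℂ))
instance : IsTopologicalAddGroup SuperNumber :=
  inferInstanceAs (IsTopologicalAddGroup (Finset ℕ → ℂ))
instance : ContinuousSMul ℂ SuperNumber := inferInstanceAs (ContinuousSMul ℂ (Finset ℕ → ℂ))
instance : ContinuousSMul ℝ SuperNumber := inferInstanceAs (ContinuousSMul ℝ (Finset ℕ → ℂ))
instance : T2Space SuperNumber := inferInstanceAs (T2Space (Finset ℕ → ℂ))

@[ext] theorem ext {X Y : SuperNumber} (h : ∀ I, X I = Y I) : X = Y := funext h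

@[simp] theorem zero_apply (I : Finset ℕ) : (0 : SuperNumber) I = 0 := rfl
@[simp] theorem add_apply (X Y : SuperNumber) (I : Finset ℕ) : (X + Y) I = X I + Y I := rfl
@[simp] theorem sub_apply (X Y : SuperNumber) (I : Finset ℕ) : (X - Y) I = X I - Y I := rfl
@[simp] theorem smul_apply (c : ℂ) (X : SuperNumber) (I : Finset ℕ) : (c • X) I = c * X I := rfl
@[simp] theorem real_smul_apply (c : ℝ) (X : SuperNumber) (I : Finset ℕ) :
    (c • X) I = (c : ℂ) * X I := rfl

/-- The sign in `σ^J σ^K = sign J K • σ^(J ∪ K)` for disjoint `J`, `K`: it counts the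
transpositions `σ_j σ_k = - σ_k σ_j`, `j ∈ J`, `k ∈ K`, `k < j`. -/
noncomputable def sign (J K : Finset ℕ) : ℂ :=
  (-1) ^ ((J ×ˢ K).filter (fun p => p.2 < p.1)).card

/-- The monomial `σ^I`. -/
noncomputable def sigma (I : Finset ℕ) : SuperNumber := fun J => if J = I then 1 else 0

noncomputable instance : One SuperNumber := ⟨sigma ∅⟩

/-- The Grassmann product, `(XY)_I = ∑_{I = J ⊔ K} sign J K * X_J * Y_K`. -/
noncomputable instance : Mul SuperNumber :=
  ⟨fun X Y I => ∑ J ∈ I.powerset, sign J (I \ J) * X J * Y (I \ J)⟩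

theorem mul_apply (X Y : SuperNumber) (I : Finset ℕ) :
    (X * Y) I = ∑ J ∈ I.powerset, sign J (I \ J) * X J * Y (I \ J) := rfl

theorem one_apply (I : Finset ℕ) : (1 : SuperNumber) I = if I = ∅ then 1 else 0 := rfl

theorem sign_union_left {J K : Finset ℕ} (h : Disjoint J K) (L : Finset ℕ) :
    sign (J ∪ K) L = sign J L * sign K L := by
  unfold sign
  rw [← pow_add, Finset.union_product, Finset.filter_union, Finset.card_union_of_disjoint]
  exact Finset.disjoint_filter_filter (Finset.disjoint_product.2 (Or.inl h))

theorem sign_union_right (J : Finset ℕ) {K L : Finset ℕ} (h : Disjoint K L) :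
    sign J (K ∪ L) = sign J K * sign J L := by
  unfold sign
  rw [← pow_add, Finset.product_union, Finset.filter_union, Finset.card_union_of_disjoint]
  exact Finset.disjoint_filter_filter (Finset.disjoint_product.2 (Or.inr h))

@[simp] theorem sign_empty_left (K : Finset ℕ) : sign ∅ K = 1 := by simp [sign]
@[simp] theorem sign_empty_right (K : Finset ℕ) : sign K ∅ = 1 := by simp [sign]

protected theorem mul_assoc (X Y Z : SuperNumber) : X * Y * Z = X * (Y * Z) := by
  ext I
  simp only [mul_apply, Finset.mul_sum, Finset.sum_mul]
  rw [Finset.sum_sigma', Finset.sum_sigma']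
  refine Finset.sum_bij' (fun p _ => ⟨p.2, p.1 \ p.2⟩) (fun p _ => ⟨p.1 ∪ p.2, p.1⟩) ?_ ?_ ?_ ?_ ?_
  · rintro ⟨J, K⟩ h
    simp only [Finset.mem_sigma, Finset.mem_powerset] at h ⊢
    exact ⟨h.2.trans h.1, Finset.sdiff_subset_sdiff h.1 subset_rfl⟩
  · rintro ⟨K, L⟩ h
    simp only [Finset.mem_sigma, Finset.mem_powerset] at h ⊢
    exact ⟨Finset.union_subset h.1 (h.2.trans Finset.sdiff_subset), Finset.subset_union_left⟩
  · rintro ⟨J, K⟩ h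
    simp only [Finset.mem_sigma, Finset.mem_powerset] at h
    simp [Finset.union_sdiff_of_subset h.2]
  · rintro ⟨K, L⟩ h
    simp only [Finset.mem_sigma, Finset.mem_powerset] at h
    have hd : Disjoint K L := (Finset.subset_sdiff.1 h.2).2.symm
    simp [Finset.union_sdiff_cancel_left hd]
  · rintro ⟨J, K⟩ h
    simp only [Finset.mem_sigma, Finset.mem_powerset] at h
    obtain ⟨hJ, hK⟩ := h
    have e1 : (I \ K) \ (J \ K) = I \ J := by
      ext x; simp only [Finset.mem_sdiff]; have := @hK x; tauto
    have e2 : I \ K = (J \ K) ∪ (I \ J) := by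
      ext x; simp only [Finset.mem_sdiff, Finset.mem_union]
      have := @hK x; have := @hJ x; tauto
    have d1 : Disjoint (J \ K) (I \ J) :=
      (Finset.disjoint_sdiff (s := J) (t := I)).mono_left Finset.sdiff_subset
    have s1 : sign J (I \ J) = sign K (I \ J) * sign (J \ K) (I \ J) := by
      rw [← sign_union_left Finset.disjoint_sdiff, Finset.union_sdiff_of_subset hK]
    have s2 : sign K (I \ K) = sign K (J \ K) * sign K (I \ J) := by
      rw [e2, sign_union_right K d1]
    dsimp only
    rw [e1, s1, s2]
    ring

protected theorem one_mul (X : SuperNumber) : 1 * X = X := by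
  ext I
  rw [mul_apply, Finset.sum_eq_single ∅]
  · simp [one_apply]
  · intro J _ hJ; simp [one_apply, hJ]
  · simp

protected theorem mul_one (X : SuperNumber) : X * 1 = X := by
  ext I
  rw [mul_apply, Finset.sum_eq_single I]
  · simp [one_apply]
  · intro J hJ hJI
    have : ¬ I ⊆ J := fun h => hJI (Finset.Subset.antisymm (Finset.mem_powerset.1 hJ) h)
    simp [one_apply, Finset.sdiff_eq_empty_iff_subset, this]
  · simp

noncomputable instance : Ring SuperNumber :=
  { (inferInstance : AddCommGroup SuperNumber) with
    mul := (· * ·)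
    one := 1
    left_distrib := fun X Y Z => by
      ext I; simp [mul_apply, mul_add, Finset.sum_add_distrib]
    right_distrib := fun X Y Z => by
      ext I; simp [mul_apply, mul_add, add_mul, Finset.sum_add_distrib]
    zero_mul := fun X => by ext I; simp [mul_apply]
    mul_zero := fun X => by ext I; simp [mul_apply]
    mul_assoc := SuperNumber.mul_assoc
    one_mul := SuperNumber.one_mul
    mul_one := SuperNumber.mul_one }

/-- The supernumbers with real body `X_∅`; the other coefficients stay complex. -/
noncomputable def realBody : Submodule ℝ SuperNumber where
  carrier := {X | (X ∅).im = 0}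
  add_mem' := by intro X Y hX hY; simp_all
  zero_mem' := by simp
  smul_mem' := by intro c X hX; simp_all

/-- Even supernumbers. -/
noncomputable def evenPart : Submodule ℝ SuperNumber where
  carrier := {X | ∀ I : Finset ℕ, Odd I.card → X I = 0}
  add_mem' := by intro X Y hX hY I hI; simp [hX I hI, hY I hI]
  zero_mem' := by intro I _; rfl
  smul_mem' := by intro c X hX I hI; simp [hX I hI]

/-- Odd supernumbers. -/
noncomputable def oddPart : Submodule ℝ SuperNumber where
  carrier := {X | ∀ I : Finset ℕ, Even I.card → X I = 0}
  add_mem' := by intro X Y hX hY I hI; simp [hX I hI, hY I hI]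
  zero_mem' := by intro I _; rfl
  smul_mem' := by intro c X hX I hI; simp [hX I hI]

/-- The range of an even coordinate. -/
noncomputable def realEven : Submodule ℝ SuperNumber := realBody ⊓ evenPart

/-- The range of an odd coordinate. -/
noncomputable def realOdd : Submodule ℝ SuperNumber := realBody ⊓ oddPart

/-- The soul `X - X_∅`. -/
noncomputable def soul (X : SuperNumber) : SuperNumber := X - X ∅ • 1

theorem one_mem_realEven : (1 : SuperNumber) ∈ realEven :=
  ⟨show ((1 : SuperNumber) ∅).im = 0 by simp [one_apply], fun I hI => by
    have : I ≠ ∅ := by rintro rfl; simp at hI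
    simp [one_apply, this]⟩

theorem smul_sigma_mem_realEven {I : Finset ℕ} (hI : Even I.card) (h0 : I.Nonempty) (z : ℂ) :
    z • sigma I ∈ realEven :=
  ⟨show ((z • sigma I) ∅).im = 0 by simp [sigma, h0.ne_empty.symm], fun J hJ => by
    have : J ≠ I := by rintro rfl; exact (Nat.not_even_iff_odd.2 hJ) hI
    simp [sigma, this]⟩

theorem smul_sigma_mem_realOdd {I : Finset ℕ} (hI : Odd I.card) (z : ℂ) :
    z • sigma I ∈ realOdd := by
  have h0 : ∅ ≠ I := by rintro rfl; simp at hI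
  exact ⟨show ((z • sigma I) ∅).im = 0 by simp [sigma, h0], fun J hJ => by
    have : J ≠ I := by rintro rfl; exact (Nat.not_even_iff_odd.2 hI) hJ
    simp [sigma, this]⟩

end SuperNumber

open SuperNumber

/-- The superspace with `m` even and `n` odd coordinates; a point is `X = (x, θ)`. -/
abbrev SuperSpace (m n : ℕ) : Type := (Fin m → realEven) × (Fin n → realOdd)

namespace SuperSpace

variable {m n : ℕ}

/-- The coordinates `X_A`, the `m` even ones followed by the `n` odd ones. -/
def coord (X : SuperSpace m n) : Fin m ⊕ Fin n → SuperNumber :=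
  Sum.elim (fun j => (X.1 j : SuperNumber)) (fun k => (X.2 k : SuperNumber))

/-- The body of the even coordinates. -/
def evenBody (x : Fin m → realEven) : Fin m → ℝ := fun j => ((x j : SuperNumber) ∅).re

/-- The body map from superspace to `ℝ^m`. -/
def body (X : SuperSpace m n) : Fin m → ℝ := evenBody X.1

/-- `θ^a = θ_1^{a_1} ⋯ θ_n^{a_n}`; the exponent `a ∈ {0,1}^n` is given by its support. -/
noncomputable def thetaPow (θ : Fin n → realOdd) (a : Finset (Fin n)) : SuperNumber :=
  (List.ofFn fun k => if k ∈ a then (θ k : SuperNumber) else 1).prod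

/-- `x_S^α = x_{1,S}^{α_1} ⋯ x_{m,S}^{α_m}`, the monomial in the souls of the even coordinates. -/
noncomputable def soulPow (x : Fin m → realEven) (α : Fin m → ℕ) : SuperNumber :=
  (List.ofFn fun j => soul (x j : SuperNumber) ^ α j).prod

end SuperSpace

open SuperSpace

/-- `lim_{t → 0} (g t - g 0) / t = v`, that is `dg/dt|_{t=0} = v`, with `t` in `𝕜 = ℝ` or `ℂ`. -/
def HasDerivAtZero (𝕜 : Type*) [NontriviallyNormedField 𝕜] [Module 𝕜 SuperNumber]
    (g : 𝕜 → SuperNumber) (v : SuperNumber) : Prop :=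
  Tendsto (fun t : 𝕜 => t⁻¹ • (g t - g 0)) (𝓝[≠] 0) (𝓝 v)

/-- `f` is `r` times superdifferentiable on `U` with values in `W`: there are continuous `W`-valued
`F_A` with `d/dt f(X + tH)|_{t=0} = ∑_A H_A F_A(X)` which are themselves `r - 1` times
superdifferentiable. Order `0` means continuity. -/
def IsSuperDiff {m n : ℕ} (U : Set (SuperSpace m n)) (W : Set SuperNumber) :
    ℕ → (SuperSpace m n → SuperNumber) → Prop
  | 0, f => MapsTo f U W ∧ ContinuousOn f U
  | r + 1, f => MapsTo f U W ∧ ∃ F : Fin m ⊕ Fin n → SuperSpace m n → SuperNumber,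
      (∀ A, MapsTo (F A) U W ∧ ContinuousOn (F A) U) ∧
      (∀ X ∈ U, ∀ H : SuperSpace m n,
        HasDerivAtZero ℝ (fun t : ℝ => f (X + t • H)) (∑ A, coord H A * F A X)) ∧
      ∀ A, IsSuperDiff U W r (F A)

/-- The class `𝒢_SD^∞(U : W)`. -/
def IsSuperDiffInfty {m n : ℕ} (U : Set (SuperSpace m n)) (W : Set SuperNumber)
    (f : SuperSpace m n → SuperNumber) : Prop :=
  ∀ r : ℕ, 1 ≤ r → IsSuperDiff U W r f

/-- The class `C_G^∞(U)`: all iterated Gâteaux differentials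
`D k X (y_0, …, y_{k-1}) = d^k f(X){y_0, …, y_{k-1}}` exist and are jointly continuous. -/
def IsGateauxSmooth {m n : ℕ} (U : Set (SuperSpace m n)) (f : SuperSpace m n → SuperNumber) :
    Prop :=
  ∃ D : (k : ℕ) → SuperSpace m n → (Fin k → SuperSpace m n) → SuperNumber,
    (∀ X ∈ U, ∀ y : Fin 0 → SuperSpace m n, D 0 X y = f X) ∧
    (∀ k, ∀ X ∈ U, ∀ y : Fin (k + 1) → SuperSpace m n,
      HasDerivAtZero ℝ (fun t : ℝ => D k (X + t • y (Fin.last k)) (Fin.init y))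
        (D (k + 1) X y)) ∧
    ∀ k, ContinuousOn (fun p : SuperSpace m n × (Fin k → SuperSpace m n) => D k p.1 p.2)
      (U ×ˢ univ)

/-- The Cauchy–Riemann equations. `P A I` is the partial derivative of `f` with respect to the
coefficient `X_{A,I}` of `σ^I` in the coordinate `X_A`. This coefficient is a real variable for
`I = ∅` (`A` even) and a complex variable for `I ≠ ∅`, so the derivative is a real, respectively a
complex one. -/
def SatisfiesCauchyRiemann {m n : ℕ} (U : Set (SuperSpace m n))
    (f : SuperSpace m n → SuperNumber) : Prop :=
  ∃ P : Fin m ⊕ Fin n → Finset ℕ → SuperSpace m n → SuperNumber, ∀ X ∈ U,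
    (∀ j : Fin m, HasDerivAtZero ℝ
      (fun t : ℝ => f (X + (Pi.single j (t • ⟨1, one_mem_realEven⟩), 0))) (P (.inl j) ∅ X)) ∧
    (∀ (j : Fin m) (I : Finset ℕ) (hI : Even I.card) (h0 : I.Nonempty), HasDerivAtZero ℂ
      (fun z : ℂ => f (X + (Pi.single j ⟨z • sigma I, smul_sigma_mem_realEven hI h0 z⟩, 0)))
      (P (.inl j) I X)) ∧
    (∀ (k : Fin n) (I : Finset ℕ) (hI : Odd I.card), HasDerivAtZero ℂ
      (fun z : ℂ => f (X + (0, Pi.single k ⟨z • sigma I, smul_sigma_mem_realOdd hI z⟩)))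
      (P (.inr k) I X)) ∧
    (∀ (j : Fin m) (I : Finset ℕ), Even I.card →
      P (.inl j) I X = sigma I * P (.inl j) ∅ X) ∧
    (∀ (k : Fin n) (J K : Finset ℕ), Odd J.card → Odd K.card →
      sigma K * P (.inr k) J X + sigma J * P (.inr k) K X = 0)

/-- `C^∞` for supernumber-valued functions on an open subset of `ℝ^m`: every coefficient is
`C^∞`. -/
def IsSmoothOn {m : ℕ} (V : Set (Fin m → ℝ)) (u : (Fin m → ℝ) → SuperNumber) : Prop :=
  ∀ I : Finset ℕ, ContDiffOn ℝ ∞ (fun q => u q I) V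

/-- The partial derivative `∂g/∂q_j`. -/
noncomputable def partialDeriv {m : ℕ} (j : Fin m) (g : (Fin m → ℝ) → ℂ) : (Fin m → ℝ) → ℂ :=
  fun q => lineDeriv ℝ g q (Pi.single j 1)

/-- The iterated partial derivative `∂^α g = ∂_1^{α_1} ⋯ ∂_m^{α_m} g`. -/
noncomputable def multiDeriv {m : ℕ} (α : Fin m → ℕ) (g : (Fin m → ℝ) → ℂ) : (Fin m → ℝ) → ℂ :=
  (List.finRange m).foldr (fun j h => (partialDeriv j)^[α j] h) g

/-- `∂^α u`, coefficientwise. -/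
noncomputable def superMultiDeriv {m : ℕ} (α : Fin m → ℕ) (u : (Fin m → ℝ) → SuperNumber)
    (q : Fin m → ℝ) : SuperNumber :=
  fun I => multiDeriv α (fun q' => u q' I) q

/-- The term of index `α` in the Grassmann continuation of `u`. -/
noncomputable def grassmannTerm {m : ℕ} (u : (Fin m → ℝ) → SuperNumber) (x : Fin m → realEven)
    (α : Fin m → ℕ) : SuperNumber :=
  ((∏ j, ((α j).factorial : ℂ))⁻¹) • (superMultiDeriv α u (evenBody x) * soulPow x α)

/-- The Grassmann continuation `ũ(x) = ∑_α (1/α!) ∂^α u(x_B) x_S^α`. The series always converges,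
see `summable_grassmannTerm`. -/
noncomputable def grassmannContinuation {m : ℕ} (u : (Fin m → ℝ) → SuperNumber)
    (x : Fin m → realEven) : SuperNumber :=
  ∑' α : Fin m → ℕ, grassmannTerm u x α

/-- `f(x, θ) = ∑_a θ^a ũ_a(x)` on `U`, with `W`-valued `C^∞` functions `u_a` on the body of `U`. -/
def IsSuperfieldExpansion {m n : ℕ} (U : Set (SuperSpace m n)) (W : Set SuperNumber)
    (f : SuperSpace m n → SuperNumber) (u : Finset (Fin n) → (Fin m → ℝ) → SuperNumber) : Prop :=
  (∀ a, IsSmoothOn (body '' U) (u a) ∧ MapsTo (u a) (body '' U) W) ∧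
  ∀ X ∈ U, f X = ∑ a : Finset (Fin n), thetaPow X.2 a * grassmannContinuation (u a) X.1

/-- Products of `k` factors without body have no coefficients of degree `< k`. -/
theorem SuperNumber.mul_apply_eq_zero_of_card_lt {X Y : SuperNumber} {k l : ℕ}
    (hX : ∀ I : Finset ℕ, I.card < k → X I = 0) (hY : ∀ I : Finset ℕ, I.card < l → Y I = 0)
    (I : Finset ℕ) (hI : I.card < k + l) : (X * Y) I = 0 := by
  rw [SuperNumber.mul_apply]
  refine Finset.sum_eq_zero fun J hJ => ?_
  have hc := Finset.card_sdiff_add_card_eq_card (Finset.mem_powerset.1 hJ)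
  rcases lt_or_ge J.card k with h | h
  · simp [hX J h]
  · simp [hY (I \ J) (by omega)]

theorem SuperNumber.soul_pow_apply_eq_zero (X : SuperNumber) (k : ℕ) :
    ∀ I : Finset ℕ, I.card < k → (soul X ^ k) I = 0 := by
  induction k with
  | zero => intro I hI; omega
  | succ k ih =>
    intro I hI
    rw [pow_succ]
    refine SuperNumber.mul_apply_eq_zero_of_card_lt ih (l := 1) ?_ I hI
    intro J hJ
    have : J = ∅ := by rw [← Finset.card_eq_zero]; omega
    subst this
    simp [soul, SuperNumber.one_apply]

theorem SuperSpace.soulPow_apply_eq_zero : ∀ {m : ℕ} (x : Fin m → realEven) (α : Fin m → ℕ)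
    (I : Finset ℕ), I.card < ∑ j, α j → soulPow x α I = 0
  | 0, _, _, _, h => by simp at h
  | m + 1, x, α, I, h => by
    rw [soulPow, List.ofFn_succ, List.prod_cons]
    refine SuperNumber.mul_apply_eq_zero_of_card_lt (SuperNumber.soul_pow_apply_eq_zero _ (α 0))
      (fun J hJ => SuperSpace.soulPow_apply_eq_zero (fun j => x j.succ) (fun j => α j.succ) J hJ)
      I ?_
    rwa [Fin.sum_univ_succ] at h

theorem grassmannTerm_apply_eq_zero {m : ℕ} (u : (Fin m → ℝ) → SuperNumber)
    (x : Fin m → realEven) (α : Fin m → ℕ) (I : Finset ℕ) (h : I.card < ∑ j, α j) :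
    grassmannTerm u x α I = 0 := by
  have := SuperNumber.mul_apply_eq_zero_of_card_lt (X := superMultiDeriv α u (evenBody x))
    (k := 0) (by intro I hI; omega) (SuperSpace.soulPow_apply_eq_zero x α) I (by omega)
  simp [grassmannTerm, this]

/-- In every coefficient only finitely many terms of the Grassmann continuation are nonzero. -/
theorem summable_grassmannTerm {m : ℕ} (u : (Fin m → ℝ) → SuperNumber) (x : Fin m → realEven) :
    Summable (grassmannTerm u x) := by
  have key : ∀ I : Finset ℕ, Summable fun α => grassmannTerm u x α I := by
    intro I
    refine summable_of_hasFiniteSupport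
      ((Set.finite_Iic (fun _ : Fin m => I.card)).subset fun α hα j => ?_)
    by_contra hj
    refine hα (grassmannTerm_apply_eq_zero u x α I (lt_of_lt_of_le (not_le.1 hj) ?_))
    exact Finset.single_le_sum (f := α) (fun _ _ => Nat.zero_le _) (Finset.mem_univ j)
  exact Pi.summable.2 key

/-! ### The Grassmann algebra: topology, parity, cancellation of generators. -/

namespace SuperNumber

/-! All equivalences pass through (a).

From (a) to (e). Let `F` be the superderivative in `θ_k` and let `y` be odd. Along `X + t y` the
product `y F` has a derivative containing `y y = 0`, so `f(X + y) = f(X) + y F(X)`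
(`apply_add_oddDir`). Expanding `f(X + y + t σ_i)` in two ways gives `σ_i F(X + y) = σ_i F(X)` for
every `i`, and since there are infinitely many generators they can be cancelled
(`eq_zero_of_sigma_mul`). Hence `f = g + θ_k F` with `g` and `F` free of `θ_k`; induction over `k`
leaves coefficients that depend on `x` alone (`exists_odd_expansion`). Let `h_α` be the even
derivatives of such a coefficient. The sum `exp(-x_S ∂) h` has a derivative in direction `H` that
sees only the body of `H`. It is therefore constant on the fibres of the body map over a convex `U`
and descends to a smooth function `u` on the body; the identity `exp(x_S ∂) exp(-x_S ∂) = 1` says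
that the coefficient is the continuation of `u`. All these exponentials are formal Taylor sums,
finite in each coefficient, and the computations rest on one differentiation formula,
`hasCoeffDerivAt_taylorSum`.

From (e) to (a). By the same formula the superderivatives of a continuation are the continuations of
the partial derivatives. Sums and products with `θ_k` stay in a class closed under superderivatives,
and such a class consists of smooth functions by coinduction. Being `ℜ`-valued constrains the body
only, so it is carried along.

Between (a) and (d). The `F_A` give the differentials and the Cauchy–Riemann equations explicitly.
Conversely, the derivatives `P_i` in the directions `σ_i` of an odd coordinate satisfy `σ_j P_i +
σ_i P_j = 0`, and with infinitely many generators this forces `P_i = σ_i F` (`exists_eq_sigma_mul`).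
Joint continuity makes the first differential linear and continuous in the direction, so its values
on monomials determine it and the `F_A` are superderivatives. Each coefficient of `F` is read off
from a single `P_i`, so `F` inherits iterated differentials; it inherits the Cauchy–Riemann
equations by symmetry of second differentials and cancellation of `σ_i` (`derivTower_tower`).

Uniqueness: shifting `θ_k` by `t σ_i` isolates the coefficient of `θ_k`, and `u` is recovered from
its continuation by induction on the size of `I`. -/

instance : IsScalarTower ℂ SuperNumber SuperNumber :=
  ⟨fun c X Y => by ext I; simp [mul_apply, Finset.mul_sum, mul_assoc, mul_left_comm]⟩

instance : SMulCommClass ℂ SuperNumber SuperNumber :=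
  ⟨fun c X Y => by ext I; simp [mul_apply, Finset.mul_sum, mul_left_comm]⟩

theorem continuous_apply_coeff (I : Finset ℕ) : Continuous fun X : SuperNumber => X I :=
  continuous_apply I

theorem continuous_iff_coeff {E : Type*} [TopologicalSpace E] {f : E → SuperNumber} :
    Continuous f ↔ ∀ I, Continuous fun x => f x I := continuous_pi_iff

theorem continuousOn_iff_coeff {E : Type*} [TopologicalSpace E] {s : Set E}
    {f : E → SuperNumber} : ContinuousOn f s ↔ ∀ I, ContinuousOn (fun x => f x I) s :=
  continuousOn_pi

theorem tendsto_iff_coeff {E : Type*} {l : Filter E} {f : E → SuperNumber} {v : SuperNumber} :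
    Tendsto f l (𝓝 v) ↔ ∀ I, Tendsto (fun x => f x I) l (𝓝 (v I)) := tendsto_pi_nhds

/-- A coefficient of a product is a finite sum over the subsets of `I`. -/
instance : ContinuousMul SuperNumber where
  continuous_mul := continuous_iff_coeff.2 fun I => by
    simp only [mul_apply]
    refine continuous_finsetSum _ fun J _ => ?_
    exact (continuous_const.mul ((continuous_apply_coeff _).comp continuous_fst)).mul
      ((continuous_apply_coeff _).comp continuous_snd)

instance : IsTopologicalRing SuperNumber where
  continuous_neg := continuous_neg

@[simp] theorem neg_apply (X : SuperNumber) (I : Finset ℕ) : (-X) I = -X I := rfl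

@[simp] theorem sum_apply {ι : Type*} (s : Finset ι) (f : ι → SuperNumber) (I : Finset ℕ) :
    (∑ i ∈ s, f i) I = ∑ i ∈ s, f i I := Finset.sum_apply I s f

theorem mul_empty (X Y : SuperNumber) : (X * Y) ∅ = X ∅ * Y ∅ := by
  simp [mul_apply]

theorem sign_mul_self (J K : Finset ℕ) : sign J K * sign J K = 1 := by
  unfold sign
  rw [← pow_add, ← two_mul, pow_mul]; simp

theorem sign_ne_zero (J K : Finset ℕ) : sign J K ≠ 0 := fun h => by
  simpa [h] using sign_mul_self J K

/-- Each pair in `J × K` is an inversion in exactly one of the two orders, so the two inversion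
numbers add up to `|J| |K|`. -/
theorem sign_swap {J K : Finset ℕ} (h : Disjoint J K) :
    sign J K = (-1) ^ (J.card * K.card) * sign K J := by
  have e : ((J ×ˢ K).filter (fun p => p.2 < p.1)).card
      + ((K ×ˢ J).filter (fun p => p.2 < p.1)).card = J.card * K.card := by
    rw [← Finset.card_product, ← Finset.card_filter_add_card_filter_not (s := J ×ˢ K)
      (fun p => p.2 < p.1)]
    congr 1
    refine Finset.card_bij (fun p _ => p.swap) ?_ ?_ ?_
    · rintro ⟨a, b⟩ hp
      simp only [Finset.mem_filter, Finset.mem_product, Prod.swap, not_lt] at hp ⊢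
      exact ⟨⟨hp.1.2, hp.1.1⟩, hp.2.le⟩
    · rintro ⟨a, b⟩ _ ⟨c, d⟩ _ hp
      simpa [and_comm] using hp
    · rintro ⟨a, b⟩ hp
      simp only [Finset.mem_filter, Finset.mem_product, not_lt] at hp
      refine ⟨(b, a), ?_, rfl⟩
      simp only [Finset.mem_filter, Finset.mem_product]
      exact ⟨⟨hp.1.2, hp.1.1⟩, lt_of_le_of_ne hp.2 (Finset.disjoint_left.1 h hp.1.1 <| · ▸ hp.1.2)⟩
  rw [← e, pow_add, mul_assoc]
  have := sign_mul_self K J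
  unfold sign at this ⊢
  rw [this, mul_one]

theorem mul_apply_swap (X Y : SuperNumber) (I : Finset ℕ) :
    (Y * X) I = ∑ J ∈ I.powerset, sign (I \ J) J * Y (I \ J) * X J := by
  rw [mul_apply]
  refine Finset.sum_bij' (fun J _ => I \ J) (fun J _ => I \ J) ?_ ?_ ?_ ?_ ?_
  · intro J _; simp
  · intro J _; simp
  · intro J hJ; simpa using Finset.mem_powerset.1 hJ
  · intro J hJ; simpa using Finset.mem_powerset.1 hJ
  · intro J hJ
    have : I \ (I \ J) = J := by simpa using Finset.mem_powerset.1 hJ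
    simp [this]

theorem even_mul_comm {X : SuperNumber} (hX : X ∈ evenPart) (Y : SuperNumber) :
    X * Y = Y * X := by
  ext I
  rw [mul_apply_swap X Y, mul_apply]
  refine Finset.sum_congr rfl fun J _ => ?_
  rcases Nat.even_or_odd J.card with h | h
  · rw [sign_swap Finset.disjoint_sdiff, (h.mul_right _).neg_one_pow]; ring
  · rw [show X J = 0 from hX J h]; ring

theorem odd_mul_odd {X Y : SuperNumber} (hX : X ∈ oddPart) (hY : Y ∈ oddPart) :
    X * Y = -(Y * X) := by
  ext I
  rw [neg_apply, mul_apply_swap X Y, mul_apply, ← Finset.sum_neg_distrib]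
  refine Finset.sum_congr rfl fun J _ => ?_
  rcases Nat.even_or_odd J.card with h | h
  · rw [show X J = 0 from hX J h]; ring
  rcases Nat.even_or_odd (I \ J).card with h' | h'
  · rw [show Y (I \ J) = 0 from hY _ h']; ring
  · rw [sign_swap Finset.disjoint_sdiff, (h.mul h').neg_one_pow]; ring

theorem odd_mul_self {X : SuperNumber} (hX : X ∈ oddPart) : X * X = 0 := by
  have h : (2 : ℂ) • (X * X) = 0 := by
    rw [two_smul]; nth_rewrite 1 [odd_mul_odd hX hX]; simp
  exact (smul_eq_zero.1 h).resolve_left two_ne_zero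

theorem odd_body {X : SuperNumber} (hX : X ∈ oddPart) : X ∅ = 0 := hX ∅ (by simp)

theorem sigma_mem_oddPart {I : Finset ℕ} (hI : Odd I.card) : sigma I ∈ oddPart := by
  simpa using (smul_sigma_mem_realOdd hI 1).2

theorem sigma_mul_apply (J : Finset ℕ) (Y : SuperNumber) (I : Finset ℕ) :
    (sigma J * Y) I = if J ⊆ I then sign J (I \ J) * Y (I \ J) else 0 := by
  rw [mul_apply]
  split_ifs with h
  · rw [Finset.sum_eq_single J]
    · simp [sigma]
    · intro K _ hK; simp [sigma, hK]
    · intro h'; exact absurd (Finset.mem_powerset.2 h) h'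
  · refine Finset.sum_eq_zero fun K hK => ?_
    have : K ≠ J := by rintro rfl; exact h (Finset.mem_powerset.1 hK)
    simp [sigma, this]

theorem sigma_mul_apply_union {J I : Finset ℕ} (h : Disjoint J I) (Y : SuperNumber) :
    (sigma J * Y) (J ∪ I) = sign J I * Y I := by
  rw [sigma_mul_apply, if_pos Finset.subset_union_left, Finset.union_sdiff_cancel_left h]

theorem apply_eq_zero_of_sigma_mul {i : ℕ} {Y : SuperNumber} (h : sigma {i} * Y = 0)
    {I : Finset ℕ} (hi : i ∉ I) : Y I = 0 := by
  have := sigma_mul_apply_union (Finset.disjoint_singleton_left.2 hi) Y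
  rw [h, zero_apply] at this
  exact (mul_eq_zero.1 this.symm).resolve_left (sign_ne_zero _ _)

/-- Every finite `I` misses some generator, and multiplication by that one preserves the coefficient
at `I` up to sign. With finitely many generators the top monomial would be a counterexample. -/
theorem eq_zero_of_sigma_mul {Y : SuperNumber} (h : ∀ i, sigma {i} * Y = 0) : Y = 0 := by
  ext I
  obtain ⟨i, hi⟩ := Infinite.exists_notMem_finset I
  exact apply_eq_zero_of_sigma_mul (h i) hi

theorem eq_of_sigma_mul {Y Z : SuperNumber} (h : ∀ i, sigma {i} * Y = sigma {i} * Z) :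
    Y = Z := sub_eq_zero.1 <| eq_zero_of_sigma_mul fun i => by rw [mul_sub, h i, sub_self]

/-- An anticommuting family `P_i` is of the form `σ_i F`. -/
theorem exists_eq_sigma_mul (c : Finset ℕ → ℕ) (hc : ∀ I, c I ∉ I) (P : ℕ → SuperNumber)
    (h : ∀ i j, sigma {j} * P i + sigma {i} * P j = 0) (i : ℕ) :
    P i = sigma {i} * (show SuperNumber from fun I => sign {c I} I * P (c I) ({c I} ∪ I)) := by
  have hself : ∀ j, sigma {j} * P j = 0 := fun j => by
    have h2 : (2 : ℂ) • (sigma {j} * P j) = 0 := by rw [two_smul, h j j]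
    exact (smul_eq_zero.1 h2).resolve_left two_ne_zero
  -- The coefficient of `F` at `I` can be read off from any `P a` with `a ∉ I`; the relation for
  -- `a`, `b` at `{a, b} ∪ I` shows that the choice is irrelevant, so `c` is only a selector.
  have key : ∀ (I : Finset ℕ) (a b : ℕ), a ∉ I → b ∉ I →
      sign {a} I * P a ({a} ∪ I) = sign {b} I * P b ({b} ∪ I) := by
    intro I a b ha hb
    rcases eq_or_ne a b with rfl | hab
    · rfl
    have d1 : Disjoint {b} ({a} ∪ I) := by simp [hb, hab.symm]
    have d2 : Disjoint {a} ({b} ∪ I) := by simp [ha, hab]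
    have e := congrFun (h a b) ({b} ∪ ({a} ∪ I))
    rw [add_apply, sigma_mul_apply_union d1, show ({b} ∪ ({a} ∪ I) : Finset ℕ) = {a} ∪ ({b} ∪ I) by
      rw [← Finset.union_assoc, Finset.union_comm {b}, Finset.union_assoc],
      sigma_mul_apply_union d2, sign_union_right _ (by simpa using ha),
      sign_union_right _ (by simpa using hb),
      sign_swap (J := {b}) (K := {a}) (by simpa using hab.symm)] at e
    have hs := sign_mul_self {a} {b}
    have ha1 := sign_mul_self {a} I
    have hb1 := sign_mul_self {b} I
    simp only [Finset.card_singleton, mul_one, pow_one, zero_apply] at e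
    have e' : sign {b} I * P a ({a} ∪ I) = sign {a} I * P b ({b} ∪ I) := by
      linear_combination (-sign {a} {b}) * e + (-sign {b} I * P a ({a} ∪ I)
        + sign {a} I * P b ({b} ∪ I)) * hs
    linear_combination (sign {a} I * sign {b} I) * e' - (sign {a} I * P a ({a} ∪ I)) * hb1 +
      (sign {b} I * P b ({b} ∪ I)) * ha1
  ext L
  rw [sigma_mul_apply]
  split_ifs with hi
  · have hL : {i} ∪ L \ {i} = L := Finset.union_sdiff_of_subset hi
    have hiL : i ∉ L \ {i} := by simp
    have := key (L \ {i}) i (c (L \ {i})) hiL (hc _)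
    rw [← this, hL, ← mul_assoc, sign_mul_self, one_mul]
  · exact apply_eq_zero_of_sigma_mul (hself i) (by simpa using hi)

theorem soul_apply_empty (X : SuperNumber) : soul X ∅ = 0 := by simp [soul, one_apply]

theorem body_add_soul (X : SuperNumber) : X ∅ • (1 : SuperNumber) + soul X = X := by simp [soul]

theorem soul_mem_evenPart {X : SuperNumber} (hX : X ∈ evenPart) : soul X ∈ evenPart :=
  fun I hI => by
    have : I ≠ ∅ := by rintro rfl; simp at hI
    simp [soul, one_apply, hX I hI, this]

theorem soul_add (X Y : SuperNumber) : soul (X + Y) = soul X + soul Y := by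
  simp only [soul, add_apply, add_smul]; abel

theorem soul_real_smul (c : ℝ) (X : SuperNumber) : soul (c • X) = c • soul X := by
  ext I; simp [soul, mul_sub, mul_assoc]

theorem continuous_soul : Continuous soul :=
  continuous_id.sub ((continuous_apply_coeff ∅).smul continuous_const)

end SuperNumber

/-! ### Calculus of supernumber-valued functions of one real variable. -/

/-- Coefficientwise derivative of a supernumber-valued function of a real variable. -/
def HasCoeffDerivAt (g : ℝ → SuperNumber) (v : SuperNumber) (t : ℝ) : Prop :=
  ∀ I, HasDerivAt (fun s => g s I) (v I) t

theorem hasDerivAtZero_iff {g : ℝ → SuperNumber} {v : SuperNumber} :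
    HasDerivAtZero ℝ g v ↔ HasCoeffDerivAt g v 0 := by
  unfold HasDerivAtZero HasCoeffDerivAt
  rw [tendsto_iff_coeff]
  refine forall_congr' fun I => ?_
  rw [hasDerivAt_iff_tendsto_slope_zero]
  simp

theorem hasDerivAtZero_complex_iff {g : ℂ → SuperNumber} {v : SuperNumber} :
    HasDerivAtZero ℂ g v ↔ ∀ I, HasDerivAt (fun z => g z I) (v I) 0 := by
  unfold HasDerivAtZero
  rw [tendsto_iff_coeff]
  refine forall_congr' fun I => ?_
  rw [hasDerivAt_iff_tendsto_slope_zero]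
  simp

namespace HasCoeffDerivAt

variable {g h : ℝ → SuperNumber} {v w : SuperNumber} {t : ℝ}

theorem unique (h1 : HasCoeffDerivAt g v t) (h2 : HasCoeffDerivAt g w t) : v = w :=
  SuperNumber.ext fun I => (h1 I).unique (h2 I)

theorem congr_of_eventuallyEq (h1 : HasCoeffDerivAt g v t) (e : h =ᶠ[𝓝 t] g) :
    HasCoeffDerivAt h v t := fun I => (h1 I).congr_of_eventuallyEq <| by
  filter_upwards [e] with s hs; rw [hs]

theorem const (c : SuperNumber) (t : ℝ) : HasCoeffDerivAt (fun _ => c) 0 t :=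
  fun I => hasDerivAt_const t (c I)

theorem add (h1 : HasCoeffDerivAt g v t) (h2 : HasCoeffDerivAt h w t) :
    HasCoeffDerivAt (fun s => g s + h s) (v + w) t := fun I => (h1 I).add (h2 I)

theorem neg (h1 : HasCoeffDerivAt g v t) : HasCoeffDerivAt (fun s => -g s) (-v) t :=
  fun I => (h1 I).neg

theorem sub (h1 : HasCoeffDerivAt g v t) (h2 : HasCoeffDerivAt h w t) :
    HasCoeffDerivAt (fun s => g s - h s) (v - w) t := fun I => (h1 I).sub (h2 I)

theorem sum {ι : Type*} {s : Finset ι} {g : ι → ℝ → SuperNumber} {v : ι → SuperNumber}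
    (h : ∀ i ∈ s, HasCoeffDerivAt (g i) (v i) t) :
    HasCoeffDerivAt (fun x => ∑ i ∈ s, g i x) (∑ i ∈ s, v i) t := fun I => by
  simpa using HasDerivAt.fun_sum fun i hi => h i hi I

theorem mul (h1 : HasCoeffDerivAt g v t) (h2 : HasCoeffDerivAt h w t) :
    HasCoeffDerivAt (fun s => g s * h s) (v * h t + g t * w) t := fun I => by
  simp only [mul_apply, add_apply, ← Finset.sum_add_distrib]
  refine HasDerivAt.fun_sum fun J _ => ?_
  exact ((h1 J).const_mul (sign J (I \ J))).mul (h2 (I \ J))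

theorem const_mul (c : SuperNumber) (h1 : HasCoeffDerivAt g v t) :
    HasCoeffDerivAt (fun s => c * g s) (c * v) t := by
  simpa using (const c t).mul h1

theorem const_smul (c : ℂ) (h1 : HasCoeffDerivAt g v t) :
    HasCoeffDerivAt (fun s => c • g s) (c • v) t := fun I => (h1 I).const_mul c

theorem line (X H : SuperNumber) (t : ℝ) : HasCoeffDerivAt (fun s => X + s • H) H t :=
  fun I => by
    have := (((hasDerivAt_id t).ofReal_comp).mul_const (H I)).const_add (X I)
    simpa using this

/-- The chain rule for translations of the parameter. -/
theorem comp_add_iff : HasCoeffDerivAt (fun s => g (t + s)) v 0 ↔ HasCoeffDerivAt g v t := by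
  refine forall_congr' fun I => ?_
  constructor
  · intro h
    have := HasDerivAt.comp_sub_const t t (f := fun s => g (t + s) I) (by simpa using h)
    simpa using this
  · intro h
    exact HasDerivAt.comp_const_add t 0 (by simpa using h)

theorem eq_of_deriv_zero (h : ∀ t ∈ Icc (0 : ℝ) 1, HasCoeffDerivAt g 0 t) :
    ∀ t ∈ Icc (0 : ℝ) 1, g t = g 0 := fun t ht =>
  SuperNumber.ext fun I => constant_of_has_deriv_right_zero (f := fun s => g s I)
    (fun t ht => (h t ht I).continuousAt.continuousWithinAt)
    (fun t ht => ((h t (Ico_subset_Icc_self ht)) I).hasDerivWithinAt) t ht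

theorem sub_eq_of_deriv_const (h : ∀ t ∈ Icc (0 : ℝ) 1, HasCoeffDerivAt g v t) :
    g 1 = g 0 + v := by
  have := eq_of_deriv_zero (g := fun t => g t - (0 + t • v)) fun t ht => by
    simpa using (h t ht).sub (line 0 v t)
  replace this := this 1 (right_mem_Icc.2 zero_le_one)
  simp only [one_smul, zero_add, zero_smul, sub_zero] at this
  rw [← this]; abel

end HasCoeffDerivAt

namespace HasCoeffDerivAt

variable {g : ℝ → SuperNumber} {v : SuperNumber} {t : ℝ}

/-- Only the velocity `v` has to be even, since it is the only factor moved to the front. At `k = 0`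
the truncated exponent is multiplied by `0`. -/
theorem pow (hg : HasCoeffDerivAt g v t) (hv : v ∈ evenPart) (k : ℕ) :
    HasCoeffDerivAt (fun r => g r ^ k) ((k : ℂ) • (v * g t ^ (k - 1))) t := by
  induction k with
  | zero => simpa using const 1 t
  | succ k ih =>
    have := ih.mul hg
    simp only [pow_succ]
    convert this using 1
    rcases k with _ | k
    · simp
    · simp only [Nat.add_sub_cancel, pow_succ]
      rw [← even_mul_comm hv (g t ^ k * g t), smul_mul_assoc, mul_assoc v]
      push_cast
      rw [add_smul _ (1 : ℂ), one_smul]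

end HasCoeffDerivAt

/-! ### Formal Taylor sums with nilpotent-type increments. -/

/-- The monomial `s_1^{α_1} ⋯ s_m^{α_m}`. -/
noncomputable def superMonomial {m : ℕ} (s : Fin m → SuperNumber) (α : Fin m → ℕ) : SuperNumber :=
  (List.ofFn fun j => s j ^ α j).prod

section ExpSum

variable {m : ℕ}

theorem superMonomial_succ (s : Fin (m + 1) → SuperNumber) (α : Fin (m + 1) → ℕ) :
    superMonomial s α
      = s 0 ^ α 0 * superMonomial (fun j => s j.succ) (fun j => α j.succ) := by
  simp [superMonomial, List.ofFn_succ]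

theorem superMonomial_zero (s : Fin m → SuperNumber) : superMonomial s 0 = 1 := by
  simp [superMonomial]

theorem superMonomial_apply_eq_zero : ∀ {m : ℕ} {s : Fin m → SuperNumber}
    (_ : ∀ j, s j ∅ = 0) (α : Fin m → ℕ) (I : Finset ℕ),
    I.card < ∑ j, α j → superMonomial s α I = 0
  | 0, _, _, _, _, h => by simp at h
  | m + 1, s, hs, α, I, h => by
    rw [superMonomial_succ]
    have e : soul (s 0) = s 0 := by simp [soul, hs 0]
    refine mul_apply_eq_zero_of_card_lt (e ▸ soul_pow_apply_eq_zero (s 0) (α 0))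
      (superMonomial_apply_eq_zero (fun j => hs j.succ) fun j => α j.succ) I ?_
    rwa [Fin.sum_univ_succ] at h

theorem hasCoeffDerivAt_superMonomial : ∀ {m : ℕ} {s : ℝ → Fin m → SuperNumber}
    {S : Fin m → SuperNumber} {t : ℝ} (_ : ∀ j, S j ∈ evenPart)
    (_ : ∀ j, HasCoeffDerivAt (fun r => s r j) (S j) t) (α : Fin m → ℕ),
    HasCoeffDerivAt (fun r => superMonomial (s r) α)
      (∑ j, (α j : ℂ) • (S j * superMonomial (s t) (α - Pi.single j 1))) t
  | 0, _, _, t, _, _, _ => by simpa [superMonomial] using HasCoeffDerivAt.const 1 t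
  | m + 1, s, S, t, hS, hs, α => by
    simp only [superMonomial_succ]
    have := ((hs 0).pow (hS 0) (α 0)).mul
      (hasCoeffDerivAt_superMonomial (fun j => hS j.succ) (fun j => hs j.succ) fun j => α j.succ)
    convert this using 1
    rw [Fin.sum_univ_succ]
    congr 1
    · have : (fun j : Fin m => (α - Pi.single 0 1 : Fin (m + 1) → ℕ) j.succ) = fun j => α j.succ := by
        funext j; simp
      rw [this]
      simp [mul_assoc, smul_mul_assoc]
    · rw [Finset.mul_sum]
      refine Finset.sum_congr rfl fun j _ => ?_
      have e1 : (fun i : Fin m => (α - Pi.single j.succ 1 : Fin (m + 1) → ℕ) i.succ)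
          = (fun i => α i.succ) - Pi.single j 1 := by
        funext i; simp [Pi.single_apply]
      have e2 : (α - Pi.single j.succ 1 : Fin (m + 1) → ℕ) 0 = α 0 := by simp
      rw [e1, e2, mul_smul_comm, ← mul_assoc, ← mul_assoc, even_mul_comm (hS _) (s t 0 ^ α 0)]

theorem superMultiIndex_summable {a : (Fin m → ℕ) → SuperNumber} {k : ℕ}
    (ha : ∀ α (I : Finset ℕ), I.card + k < ∑ j, α j → a α I = 0) : Summable a := by
  have key : ∀ I : Finset ℕ, Summable fun α => a α I := by
    intro I
    refine summable_of_hasFiniteSupport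
      ((Set.finite_Iic (fun _ : Fin m => I.card + k)).subset fun α hα j => ?_)
    by_contra hj
    refine hα (ha α I (lt_of_lt_of_le (not_le.1 hj) ?_))
    exact Finset.single_le_sum (f := α) (fun _ _ => Nat.zero_le _) (Finset.mem_univ j)
  exact Pi.summable.2 key

/-- The box of multi-indices depends on `I` alone and not on the terms, so limits and derivatives of
Taylor sums reduce to those of finite sums. -/
theorem superMultiIndex_tsum_apply {a : (Fin m → ℕ) → SuperNumber} {k : ℕ}
    (ha : ∀ α (I : Finset ℕ), I.card + k < ∑ j, α j → a α I = 0) {I : Finset ℕ} {N : ℕ}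
    (hN : I.card + k ≤ N) :
    (∑' α, a α) I = ∑ α ∈ Finset.Iic (fun _ : Fin m => N), a α I := by
  have h1 : (∑' α, a α) I = ∑' α, a α I :=
    tsum_apply (f := fun α => (a α : Finset ℕ → ℂ)) (superMultiIndex_summable ha)
  rw [h1]
  refine tsum_eq_sum fun α hα => ?_
  rw [Finset.mem_Iic, Pi.le_def, not_forall] at hα
  obtain ⟨j, hj⟩ := hα
  refine ha α I (lt_of_le_of_lt hN (lt_of_lt_of_le (not_le.1 hj) ?_))
  exact Finset.single_le_sum (f := α) (fun _ _ => Nat.zero_le _) (Finset.mem_univ j)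

/-- The term of index `α` in the formal Taylor series with derivatives `h α` and increment `s`. -/
noncomputable def taylorTerm (s : Fin m → SuperNumber) (h : (Fin m → ℕ) → SuperNumber)
    (α : Fin m → ℕ) : SuperNumber :=
  ((∏ j, ((α j).factorial : ℂ))⁻¹) • (h α * superMonomial s α)

/-- The formal Taylor series `∑_α (1/α!) h_α s^α`. -/
noncomputable def taylorSum (s : Fin m → SuperNumber) (h : (Fin m → ℕ) → SuperNumber) :
    SuperNumber := ∑' α, taylorTerm s h α

theorem taylorTerm_apply_eq_zero {s : Fin m → SuperNumber} (hs : ∀ j, s j ∅ = 0)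
    (h : (Fin m → ℕ) → SuperNumber) (α : Fin m → ℕ) (I : Finset ℕ) (hI : I.card < ∑ j, α j) :
    taylorTerm s h α I = 0 := by
  have := mul_apply_eq_zero_of_card_lt (X := h α) (k := 0) (by intro I hI; omega)
    (superMonomial_apply_eq_zero hs α) I (by omega)
  simp [taylorTerm, this]

theorem taylorSum_apply {s : Fin m → SuperNumber} (hs : ∀ j, s j ∅ = 0)
    (h : (Fin m → ℕ) → SuperNumber) {I : Finset ℕ} {N : ℕ} (hN : I.card ≤ N) :
    taylorSum s h I = ∑ α ∈ Finset.Iic (fun _ : Fin m => N), taylorTerm s h α I :=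
  superMultiIndex_tsum_apply (k := 0) (taylorTerm_apply_eq_zero hs h) hN

theorem taylorSum_zero (h : (Fin m → ℕ) → SuperNumber) : taylorSum 0 h = h 0 := by
  have : taylorTerm (0 : Fin m → SuperNumber) h 0 = h 0 := by
    simp [taylorTerm, superMonomial_zero]
  rw [taylorSum, tsum_eq_single 0, this]
  intro α hα
  obtain ⟨j, hj⟩ := Function.ne_iff.1 hα
  have : superMonomial (0 : Fin m → SuperNumber) α = 0 := by
    unfold superMonomial
    refine List.prod_eq_zero ?_
    rw [List.mem_ofFn]
    exact ⟨j, zero_pow hj⟩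
  simp [taylorTerm, this]

theorem taylorSum_congr {s : Fin m → SuperNumber} {h h' : (Fin m → ℕ) → SuperNumber}
    (e : ∀ α, h α = h' α) : taylorSum s h = taylorSum s h' := by
  rw [funext e]

theorem prod_factorial_add_single (β : Fin m → ℕ) (j : Fin m) :
    (∏ i, (((β + Pi.single j 1 : Fin m → ℕ) i).factorial : ℂ))
      = (β j + 1 : ℂ) * ∏ i, ((β i).factorial : ℂ) := by
  rw [← Finset.mul_prod_erase _ _ (Finset.mem_univ j),
    ← Finset.mul_prod_erase (Finset.univ) (fun i => ((β i).factorial : ℂ)) (Finset.mem_univ j),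
    ← mul_assoc]
  congr 1
  · simp [Nat.factorial_succ]
  · refine Finset.prod_congr rfl fun i hi => ?_
    simp [Finset.ne_of_mem_erase hi]

/-- Velocities add: a jet moving with velocity `c` contributes `c_j`, and differentiating `s^α / α!`
lowers `α` by one, which after reindexing contributes `S_j` in front of the same shifted sum. The
applications differ only in `c` and `S`: opposite velocities give constancy, body plus soul gives
the continuation formula, `H` minus its soul gives descent to the body. -/
theorem hasCoeffDerivAt_taylorSum {s : ℝ → Fin m → SuperNumber} {S c : Fin m → SuperNumber}
    {h : (Fin m → ℕ) → ℝ → SuperNumber} {t : ℝ} (hs0 : ∀ r j, s r j ∅ = 0)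
    (hS : ∀ j, S j ∈ evenPart) (hS0 : ∀ j, S j ∅ = 0)
    (hs : ∀ j, HasCoeffDerivAt (fun r => s r j) (S j) t)
    (hh : ∀ α, HasCoeffDerivAt (h α) (∑ j, c j * h (α + Pi.single j 1) t) t) :
    HasCoeffDerivAt (fun r => taylorSum (s r) fun α => h α r)
      (∑ j, (c j + S j) * taylorSum (s t) fun α => h (α + Pi.single j 1) t) t := by
  set B : Fin m → (Fin m → ℕ) → SuperNumber := fun j α =>
    ((∏ i, ((α i).factorial : ℂ))⁻¹) •
      ((α j : ℂ) • (S j * (h α t * superMonomial (s t) (α - Pi.single j 1)))) with hB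
  set A : Fin m → (Fin m → ℕ) → SuperNumber := fun j α =>
    c j * taylorTerm (s t) (fun α => h (α + Pi.single j 1) t) α with hA
  have hA0 : ∀ j α (I : Finset ℕ), I.card + 0 < ∑ i, α i → A j α I = 0 := fun j α I hI =>
    mul_apply_eq_zero_of_card_lt (X := c j) (k := 0) (by intro I hI; omega)
      (taylorTerm_apply_eq_zero (hs0 t) _ α) I (by omega)
  have hsub : ∀ (j : Fin m) (α : Fin m → ℕ), α j ≠ 0 → α - Pi.single j 1 + Pi.single j 1 = α :=
    fun j α hα => tsub_add_cancel_of_le (by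
      intro i; rcases eq_or_ne i j with rfl | hi
      · simp; omega
      · simp [hi])
  -- The degree lost in lowering `α` is regained from the factor `S j`, which has no body.
  have hB0 : ∀ j α (I : Finset ℕ), I.card + 0 < ∑ i, α i → B j α I = 0 := fun j α I hI => by
    rcases eq_or_ne (α j) 0 with h0 | h0
    · simp [hB, h0]
    have e : ∑ i, α i = 1 + ∑ i, (α - Pi.single j 1 : Fin m → ℕ) i := by
      conv_lhs => rw [← hsub j α h0]
      simp only [Pi.add_apply, Finset.sum_add_distrib, Finset.sum_pi_single', Finset.mem_univ,
        if_true]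
      rw [add_comm]
    have h2 : ∀ J : Finset ℕ, J.card < ∑ i, (α - Pi.single j 1 : Fin m → ℕ) i →
        (h α t * superMonomial (s t) (α - Pi.single j 1)) J = 0 := fun J hJ =>
      mul_apply_eq_zero_of_card_lt (X := h α t) (k := 0) (by intro I hI; omega)
        (superMonomial_apply_eq_zero (hs0 t) _) J (by omega)
    have h3 := mul_apply_eq_zero_of_card_lt (X := S j) (k := 1)
      (by intro J hJ; rw [Finset.card_eq_zero.1 (Nat.lt_one_iff.1 hJ)]; exact hS0 j) h2 I (by omega)
    simp [hB, h3]
  have hAs : ∀ j, ∑' α, A j α = c j * taylorSum (s t) fun α => h (α + Pi.single j 1) t :=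
    fun j => Summable.tsum_mul_left _ (superMultiIndex_summable (k := 0)
      (taylorTerm_apply_eq_zero (hs0 t) _))
  have hBs : ∀ j, ∑' α, B j α = S j * taylorSum (s t) fun α => h (α + Pi.single j 1) t := by
    intro j
    -- Reindexing by `α = β + e_j`; the indices missed have `α j = 0`, where `B` vanishes, and the
    -- factor `α j` cancels against the factorial.
    have hinj : Function.Injective fun β : Fin m → ℕ => β + Pi.single j 1 :=
      add_left_injective _
    rw [← hinj.tsum_eq, taylorSum, ← Summable.tsum_mul_left _ (superMultiIndex_summable
      (k := 0) (taylorTerm_apply_eq_zero (hs0 t) _))]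
    · refine tsum_congr fun β => ?_
      have hne : (β j + 1 : ℂ) ≠ 0 := by exact_mod_cast Nat.succ_ne_zero (β j)
      simp only [hB, taylorTerm]
      rw [prod_factorial_add_single, add_tsub_cancel_right, smul_smul, mul_smul_comm]
      congr 1
      simp only [Pi.add_apply, Pi.single_eq_same, Nat.cast_add, Nat.cast_one]
      field_simp
    · intro α hα
      have h0 : α j ≠ 0 := by rintro h0; exact hα (by simp [hB, h0])
      exact ⟨α - Pi.single j 1, hsub j α h0⟩
  intro I
  have hval : (∑ j, (c j + S j) * taylorSum (s t) fun α => h (α + Pi.single j 1) t) I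
      = ∑ α ∈ Finset.Iic (fun _ : Fin m => I.card), (∑ j, (A j α + B j α)) I := by
    have e1 : (∑ j, (c j + S j) * taylorSum (s t) fun α => h (α + Pi.single j 1) t)
        = ∑ j, (∑' α, A j α + ∑' α, B j α) := by
      refine Finset.sum_congr rfl fun j _ => ?_
      rw [hAs, hBs, add_mul]
    rw [e1, sum_apply]
    simp only [add_apply, superMultiIndex_tsum_apply (hA0 _) (le_refl (I.card + 0)),
      superMultiIndex_tsum_apply (hB0 _) (le_refl (I.card + 0)), sum_apply, add_zero]
    rw [Finset.sum_comm]
    exact Finset.sum_congr rfl fun j _ => Finset.sum_add_distrib.symm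
  rw [hval]
  simp only [fun r => taylorSum_apply (hs0 r) (fun α => h α r) (le_refl I.card)]
  refine HasDerivAt.fun_sum fun α _ => ?_
  have hd := (((hh α).mul (hasCoeffDerivAt_superMonomial hS hs α)).const_smul
    ((∏ i, ((α i).factorial : ℂ))⁻¹)) I
  suffices e : ∑ j, (A j α + B j α) = _ by rw [e]; exact hd
  rw [Finset.sum_mul, Finset.mul_sum, ← Finset.sum_add_distrib, Finset.smul_sum]
  refine Finset.sum_congr rfl fun j _ => ?_
  simp only [hA, hB, taylorTerm]
  rw [smul_add, mul_smul_comm, mul_smul_comm, mul_assoc, ← mul_assoc (S j), ← mul_assoc (h α t),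
    even_mul_comm (hS j)]

/-- `exp(s∂) exp(-s∂) = 1`. -/
theorem taylorSum_taylorSum_neg {s : Fin m → SuperNumber} (hs0 : ∀ j, s j ∅ = 0)
    (hs : ∀ j, s j ∈ evenPart) (h : (Fin m → ℕ) → SuperNumber) :
    taylorSum s (fun α => taylorSum (-s) fun β => h (α + β)) = h 0 := by
  have hr : ∀ (r : ℝ) j, (r • s) j ∅ = 0 := fun r j => by simp [hs0 j]
  have hline : ∀ (t : ℝ) j, HasCoeffDerivAt (fun r => (r • s) j) (s j) t := fun t j => by
    simpa using HasCoeffDerivAt.line 0 (s j) t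
  have h1 : ∀ (α : Fin m → ℕ) (t : ℝ),
      HasCoeffDerivAt (fun r : ℝ => taylorSum (-(r • s)) fun β => h (α + β))
        (∑ j, (-s j) * taylorSum (-(t • s)) fun β => h (α + Pi.single j 1 + β)) t := by
    intro α t
    have := hasCoeffDerivAt_taylorSum (s := fun r => -(r • s)) (S := -s) (c := 0)
      (h := fun β _ => h (α + β)) (t := t) (fun r j => by simp [hs0 j])
      (fun j => neg_mem (hs j)) (fun j => by simp [hs0 j]) (fun j => (hline t j).neg)
      (fun β => by simpa using HasCoeffDerivAt.const (h (α + β)) t)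
    simpa [add_assoc, add_comm, add_left_comm] using this
  -- With increment `r s` the outer sum has velocity `s` and, by `h1`, its jet has velocity `-s`:
  -- they cancel, and at `r = 0` the expression is `h 0`.
  have h2 : ∀ t : ℝ, HasCoeffDerivAt
      (fun r : ℝ => taylorSum (r • s) fun α => taylorSum (-(r • s)) fun β => h (α + β)) 0 t := by
    intro t
    have := hasCoeffDerivAt_taylorSum (s := fun r => r • s) (S := s) (c := -s)
      (h := fun α r => taylorSum (-(r • s)) fun β => h (α + β)) (t := t) hr hs hs0 (hline t)
      (fun α => h1 α t)
    simpa using this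
  have := HasCoeffDerivAt.eq_of_deriv_zero (fun t _ => h2 t) 1 (right_mem_Icc.2 zero_le_one)
  simpa [taylorSum_zero] using this

/-- A coefficient of a Taylor series is the coefficient of its constant term up to lower ones. -/
theorem taylorSum_apply_inj {s : Fin m → SuperNumber} (hs0 : ∀ j, s j ∅ = 0)
    {h h' : (Fin m → ℕ) → SuperNumber} {I : Finset ℕ}
    (hlt : ∀ α (J : Finset ℕ), J.card < I.card → h α J = h' α J)
    (heq : taylorSum s h I = taylorSum s h' I) : h 0 I = h' 0 I := by
  have h0 : (0 : Fin m → ℕ) ∈ Finset.Iic (fun _ : Fin m => I.card) :=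
    Finset.mem_Iic.2 fun _ => Nat.zero_le _
  rw [taylorSum_apply hs0 h le_rfl, taylorSum_apply hs0 h' le_rfl,
    ← Finset.add_sum_erase _ (fun α => taylorTerm s h α I) h0,
    ← Finset.add_sum_erase _ (fun α => taylorTerm s h' α I) h0] at heq
  have e : ∀ α ∈ (Finset.Iic (fun _ : Fin m => I.card)).erase 0,
      taylorTerm s h α I = taylorTerm s h' α I := by
    intro α hα
    have hα0 : 0 < ∑ j, α j := by
      obtain ⟨j, hj⟩ := Function.ne_iff.1 (Finset.ne_of_mem_erase hα)
      exact Finset.sum_pos' (fun _ _ => Nat.zero_le _) ⟨j, Finset.mem_univ j, Nat.pos_of_ne_zero hj⟩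
    simp only [taylorTerm, smul_apply, mul_apply]
    congr 1
    refine Finset.sum_congr rfl fun J hJ => ?_
    rcases eq_or_ne J I with rfl | hJI
    -- The coefficient of `h α` at `I` itself is paired with the body of `s^α`, which vanishes for
    -- `α ≠ 0`; the remaining terms involve only smaller `J`.
    · have : superMonomial s α (J \ J) = 0 :=
        superMonomial_apply_eq_zero hs0 α _ (by simpa using hα0)
      rw [this, mul_zero, mul_zero]
    · rw [hlt α J (Finset.card_lt_card ((Finset.mem_powerset.1 hJ).ssubset_of_ne hJI))]
  rw [Finset.sum_congr rfl e] at heq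
  simpa [taylorTerm, superMonomial_zero] using add_right_cancel heq

theorem taylorSum_apply_empty {s : Fin m → SuperNumber} (hs0 : ∀ j, s j ∅ = 0)
    (h : (Fin m → ℕ) → SuperNumber) : taylorSum s h ∅ = h 0 ∅ := by
  rw [taylorSum_apply hs0 h (N := 0) (by simp), Finset.sum_eq_single 0]
  · simp [taylorTerm, superMonomial_zero]
  · intro α hα hne
    exact absurd (le_antisymm (Finset.mem_Iic.1 hα) fun _ => Nat.zero_le _) hne
  · intro h0; exact absurd (Finset.mem_Iic.2 fun _ => Nat.zero_le _) h0

theorem continuousOn_superMonomial {E : Type*} [TopologicalSpace E] {U : Set E} :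
    ∀ {m : ℕ} {s : E → Fin m → SuperNumber} (_ : ∀ j, ContinuousOn (fun x => s x j) U)
    (α : Fin m → ℕ), ContinuousOn (fun x => superMonomial (s x) α) U
  | 0, _, _, _ => by simpa [superMonomial] using continuousOn_const
  | m + 1, s, hs, α => by
    simp only [superMonomial_succ]
    exact ((hs 0).pow _).mul (continuousOn_superMonomial (fun j => hs j.succ) _)

theorem continuousOn_taylorSum {E : Type*} [TopologicalSpace E] {U : Set E}
    {s : E → Fin m → SuperNumber} {h : (Fin m → ℕ) → E → SuperNumber}
    (hs0 : ∀ x j, s x j ∅ = 0) (hs : ∀ j, ContinuousOn (fun x => s x j) U)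
    (hh : ∀ α, ContinuousOn (h α) U) :
    ContinuousOn (fun x => taylorSum (s x) fun α => h α x) U := by
  rw [continuousOn_iff_coeff]
  intro I
  simp only [fun x => taylorSum_apply (hs0 x) (fun α => h α x) (le_refl I.card)]
  refine continuousOn_finsetSum _ fun α _ => ?_
  exact continuousOn_const.mul
    (continuousOn_iff_coeff.1 ((hh α).mul (continuousOn_superMonomial hs α)) I)

theorem grassmannContinuation_eq_taylorSum (u : (Fin m → ℝ) → SuperNumber)
    (x : Fin m → realEven) : grassmannContinuation u x
      = taylorSum (fun j => soul (x j)) fun α => superMultiDeriv α u (evenBody x) := rfl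

end ExpSum

/-! ### Operators commuting up to equality on an open set, and their iterates. -/

/-- Operators `∂ i` on a class `C`, compatible with an equivalence `r` and commuting up to `r`. -/
structure CommutingOperators {ι F : Type*} (D : ι → F → F) (r : F → F → Prop) (C : F → Prop) :
    Prop where
  equiv : Equivalence r
  mem : ∀ i g, C g → C (D i g)
  congr : ∀ i g g', C g → C g' → r g g' → r (D i g) (D i g')
  comm : ∀ i j g, C g → r (D i (D j g)) (D j (D i g))

section Operators

variable {ι F : Type*} {D : ι → F → F} {r : F → F → Prop} {C : F → Prop}

/-- The composition of the `D_j^{α_j}`, `j ∈ l`. -/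
def iterOps (D : ι → F → F) (l : List ι) (α : ι → ℕ) (g : F) : F :=
  l.foldr (fun j h => (D j)^[α j] h) g

namespace CommutingOperators

theorem iterate_mem (hD : CommutingOperators D r C) (i : ι) {g : F} (hg : C g) (k : ℕ) :
    C ((D i)^[k] g) := by
  induction k with
  | zero => exact hg
  | succ k ih => rw [Function.iterate_succ_apply']; exact hD.mem i _ ih

theorem iterate_congr (hD : CommutingOperators D r C) (i : ι) {g g' : F} (hg : C g) (hg' : C g')
    (h : r g g') (k : ℕ) : r ((D i)^[k] g) ((D i)^[k] g') := by
  induction k with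
  | zero => exact h
  | succ k ih =>
    rw [Function.iterate_succ_apply', Function.iterate_succ_apply']
    exact hD.congr i _ _ (hD.iterate_mem i hg k) (hD.iterate_mem i hg' k) ih

theorem iterate_comm (hD : CommutingOperators D r C) (i j : ι) {g : F} (hg : C g) (k : ℕ) :
    r (D j ((D i)^[k] g)) ((D i)^[k] (D j g)) := by
  induction k with
  | zero => exact hD.equiv.refl _
  | succ k ih =>
    rw [Function.iterate_succ_apply', Function.iterate_succ_apply']
    have hk := hD.iterate_mem i hg k
    exact hD.equiv.trans (hD.comm j i _ hk)
      (hD.congr i _ _ (hD.mem j _ hk) (hD.iterate_mem i (hD.mem j _ hg) k) ih)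

theorem iterOps_mem (hD : CommutingOperators D r C) (l : List ι) (α : ι → ℕ) {g : F} (hg : C g) :
    C (iterOps D l α g) := by
  induction l with
  | nil => exact hg
  | cons i l ih => exact hD.iterate_mem i ih _

theorem iterOps_comm (hD : CommutingOperators D r C) (l : List ι) (α : ι → ℕ) (j : ι) {g : F}
    (hg : C g) : r (D j (iterOps D l α g)) (iterOps D l α (D j g)) := by
  induction l with
  | nil => exact hD.equiv.refl _
  | cons i l ih =>
    exact hD.equiv.trans (hD.iterate_comm i j (hD.iterOps_mem l α hg) _)
      (hD.iterate_congr i (hD.mem j _ (hD.iterOps_mem l α hg))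
        (hD.iterOps_mem l α (hD.mem j _ hg)) ih _)

end CommutingOperators

variable [DecidableEq ι]

theorem iterOps_add_single_of_notMem {l : List ι} {j : ι} (hj : j ∉ l) (α : ι → ℕ) (g : F) :
    iterOps D l (α + Pi.single j 1) g = iterOps D l α g := by
  induction l with
  | nil => rfl
  | cons i l ih =>
    simp only [List.mem_cons, not_or] at hj
    have := ih hj.2
    simp only [iterOps, List.foldr_cons] at this ⊢
    rw [this]
    simp [Ne.symm hj.1]

theorem CommutingOperators.iterOps_add_single (hD : CommutingOperators D r C) {l : List ι}
    (hl : l.Nodup) {j : ι} (hj : j ∈ l) (α : ι → ℕ) {g : F} (hg : C g) :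
    r (D j (iterOps D l α g)) (iterOps D l (α + Pi.single j 1) g) := by
  induction l with
  | nil => simp at hj
  | cons i l ih =>
    have hcons : ∀ β : ι → ℕ, iterOps D (i :: l) β g = (D i)^[β i] (iterOps D l β g) :=
      fun _ => rfl
    rw [List.nodup_cons] at hl
    rw [hcons, hcons]
    rcases eq_or_ne j i with rfl | hji
    · rw [iterOps_add_single_of_notMem hl.1]
      simp only [Pi.add_apply, Pi.single_eq_same, Function.iterate_succ_apply']
      exact hD.equiv.refl _
    · have hjl := (List.mem_cons.1 hj).resolve_left hji
      simp only [Pi.add_apply, Pi.single_eq_of_ne hji.symm, add_zero]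
      have hm := hD.iterOps_mem l α hg
      exact hD.equiv.trans (hD.iterate_comm i j hm _)
        (hD.iterate_congr i (hD.mem j _ hm) (hD.iterOps_mem l _ hg) (ih hl.2 hjl) _)

end Operators

/-! ### Partial derivatives on open subsets of `ℝ^m` and smoothness from directional derivatives. -/

section PartialDerivatives

variable {m : ℕ} {V : Set (Fin m → ℝ)}

theorem equivalence_eqOn {A B : Type*} (s : Set A) :
    Equivalence fun f g : A → B => EqOn f g s :=
  ⟨fun _ => eqOn_refl _ _, fun h => h.symm, fun h h' => h.trans h'⟩

theorem partialDeriv_congr (hV : IsOpen V) {g g' : (Fin m → ℝ) → ℂ} (h : EqOn g g' V)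
    (j : Fin m) : EqOn (partialDeriv j g) (partialDeriv j g') V := fun q hq => by
  have : g =ᶠ[𝓝 q] g' := h.eventuallyEq_of_mem (hV.mem_nhds hq)
  exact this.lineDeriv_eq

theorem partialDeriv_eq_fderiv (hV : IsOpen V) {g : (Fin m → ℝ) → ℂ} (hg : ContDiffOn ℝ ∞ g V)
    (j : Fin m) : EqOn (partialDeriv j g) (fun q => fderiv ℝ g q (Pi.single j 1)) V :=
  fun q hq => ((hg.contDiffAt (hV.mem_nhds hq)).differentiableAt (by simp)).lineDeriv_eq_fderiv

theorem contDiffOn_partialDeriv (hV : IsOpen V) {g : (Fin m → ℝ) → ℂ} (hg : ContDiffOn ℝ ∞ g V)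
    (j : Fin m) : ContDiffOn ℝ ∞ (partialDeriv j g) V := by
  refine ContDiffOn.congr ?_ (partialDeriv_eq_fderiv hV hg j)
  exact (hg.fderiv_of_isOpen hV (m := ∞) (by simp)).clm_apply contDiffOn_const

theorem partialDeriv_comm (hV : IsOpen V) {g : (Fin m → ℝ) → ℂ} (hg : ContDiffOn ℝ ∞ g V)
    (i j : Fin m) :
    EqOn (partialDeriv i (partialDeriv j g)) (partialDeriv j (partialDeriv i g)) V := by
  have key : ∀ i j : Fin m, EqOn (partialDeriv i (partialDeriv j g))
      (fun q => fderiv ℝ (fderiv ℝ g) q (Pi.single i 1) (Pi.single j 1)) V := by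
    intro i j q hq
    rw [partialDeriv_eq_fderiv hV (contDiffOn_partialDeriv hV hg j) i hq]
    have e : partialDeriv j g =ᶠ[𝓝 q] fun q => fderiv ℝ g q (Pi.single j 1) :=
      (partialDeriv_eq_fderiv hV hg j).eventuallyEq_of_mem (hV.mem_nhds hq)
    have hd : DifferentiableAt ℝ (fderiv ℝ g) q :=
      ((hg.fderiv_of_isOpen hV (m := ∞) (by simp)).contDiffAt
        (hV.mem_nhds hq)).differentiableAt (by simp)
    simp only [e.fderiv_eq]
    rw [fderiv_clm_apply hd (differentiableAt_const _)]
    simp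
  intro q hq
  rw [key i j hq, key j i hq]
  exact (hg.contDiffAt (hV.mem_nhds hq)).isSymmSndFDerivAt (by
    rw [minSmoothness_of_isRCLikeNormedField]; exact ENat.LEInfty.out) _ _

theorem commutingOperators_partialDeriv (hV : IsOpen V) :
    CommutingOperators (partialDeriv (m := m)) (fun f g => EqOn f g V)
      (fun g => ContDiffOn ℝ ∞ g V) where
  equiv := equivalence_eqOn V
  mem i _ hg := contDiffOn_partialDeriv hV hg i
  congr i _ _ _ _ h := partialDeriv_congr hV h i
  comm i j _ hg := partialDeriv_comm hV hg i j

theorem multiDeriv_congr (hV : IsOpen V) {g g' : (Fin m → ℝ) → ℂ} (h : EqOn g g' V)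
    (α : Fin m → ℕ) : EqOn (multiDeriv α g) (multiDeriv α g') V := by
  unfold multiDeriv
  induction List.finRange m with
  | nil => exact h
  | cons i l ih =>
    simp only [List.foldr_cons]
    induction α i with
    | zero => exact ih
    | succ k ihk =>
      rw [Function.iterate_succ_apply', Function.iterate_succ_apply']
      exact partialDeriv_congr hV ihk i

/-- A Gâteaux derivative which is linear and norm continuous is a Fréchet derivative. -/
theorem hasFDerivAt_of_lineDeriv {E : Type*} [NormedAddCommGroup E] [NormedSpace ℝ E]
    {V : Set E} (hV : IsOpen V) {φ : E → ℂ} {L : E → E →L[ℝ] ℂ} (hL : ContinuousOn L V)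
    (hφ : ∀ x ∈ V, ∀ h, HasDerivAt (fun t : ℝ => φ (x + t • h)) (L x h) 0) {x : E} (hx : x ∈ V) :
    HasFDerivAt φ (L x) x := by
  rw [hasFDerivAt_iff_isLittleO, Asymptotics.isLittleO_iff]
  intro ε hε
  have h1 : ∀ᶠ y in 𝓝 x, y ∈ V ∧ ‖L y - L x‖ < ε := by
    refine Filter.Eventually.and (hV.mem_nhds hx) ?_
    have := (hL.continuousAt (hV.mem_nhds hx)).tendsto
    simpa [dist_eq_norm] using (Metric.tendsto_nhds.1 this ε hε)
  obtain ⟨δ, hδ, hball⟩ := Metric.eventually_nhds_iff_ball.1 h1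
  filter_upwards [Metric.ball_mem_nhds x hδ] with y hy
  have hseg : ∀ t ∈ Icc (0 : ℝ) 1, x + t • (y - x) ∈ Metric.ball x δ := fun t ht => by
    have := (convex_ball x δ).add_smul_sub_mem (Metric.mem_ball_self hδ) hy ht
    exact this
  have hd : ∀ t ∈ Icc (0 : ℝ) 1, HasDerivWithinAt
      (fun t : ℝ => φ (x + t • (y - x)) - t • L x (y - x))
      (L (x + t • (y - x)) (y - x) - L x (y - x)) (Icc 0 1) t := fun t ht => by
    have h2 := hφ _ (hball _ (hseg t ht)).1 (y - x)
    have h3 : HasDerivAt (fun s : ℝ => φ (x + s • (y - x))) (L (x + t • (y - x)) (y - x)) t := by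
      have h4 : HasDerivAt (fun s : ℝ => φ (x + t • (y - x) + s • (y - x)))
        (L (x + t • (y - x)) (y - x)) (t - t) := by rwa [sub_self]
      have := h4.comp_sub_const t t
      refine this.congr_of_eventuallyEq (Eventually.of_forall fun s => ?_)
      simp only [add_assoc, ← add_smul]
      congr 3; ring_nf
    have h5 := (hasDerivAt_id t).smul_const (L x (y - x))
    simp only [id, one_smul] at h5
    exact (h3.sub h5).hasDerivWithinAt
  -- Mean value inequality on the segment from `x` to `y` for `φ` minus its linear part at `x`.
  have := norm_image_sub_le_of_norm_deriv_le_segment_01' hd (C := ε * ‖y - x‖) fun t ht => by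
    rw [← _root_.sub_apply]
    exact (ContinuousLinearMap.le_opNorm _ _).trans
      (mul_le_mul_of_nonneg_right (hball _ (hseg t (Ico_subset_Icc_self ht))).2.le (norm_nonneg _))
  simpa [sub_right_comm] using this

/-- A family of functions closed under continuous partial derivatives. -/
structure DerivativeFamily {A : Type*} (V : Set (Fin m → ℝ)) (φ : A → (Fin m → ℝ) → ℂ)
    (d : Fin m → A → A) : Prop where
  cont : ∀ a, ContinuousOn (φ a) V
  deriv : ∀ a, ∀ q ∈ V, ∀ η : Fin m → ℝ,
    HasDerivAt (fun t : ℝ => φ a (q + t • η)) (∑ j, (η j : ℂ) * φ (d j a) q) 0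

namespace DerivativeFamily

variable {A : Type*} {φ : A → (Fin m → ℝ) → ℂ} {d : Fin m → A → A}

theorem hasFDerivAt (h : DerivativeFamily V φ d) (hV : IsOpen V) (a : A) {q : Fin m → ℝ}
    (hq : q ∈ V) : HasFDerivAt (φ a)
      (∑ j, (ContinuousLinearMap.proj (R := ℝ) (φ := fun _ : Fin m => ℝ) j).smulRight
        (φ (d j a) q)) q := by
  refine hasFDerivAt_of_lineDeriv hV (L := fun q => ∑ j,
    (ContinuousLinearMap.proj (R := ℝ) (φ := fun _ : Fin m => ℝ) j).smulRight (φ (d j a) q))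
    ?_ (fun x hx η => ?_) hq
  · refine continuousOn_finsetSum _ fun j _ => ?_
    exact ((ContinuousLinearMap.smulRightL ℝ (Fin m → ℝ) ℂ
      (ContinuousLinearMap.proj j)).continuous).comp_continuousOn (h.cont _)
  · simpa using h.deriv a x hx η

/-- Bootstrap: the Fréchet derivative of a member is a finite combination of members of the same
family, so each step of the induction gains one order for all members at once. -/
theorem contDiffOn (h : DerivativeFamily V φ d) (hV : IsOpen V) (a : A) :
    ContDiffOn ℝ ∞ (φ a) V := by
  rw [contDiffOn_infty]
  intro n
  induction n generalizing a with
  | zero => exact contDiffOn_zero.2 (h.cont a)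
  | succ n ih =>
    rw [Nat.cast_succ, contDiffOn_succ_iff_fderiv_of_isOpen hV]
    refine ⟨fun q hq => (h.hasFDerivAt hV a hq).differentiableAt.differentiableWithinAt,
      by simp, ?_⟩
    refine ContDiffOn.congr ?_ fun q hq => (h.hasFDerivAt hV a hq).fderiv
    refine ContDiffOn.sum fun j _ => ?_
    exact ((ContinuousLinearMap.smulRightL ℝ (Fin m → ℝ) ℂ
      (ContinuousLinearMap.proj j)).contDiff).comp_contDiffOn (ih _)

theorem partialDeriv_eqOn (h : DerivativeFamily V φ d) (a : A) (j : Fin m) :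
    EqOn (partialDeriv j (φ a)) (φ (d j a)) V := fun q hq => by
  have := (h.deriv a q hq (Pi.single j 1)).deriv
  rw [Finset.sum_eq_single j (by intro i _ hi; simp [hi]) (by simp)] at this
  simpa [partialDeriv, lineDeriv] using this

/-- Mixed partial derivatives commute. -/
theorem comm (h : DerivativeFamily V φ d) (hV : IsOpen V) (a : A) (i j : Fin m) :
    EqOn (φ (d i (d j a))) (φ (d j (d i a))) V := by
  have key : ∀ i j : Fin m, EqOn (φ (d i (d j a))) (partialDeriv i (partialDeriv j (φ a))) V :=
    fun i j => ((partialDeriv_congr hV (h.partialDeriv_eqOn a j) i).trans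
      (h.partialDeriv_eqOn _ i)).symm
  exact (key i j).trans ((partialDeriv_comm hV (h.contDiffOn hV a) i j).trans (key j i).symm)

theorem multiDeriv_eqOn {φ : (Fin m → ℕ) → (Fin m → ℝ) → ℂ}
    (h : DerivativeFamily V φ fun j α => α + Pi.single j 1) (hV : IsOpen V) (α : Fin m → ℕ) :
    EqOn (multiDeriv α (φ 0)) (φ α) V := by
  have key : ∀ l : List (Fin m), EqOn (l.foldr (fun j h => (partialDeriv j)^[α j] h) (φ 0))
      (φ (l.map fun j => Pi.single j (α j)).sum) V := by
    intro l
    induction l with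
    | nil => exact eqOn_refl _ _
    | cons i l ih =>
      have : ∀ k, EqOn ((partialDeriv i)^[k] (l.foldr (fun j h => (partialDeriv j)^[α j] h) (φ 0)))
          (φ (Pi.single i k + (l.map fun j => Pi.single j (α j)).sum)) V := by
        intro k
        induction k with
        | zero => simpa using ih
        | succ k ihk =>
          rw [Function.iterate_succ_apply']
          refine (partialDeriv_congr hV ihk i).trans ((h.partialDeriv_eqOn _ i).trans ?_)
          rw [add_right_comm, ← Pi.single_add]
          exact eqOn_refl _ _
      simpa using this (α i)
  have e := key (List.finRange m)
  rw [← List.ofFn_eq_map, List.sum_ofFn, Finset.univ_sum_single] at e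
  exact e

end DerivativeFamily

theorem derivativeFamily_multiDeriv (hV : IsOpen V) {g : (Fin m → ℝ) → ℂ}
    (hg : ContDiffOn ℝ ∞ g V) :
    DerivativeFamily V (fun α => multiDeriv α g) fun j α => α + Pi.single j 1 where
  cont α := ((commutingOperators_partialDeriv hV).iterOps_mem (List.finRange m) α hg).continuousOn
  deriv α q hq η := by
    have hα := (commutingOperators_partialDeriv hV).iterOps_mem (List.finRange m) α hg
    have hd := ((hα.contDiffAt (hV.mem_nhds hq)).differentiableAt (by simp)).hasFDerivAt
    have := hd.hasLineDerivAt η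
    rw [← Finset.univ_sum_single η, map_sum] at this
    rw [HasLineDerivAt, Finset.univ_sum_single] at this
    refine HasDerivAt.congr_deriv this ?_
    refine Finset.sum_congr rfl fun j _ => ?_
    have e1 := (commutingOperators_partialDeriv hV).iterOps_add_single (List.nodup_finRange m)
      (List.mem_finRange j) α hg hq
    have e2 : _ = fderiv ℝ (iterOps partialDeriv (List.finRange m) α g) q (Pi.single j 1) :=
      partialDeriv_eq_fderiv hV hα j hq
    have e3 : (Pi.single j (η j) : Fin m → ℝ) = η j • Pi.single j 1 := by
      rw [← Pi.single_smul]; simp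
    rw [e3, map_smul, Complex.real_smul, ← e2]
    exact congrArg _ e1

theorem multiDeriv_partialDeriv (hV : IsOpen V) {g : (Fin m → ℝ) → ℂ}
    (hg : ContDiffOn ℝ ∞ g V) (α : Fin m → ℕ) (j : Fin m) :
    EqOn (multiDeriv α (partialDeriv j g)) (multiDeriv (α + Pi.single j 1) g) V :=
  ((commutingOperators_partialDeriv hV).iterOps_comm (List.finRange m) α j hg).symm.trans
    ((commutingOperators_partialDeriv hV).iterOps_add_single (List.nodup_finRange m)
      (List.mem_finRange j) α hg)

end PartialDerivatives

/-! ### Coordinate directions and the body map. -/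

namespace SuperSpace

variable {m n : ℕ}

/-- The tangent vector `y ∂/∂x_j`. -/
noncomputable def evenDir (j : Fin m) (y : realEven) : SuperSpace m n := (Pi.single j y, 0)

/-- The tangent vector `y ∂/∂θ_k`. -/
noncomputable def oddDir (k : Fin n) (y : realOdd) : SuperSpace m n := (0, Pi.single k y)

/-- A point of `ℝ^m` as a point without soul and odd coordinates. -/
noncomputable def ofBody (q : Fin m → ℝ) : SuperSpace m n :=
  (fun j => q j • ⟨1, one_mem_realEven⟩, 0)

/-- The generator `σ_i` as an odd number. -/
noncomputable def gen (i : ℕ) : realOdd := 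
  ⟨sigma {i}, by simpa using smul_sigma_mem_realOdd (I := {i}) (by simp) 1⟩

theorem coord_add (H K : SuperSpace m n) (A : Fin m ⊕ Fin n) :
    coord (H + K) A = coord H A + coord K A := by rcases A with j | k <;> rfl

theorem continuous_coord (A : Fin m ⊕ Fin n) :
    Continuous fun X : SuperSpace m n => coord X A := by
  rcases A with j | k
  · exact continuous_subtype_val.comp ((continuous_apply j).comp continuous_fst)
  · exact continuous_subtype_val.comp ((continuous_apply k).comp continuous_snd)

theorem coord_inl_mem (X : SuperSpace m n) (j : Fin m) : coord X (.inl j) ∈ evenPart := (X.1 j).2.2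

theorem coord_inr_mem (X : SuperSpace m n) (k : Fin n) : coord X (.inr k) ∈ oddPart := (X.2 k).2.2

theorem coord_evenDir_self (j : Fin m) (y : realEven) :
    coord (evenDir j y : SuperSpace m n) (.inl j) = y := by simp [coord, evenDir]

theorem coord_evenDir_of_ne {j : Fin m} {A : Fin m ⊕ Fin n} (h : A ≠ .inl j) (y : realEven) :
    coord (evenDir j y) A = 0 := by
  rcases A with i | k
  · have : i ≠ j := by rintro rfl; exact h rfl
    simp [coord, evenDir, this]
  · simp [coord, evenDir]

theorem coord_oddDir_self (k : Fin n) (y : realOdd) :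
    coord (oddDir k y : SuperSpace m n) (.inr k) = y := by simp [coord, oddDir]

theorem coord_oddDir_of_ne {k : Fin n} {A : Fin m ⊕ Fin n} (h : A ≠ .inr k) (y : realOdd) :
    coord (oddDir k y) A = 0 := by
  rcases A with i | l
  · simp [coord, oddDir]
  · have : l ≠ k := by rintro rfl; exact h rfl
    simp [coord, oddDir, this]

theorem sum_coord_evenDir (j : Fin m) (y : realEven) (F : Fin m ⊕ Fin n → SuperNumber) :
    ∑ A, coord (evenDir j y) A * F A = y * F (.inl j) := by
  rw [Finset.sum_eq_single (.inl j), coord_evenDir_self]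
  · intro A _ hA; rw [coord_evenDir_of_ne hA, zero_mul]
  · simp

theorem sum_coord_oddDir (k : Fin n) (y : realOdd) (F : Fin m ⊕ Fin n → SuperNumber) :
    ∑ A, coord (oddDir k y) A * F A = y * F (.inr k) := by
  rw [Finset.sum_eq_single (.inr k), coord_oddDir_self]
  · intro A _ hA; rw [coord_oddDir_of_ne hA, zero_mul]
  · simp

/-- An even coordinate can be tested with the direction `1`; an odd one only with odd multiples,
where all generators together separate. This makes superderivatives unique. -/
theorem eq_of_sum_coord {F G : Fin m ⊕ Fin n → SuperNumber}
    (h : ∀ H : SuperSpace m n, ∑ A, coord H A * F A = ∑ A, coord H A * G A) : F = G := by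
  funext A
  rcases A with j | k
  · have := h (evenDir j ⟨1, one_mem_realEven⟩)
    rw [sum_coord_evenDir, sum_coord_evenDir] at this
    simpa using this
  · refine eq_of_sigma_mul fun i => ?_
    have := h (oddDir k (gen i))
    rwa [sum_coord_oddDir, sum_coord_oddDir] at this

theorem oddDir_smul (k : Fin n) (t : ℝ) (y : realOdd) :
    (oddDir k (t • y) : SuperSpace m n) = t • oddDir k y := by
  simp [oddDir, Pi.single_smul]

theorem oddDir_add (k : Fin n) (y z : realOdd) :
    (oddDir k (y + z) : SuperSpace m n) = oddDir k y + oddDir k z := by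
  simp [oddDir, Pi.single_add]

theorem evenDir_smul (j : Fin m) (t : ℝ) (y : realEven) :
    (evenDir j (t • y) : SuperSpace m n) = t • evenDir j y := by
  simp [evenDir, Pi.single_smul]

theorem evenDir_add (j : Fin m) (y z : realEven) :
    (evenDir j (y + z) : SuperSpace m n) = evenDir j y + evenDir j z := by
  simp [evenDir, Pi.single_add]

theorem continuous_evenDir (j : Fin m) :
    Continuous (evenDir j : realEven → SuperSpace m n) :=
  (continuous_single (A := fun _ : Fin m => realEven) j).prodMk continuous_const

theorem continuous_oddDir (k : Fin n) :
    Continuous (oddDir k : realOdd → SuperSpace m n) :=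
  continuous_const.prodMk (continuous_single (A := fun _ : Fin n => realOdd) k)

theorem continuous_evenBody : Continuous (evenBody : (Fin m → realEven) → Fin m → ℝ) :=
  continuous_pi fun j => Complex.continuous_re.comp
    ((continuous_apply_coeff ∅).comp (continuous_subtype_val.comp (continuous_apply j)))

theorem evenBody_add (x y : Fin m → realEven) : evenBody (x + y) = evenBody x + evenBody y := by
  funext j; simp [evenBody]

theorem evenBody_smul (t : ℝ) (x : Fin m → realEven) : evenBody (t • x) = t • evenBody x := by
  funext j; simp [evenBody]

theorem body_add (X Y : SuperSpace m n) : body (X + Y) = body X + body Y := evenBody_add _ _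

theorem body_smul (t : ℝ) (X : SuperSpace m n) : body (t • X) = t • body X := evenBody_smul _ _

theorem evenBody_coe (x : Fin m → realEven) (j : Fin m) : (evenBody x j : ℂ) = (x j : SuperNumber) ∅ :=
  Complex.ext rfl (by simpa using (x j).2.1.symm)

theorem evenBody_smul_one_add_soul (x : Fin m → realEven) (j : Fin m) :
    (evenBody x j : ℂ) • (1 : SuperNumber) + soul (x j) = x j := by
  rw [evenBody_coe, body_add_soul]

theorem continuous_ofBody : Continuous (ofBody : (Fin m → ℝ) → SuperSpace m n) :=
  Continuous.prodMk (continuous_pi fun j => (continuous_apply j).smul continuous_const)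
    continuous_const

theorem body_ofBody (q : Fin m → ℝ) : body (ofBody q : SuperSpace m n) = q := by
  funext j; simp [body, evenBody, ofBody, one_apply]

theorem ofBody_add (q p : Fin m → ℝ) :
    (ofBody (q + p) : SuperSpace m n) = ofBody q + ofBody p := by
  ext1
  · funext j; simp [ofBody, add_smul]
  · simp [ofBody]

theorem ofBody_smul (t : ℝ) (q : Fin m → ℝ) :
    (ofBody (t • q) : SuperSpace m n) = t • ofBody q := by
  ext1
  · funext j; simp [ofBody, mul_smul]
  · simp [ofBody]

theorem sum_coord_ofBody (q : Fin m → ℝ) (F : Fin m ⊕ Fin n → SuperNumber) :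
    ∑ A, coord (ofBody q) A * F A = ∑ j, (q j : ℂ) • F (.inl j) := by
  rw [Fintype.sum_sum_type]
  simp only [coord, ofBody, Sum.elim_inl, Sum.elim_inr]
  simp

theorem continuous_line (X H : SuperSpace m n) : Continuous fun t : ℝ => X + t • H :=
  continuous_const.add (continuous_id.smul continuous_const)

theorem eventually_line_mem {U : Set (SuperSpace m n)} (hU : IsOpen U) {X H : SuperSpace m n}
    {t : ℝ} (h : X + t • H ∈ U) : ∀ᶠ s in 𝓝 t, X + s • H ∈ U :=
  (continuous_line X H).continuousAt.eventually_mem (hU.mem_nhds h)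

/-- Translation by soulless vectors is a continuous local section of the body map. -/
theorem isOpen_body {U : Set (SuperSpace m n)} (hU : IsOpen U) : IsOpen (body '' U) := by
  rw [isOpen_iff_mem_nhds]
  rintro _ ⟨X, hX, rfl⟩
  have hc : Continuous fun q : Fin m → ℝ => X + ofBody (q - body X) :=
    continuous_const.add (continuous_ofBody.comp (continuous_id.sub continuous_const))
  have h0 : X + ofBody (body X - body X) = X := by
    rw [sub_self]; simpa using ofBody_smul (n := n) 0 (body X)
  filter_upwards [hc.continuousAt.eventually_mem (hU.mem_nhds (by rwa [h0]))] with q hq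
  exact ⟨_, hq, by rw [body_add, body_ofBody]; abel⟩

end SuperSpace

/-! ### Superderivatives and the class `𝒢_SD^∞`. -/

section SuperDerivative

variable {m n : ℕ} {U : Set (SuperSpace m n)}

/-- `F_A` are superderivatives of `f` on `U`. -/
def HasSuperDeriv (U : Set (SuperSpace m n)) (f : SuperSpace m n → SuperNumber)
    (F : Fin m ⊕ Fin n → SuperSpace m n → SuperNumber) : Prop :=
  ∀ X ∈ U, ∀ H : SuperSpace m n,
    HasDerivAtZero ℝ (fun t : ℝ => f (X + t • H)) (∑ A, coord H A * F A X)

namespace HasSuperDeriv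

variable {f g : SuperSpace m n → SuperNumber}
  {F G : Fin m ⊕ Fin n → SuperSpace m n → SuperNumber}

theorem line (h : HasSuperDeriv U f F) {X H : SuperSpace m n} {t : ℝ} (ht : X + t • H ∈ U) :
    HasCoeffDerivAt (fun s => f (X + s • H)) (∑ A, coord H A * F A (X + t • H)) t := by
  rw [← HasCoeffDerivAt.comp_add_iff]
  simpa only [add_smul, add_assoc] using hasDerivAtZero_iff.1 (h _ ht H)

theorem line_zero (h : HasSuperDeriv U f F) {X : SuperSpace m n} (hX : X ∈ U)
    (H : SuperSpace m n) :
    HasCoeffDerivAt (fun s => f (X + s • H)) (∑ A, coord H A * F A X) 0 :=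
  hasDerivAtZero_iff.1 (h X hX H)

theorem congr (h : HasSuperDeriv U f F) (hU : IsOpen U) (e : EqOn f g U)
    (e' : ∀ A, EqOn (F A) (G A) U) : HasSuperDeriv U g G := fun X hX H => by
  rw [hasDerivAtZero_iff]
  have : ∑ A, coord H A * G A X = ∑ A, coord H A * F A X :=
    Finset.sum_congr rfl fun A _ => by rw [e' A hX]
  rw [this]
  refine (h.line_zero hX H).congr_of_eventuallyEq ?_
  filter_upwards [eventually_line_mem hU (X := X) (H := H) (t := 0) (by simpa using hX)] with s hs
  exact (e hs).symm

theorem unique (h : HasSuperDeriv U f F) (h' : HasSuperDeriv U f G) (A : Fin m ⊕ Fin n) :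
    EqOn (F A) (G A) U := fun X hX => by
  refine congrFun (eq_of_sum_coord (F := (F · X)) (G := (G · X)) fun H => ?_) A
  exact (h.line_zero hX H).unique (h'.line_zero hX H)

/-- The definition of order `r ≥ 1` asks only the `F_A` to be continuous. For `Y` near `X` the
derivative along the segment, `∑ (Y - X)_A F_A`, is small in the given coefficient, uniformly in `t`
by compactness of `[0, 1]`; the mean value inequality concludes without a norm on superspace. -/
theorem continuousOn (h : HasSuperDeriv U f F) (hU : IsOpen U) (hF : ∀ A, ContinuousOn (F A) U) :
    ContinuousOn f U := by
  rw [continuousOn_iff_coeff]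
  intro I X hX
  refine ContinuousAt.continuousWithinAt ?_
  rw [ContinuousAt, Metric.tendsto_nhds]
  intro ε hε
  set φ : SuperSpace m n × ℝ → SuperSpace m n := fun p => X + p.2 • (p.1 - X) with hφ
  have hφc : Continuous φ :=
    continuous_const.add (continuous_snd.smul (continuous_fst.sub continuous_const))
  have key : ∀ t ∈ Icc (0 : ℝ) 1, ∀ᶠ p in 𝓝 (X, t), φ p ∈ U ∧
      ‖(∑ A, coord (p.1 - X) A * F A (φ p)) I‖ < ε := by
    intro t _
    have hφX : φ (X, t) = X := by simp [hφ]
    have hUn : ∀ᶠ p in 𝓝 (X, t), φ p ∈ U :=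
      hφc.continuousAt.eventually_mem (hU.mem_nhds (by rwa [hφX]))
    refine hUn.and ?_
    have hc : ContinuousAt (fun p : SuperSpace m n × ℝ =>
        ∑ A, coord (p.1 - X) A * F A (φ p)) (X, t) := by
      refine tendsto_finsetSum _ fun A _ => ?_
      refine ContinuousAt.mul
        ((continuous_coord A).comp (continuous_fst.sub continuous_const)).continuousAt ?_
      refine ContinuousAt.comp ?_ hφc.continuousAt
      rw [hφX]; exact (hF A).continuousAt (hU.mem_nhds hX)
    have h0 : ∑ A, coord (X - X) A * F A (φ (X, t)) = 0 := by
      refine Finset.sum_eq_zero fun A _ => ?_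
      have : coord (X - X) A = 0 := by
        rw [sub_self]; rcases A with j | k <;> rfl
      rw [this, zero_mul]
    have hc' : Tendsto (fun p : SuperSpace m n × ℝ => (∑ A, coord (p.1 - X) A * F A (φ p)) I)
        (𝓝 (X, t)) (𝓝 0) := by
      have := ((continuous_apply_coeff I).continuousAt.tendsto).comp hc.tendsto
      rw [h0] at this
      exact this
    have := Metric.tendsto_nhds.1 hc' ε hε
    simpa using this
  have h1 : ∀ᶠ Y in 𝓝 X, ∀ t ∈ Icc (0 : ℝ) 1, φ (Y, t) ∈ U ∧
      ‖(∑ A, coord (Y - X) A * F A (φ (Y, t))) I‖ < ε :=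
    isCompact_Icc.eventually_forall_of_forall_eventually key
  filter_upwards [h1] with Y hY
  have hd : ∀ t ∈ Icc (0 : ℝ) 1, HasDerivWithinAt (fun s : ℝ => f (X + s • (Y - X)) I)
      ((∑ A, coord (Y - X) A * F A (X + t • (Y - X))) I) (Icc 0 1) t := fun t ht =>
    (h.line (hY t ht).1 I).hasDerivWithinAt
  have hcont : ContinuousOn (fun t : ℝ => ‖(∑ A, coord (Y - X) A * F A (X + t • (Y - X))) I‖)
      (Icc 0 1) := by
    refine ContinuousOn.norm (continuousOn_iff_coeff.1 (continuousOn_finsetSum _ fun A _ => ?_) I)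
    exact continuousOn_const.mul ((hF A).comp (continuous_line X (Y - X)).continuousOn
      fun t ht => (hY t ht).1)
  -- Bounding by the attained maximum keeps the inequality with `ε` strict.
  obtain ⟨t0, ht0, hmax⟩ := isCompact_Icc.exists_isMaxOn (nonempty_Icc.2 zero_le_one) hcont
  have := norm_image_sub_le_of_norm_deriv_le_segment_01' hd
    (C := ‖(∑ A, coord (Y - X) A * F A (X + t0 • (Y - X))) I‖)
    fun t ht => hmax (Ico_subset_Icc_self ht)
  rw [dist_eq_norm]
  refine lt_of_le_of_lt ?_ (hY t0 ht0).2
  simpa using this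

end HasSuperDeriv

variable {W : Submodule ℝ SuperNumber} {f g : SuperSpace m n → SuperNumber}

theorem isSuperDiff_succ {W : Set SuperNumber} {r : ℕ} : IsSuperDiff U W (r + 1) f ↔
    MapsTo f U W ∧ ∃ F : Fin m ⊕ Fin n → SuperSpace m n → SuperNumber,
      (∀ A, MapsTo (F A) U W ∧ ContinuousOn (F A) U) ∧ HasSuperDeriv U f F ∧
      ∀ A, IsSuperDiff U W r (F A) := Iff.rfl

namespace IsSuperDiff

variable {W : Set SuperNumber} {r : ℕ}

theorem congr (hU : IsOpen U) (h : IsSuperDiff U W r f) (e : EqOn f g U) :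
    IsSuperDiff U W r g := by
  cases r with
  | zero => exact ⟨h.1.congr e, h.2.congr e.symm⟩
  | succ r =>
    obtain ⟨h1, F, h2, h3, h4⟩ := isSuperDiff_succ.1 h
    exact ⟨h1.congr e, F, h2, h3.congr hU e fun A => eqOn_refl _ _, h4⟩

theorem mapsTo (h : IsSuperDiff U W r f) : MapsTo f U W := by
  cases r with
  | zero => exact h.1
  | succ r => exact h.1

theorem continuousOn (hU : IsOpen U) (h : IsSuperDiff U W r f) : ContinuousOn f U := by
  cases r with
  | zero => exact h.2
  | succ r =>
    obtain ⟨h1, F, h2, h3, h4⟩ := isSuperDiff_succ.1 h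
    exact h3.continuousOn hU fun A => (h2 A).2

end IsSuperDiff

/-- Coinduction for superdifferentiability. -/
theorem isSuperDiffInfty_of_class {W : Set SuperNumber} (P : (SuperSpace m n → SuperNumber) → Prop)
    (hP : ∀ f, P f → MapsTo f U W ∧ ContinuousOn f U ∧ ∃ F, HasSuperDeriv U f F ∧ ∀ A, P (F A))
    (hf : P f) : IsSuperDiffInfty U W f := by
  have : ∀ r f, P f → IsSuperDiff U W r f := by
    intro r
    induction r with
    | zero => exact fun f hf => ⟨(hP f hf).1, (hP f hf).2.1⟩
    | succ r ih =>
      intro f hf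
      obtain ⟨h1, h2, F, h3, h4⟩ := hP f hf
      exact ⟨h1, F, fun A => ⟨(hP _ (h4 A)).1, (hP _ (h4 A)).2.1⟩, h3, fun A => ih _ (h4 A)⟩
  exact fun r _ => this r f hf

namespace IsSuperDiffInfty

variable {W : Set SuperNumber}

theorem mapsTo (h : IsSuperDiffInfty U W f) : MapsTo f U W := (h 1 le_rfl).mapsTo

theorem continuousOn (hU : IsOpen U) (h : IsSuperDiffInfty U W f) : ContinuousOn f U :=
  (h 1 le_rfl).continuousOn hU

/-- The definition allows different `F_A` for each order `r`; uniqueness of superderivatives shows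
that those of order one serve for all. -/
theorem exists_superDeriv (hU : IsOpen U) (h : IsSuperDiffInfty U W f) :
    ∃ F, HasSuperDeriv U f F ∧ ∀ A, IsSuperDiffInfty U W (F A) := by
  obtain ⟨_, F, _, hF, _⟩ := isSuperDiff_succ.1 (h 1 le_rfl)
  refine ⟨F, hF, fun A r hr => ?_⟩
  obtain ⟨_, G, _, hG, hG'⟩ := isSuperDiff_succ.1 (h (r + 1) (by omega))
  exact (hG' A).congr hU (hG.unique hF A)

theorem congr (hU : IsOpen U) (h : IsSuperDiffInfty U W f) (e : EqOn f g U) :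
    IsSuperDiffInfty U W g := fun r hr => (h r hr).congr hU e

end IsSuperDiffInfty

open Classical in
/-- The superderivatives `F_A` of a function of class `𝒢_SD^∞`. -/
noncomputable def superDeriv (U : Set (SuperSpace m n)) (W : Set SuperNumber)
    (A : Fin m ⊕ Fin n) (f : SuperSpace m n → SuperNumber) : SuperSpace m n → SuperNumber :=
  if h : ∃ F, HasSuperDeriv U f F ∧ ∀ A, IsSuperDiffInfty U W (F A) then h.choose A else 0

namespace IsSuperDiffInfty

variable {W : Set SuperNumber}

theorem hasSuperDeriv (h : IsSuperDiffInfty U W f) (hU : IsOpen U) :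
    HasSuperDeriv U f fun A => superDeriv U W A f := by
  have := h.exists_superDeriv hU
  simp only [superDeriv, dif_pos this]
  exact this.choose_spec.1

theorem superDeriv (h : IsSuperDiffInfty U W f) (hU : IsOpen U) (A : Fin m ⊕ Fin n) :
    IsSuperDiffInfty U W (superDeriv U W A f) := by
  have := h.exists_superDeriv hU
  simp only [_root_.superDeriv, dif_pos this]
  exact this.choose_spec.2 A

theorem superDeriv_congr (h : IsSuperDiffInfty U W f) (h' : IsSuperDiffInfty U W g)
    (hU : IsOpen U) (e : EqOn f g U) (A : Fin m ⊕ Fin n) :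
    EqOn (_root_.superDeriv U W A f) (_root_.superDeriv U W A g) U :=
  ((h.hasSuperDeriv hU).congr hU e fun _ => eqOn_refl _ _).unique (h'.hasSuperDeriv hU) A

/-- Derivatives with respect to the even coordinates commute. -/
theorem superDeriv_inl_comm (h : IsSuperDiffInfty U W f) (hU : IsOpen U) (i j : Fin m) :
    EqOn (_root_.superDeriv U W (.inl i) (_root_.superDeriv U W (.inl j) f))
      (_root_.superDeriv U W (.inl j) (_root_.superDeriv U W (.inl i) f)) U := fun X hX => by
  ext I
  set V : Set (Fin m → ℝ) := (fun q => X + ofBody q) ⁻¹' U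
  have hc : Continuous fun q : Fin m → ℝ => (X + ofBody q : SuperSpace m n) :=
    continuous_const.add continuous_ofBody
  have h0 : (X + ofBody 0 : SuperSpace m n) = X := by
    simpa using ofBody_smul (m := m) (n := n) 0 0
  -- On the slice `X + ℝ^m` the even superderivatives are ordinary partial derivatives. The family
  -- is indexed by all of `𝒢_SD^∞`, so that iterated superderivatives belong to it.
  have hfam : DerivativeFamily V
      (fun (a : {f // IsSuperDiffInfty U W f}) (q : Fin m → ℝ) => a.1 (X + ofBody q) I)
      (fun j a => ⟨_root_.superDeriv U W (.inl j) a.1, a.2.superDeriv hU _⟩) := by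
    constructor
    · intro a
      exact (continuousOn_iff_coeff.1 (a.2.continuousOn hU) I).comp hc.continuousOn
        fun q hq => hq
    · intro a q hq η
      have := (a.2.hasSuperDeriv hU).line_zero (X := X + ofBody q) hq (ofBody η) I
      rw [sum_coord_ofBody η fun A => _root_.superDeriv U W A a.1 (X + ofBody q)] at this
      simpa [ofBody_add, ofBody_smul, add_assoc] using this
  have := hfam.comm (hU.preimage hc) ⟨f, h⟩ i j
    (show (0 : Fin m → ℝ) ∈ V by change X + ofBody 0 ∈ U; rwa [h0])
  simpa [h0] using this

theorem commutingOperators (hU : IsOpen U) :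
    CommutingOperators (fun j : Fin m => _root_.superDeriv U W (.inl j))
      (fun f g => EqOn f g U) (fun f : SuperSpace m n → SuperNumber => IsSuperDiffInfty U W f) where
  equiv := equivalence_eqOn U
  mem _ _ hg := hg.superDeriv hU _
  congr _ _ _ hg hg' e := hg.superDeriv_congr hg' hU e _
  comm i j _ hg := hg.superDeriv_inl_comm hU i j

end IsSuperDiffInfty

end SuperDerivative

/-! ### From superfield expansions to superdifferentiability. -/

section Continuation

variable {m n : ℕ} {U : Set (SuperSpace m n)} {V : Set (Fin m → ℝ)}

/-- `∂u/∂q_j`, coefficientwise. -/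
noncomputable def superPartialDeriv (j : Fin m) (u : (Fin m → ℝ) → SuperNumber) :
    (Fin m → ℝ) → SuperNumber := fun q I => partialDeriv j (fun q' => u q' I) q

theorem IsSmoothOn.superPartialDeriv (hV : IsOpen V) {u : (Fin m → ℝ) → SuperNumber}
    (hu : IsSmoothOn V u) (j : Fin m) : IsSmoothOn V (superPartialDeriv j u) :=
  fun I => contDiffOn_partialDeriv hV (hu I) j

/-- For both target spaces membership is a condition on the body only, so corrections without body
never matter. -/
theorem mem_of_body_eq_zero {W : Submodule ℝ SuperNumber} (hW : W = ⊤ ∨ W = realBody)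
    {Y : SuperNumber} (hY : Y ∅ = 0) : Y ∈ W := by
  rcases hW with rfl | rfl
  · trivial
  · show (Y ∅).im = 0
    rw [hY, Complex.zero_im]

theorem mapsTo_superPartialDeriv {W : Submodule ℝ SuperNumber} (hW : W = ⊤ ∨ W = realBody)
    (hV : IsOpen V) {u : (Fin m → ℝ) → SuperNumber} (hu : IsSmoothOn V u)
    (huW : MapsTo u V W) (j : Fin m) : MapsTo (superPartialDeriv j u) V W := by
  rcases hW with rfl | rfl
  · exact fun _ _ => trivial
  intro q hq
  change (partialDeriv j (fun q' => u q' ∅) q).im = 0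
  have hd := ((((hu ∅).contDiffAt (hV.mem_nhds hq)).differentiableAt
    (by simp)).hasFDerivAt.hasLineDerivAt (Pi.single j 1)).lineDifferentiableAt.hasDerivAt
  have h1 := (Complex.imCLM.hasFDerivAt (x := u (q + (0 : ℝ) • Pi.single j 1) ∅)).comp_hasDerivAt
    (0 : ℝ) hd
  have hc : Continuous fun t : ℝ => q + t • (Pi.single j 1 : Fin m → ℝ) :=
    continuous_const.add (continuous_id.smul continuous_const)
  have h2 : (Complex.imCLM ∘ fun t : ℝ => u (q + t • Pi.single j 1) ∅) =ᶠ[𝓝 0] fun _ => 0 := by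
    filter_upwards [hc.continuousAt.eventually_mem (hV.mem_nhds (x := q + (0 : ℝ) • _)
      (by simpa using hq))] with t ht
    exact huW ht
  exact h1.unique ((hasDerivAt_const (0 : ℝ) (0 : ℝ)).congr_of_eventuallyEq h2)

theorem continuousOn_grassmannContinuation (hU : IsOpen U) {u : (Fin m → ℝ) → SuperNumber}
    (hu : IsSmoothOn (body '' U) u) :
    ContinuousOn (fun X : SuperSpace m n => grassmannContinuation u X.1) U := by
  simp only [grassmannContinuation_eq_taylorSum]
  refine continuousOn_taylorSum (s := fun (X : SuperSpace m n) j => soul (X.1 j))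
    (h := fun α X => superMultiDeriv α u (evenBody X.1)) (fun X j => soul_apply_empty _)
    (fun j => (continuous_soul.comp (continuous_coord (.inl j))).continuousOn) fun α => ?_
  rw [continuousOn_iff_coeff]
  intro I
  exact ((derivativeFamily_multiDeriv (isOpen_body hU) (hu I)).cont α).comp
    (continuous_evenBody.comp continuous_fst).continuousOn fun X hX => ⟨X, hX, rfl⟩

/-- The body of `H_j` acts through the derivatives of `u`, the soul through the monomials; the two
velocities add up to `H_j`. -/
theorem hasSuperDeriv_grassmannContinuation (hU : IsOpen U) {u : (Fin m → ℝ) → SuperNumber}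
    (hu : IsSmoothOn (body '' U) u) :
    HasSuperDeriv U (fun X => grassmannContinuation u X.1)
      (Sum.elim (fun j X => grassmannContinuation (superPartialDeriv j u) X.1) fun _ => 0) := by
  intro X hX H
  rw [hasDerivAtZero_iff]
  have hV := isOpen_body hU
  have hXV : evenBody X.1 ∈ body '' U := ⟨X, hX, rfl⟩
  have key := hasCoeffDerivAt_taylorSum (t := 0)
    (s := fun (r : ℝ) j => soul ((X + r • H).1 j)) (S := fun j => soul (H.1 j))
    (c := fun j => (evenBody H.1 j : ℂ) • 1)
    (h := fun α r => superMultiDeriv α u (evenBody (X + r • H).1))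
    (fun r j => soul_apply_empty _) (fun j => soul_mem_evenPart (H.1 j).2.2)
    (fun j => soul_apply_empty _)
    (fun j => by
      have := HasCoeffDerivAt.line (soul (X.1 j)) (soul (H.1 j)) 0
      simpa [soul_add, soul_real_smul] using this)
    (fun α I => by
      have := (derivativeFamily_multiDeriv hV (hu I)).deriv α _ hXV (evenBody H.1)
      simpa [superMultiDeriv, evenBody_add, evenBody_smul] using this)
  simp only [grassmannContinuation_eq_taylorSum] at key ⊢
  convert key using 1
  rw [Fintype.sum_sum_type]
  simp only [Sum.elim_inl, Sum.elim_inr, Pi.zero_apply, mul_zero, Finset.sum_const_zero, add_zero,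
    evenBody_smul_one_add_soul, zero_smul]
  refine Finset.sum_congr rfl fun j _ => ?_
  congr 1
  refine taylorSum_congr fun α => ?_
  ext I
  exact multiDeriv_partialDeriv hV (hu I) α j hXV

theorem grassmannContinuation_apply_empty (u : (Fin m → ℝ) → SuperNumber) (x : Fin m → realEven) :
    grassmannContinuation u x ∅ = u (evenBody x) ∅ := by
  rw [grassmannContinuation_eq_taylorSum, taylorSum_apply_empty fun j => soul_apply_empty _]
  have : ∀ l : List (Fin m), l.foldr (fun j h => (partialDeriv j)^[(0 : Fin m → ℕ) j] h)
      (fun q' => u q' ∅) = fun q' => u q' ∅ := by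
    intro l
    induction l with
    | nil => rfl
    | cons i l ih => simp
  exact congrFun (this _) _

/-- The closure of `𝒢_SD^∞` and the Grassmann continuations under sums and multiplication by odd
coordinates. -/
inductive SuperClosure (U : Set (SuperSpace m n)) (W : Submodule ℝ SuperNumber) :
    (SuperSpace m n → SuperNumber) → Prop
  | base {f} : IsSuperDiffInfty U W f → SuperClosure U W f
  | zero : SuperClosure U W fun _ => 0
  | continuation {u} : IsSmoothOn (body '' U) u → MapsTo u (body '' U) W →
      SuperClosure U W fun X => grassmannContinuation u X.1
  | add {f g} : SuperClosure U W f → SuperClosure U W g → SuperClosure U W fun X => f X + g X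
  | neg {f} : SuperClosure U W f → SuperClosure U W fun X => -f X
  | theta {f} (k : Fin n) : SuperClosure U W f → SuperClosure U W fun X => X.2 k * f X

/-- Leibniz rule: `H_A` has to be moved to the left of `θ_k`, which costs a sign exactly for odd
`A`. -/
theorem HasSuperDeriv.theta_mul {f : SuperSpace m n → SuperNumber}
    {F : Fin m ⊕ Fin n → SuperSpace m n → SuperNumber} (h : HasSuperDeriv U f F) (k : Fin n) :
    HasSuperDeriv U (fun X => X.2 k * f X)
      (Sum.elim (fun j X => X.2 k * F (.inl j) X)
        fun l X => (if l = k then f X else 0) + -(X.2 k * F (.inr l) X)) := by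
  intro X hX H
  rw [hasDerivAtZero_iff]
  have h1 := (HasCoeffDerivAt.line (X.2 k : SuperNumber) (H.2 k) 0).mul (h.line_zero hX H)
  have h2 : HasCoeffDerivAt (fun s : ℝ => ((X + s • H).2 k : SuperNumber) * f (X + s • H))
      (H.2 k * f X + X.2 k * ∑ A, coord H A * F A X) 0 := by simpa using h1
  convert h2 using 1
  rw [Fintype.sum_sum_type, Fintype.sum_sum_type]
  simp only [Sum.elim_inl, Sum.elim_inr, mul_add, Finset.sum_add_distrib, Finset.mul_sum]
  have e1 : ∀ j, coord H (.inl j) * (X.2 k * F (.inl j) X)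
      = X.2 k * (coord H (.inl j) * F (.inl j) X) := fun j => by
    rw [← mul_assoc, ← mul_assoc, even_mul_comm (coord_inl_mem H j)]
  have e2 : ∀ l, coord H (.inr l) * -(X.2 k * F (.inr l) X)
      = X.2 k * (coord H (.inr l) * F (.inr l) X) := fun l => by
    rw [mul_neg, ← mul_assoc, ← mul_assoc, odd_mul_odd (coord_inr_mem H l) (X.2 k).2.2, neg_mul,
      neg_neg]
  have e3 : ∑ l, coord H (.inr l) * (if l = k then f X else 0) = H.2 k * f X := by
    simp [coord]
  simp only [e1, e2, e3]
  abel

theorem SuperClosure.isSuperDiffInfty {W : Submodule ℝ SuperNumber} (hW : W = ⊤ ∨ W = realBody)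
    (hU : IsOpen U) {f : SuperSpace m n → SuperNumber} (hf : SuperClosure U W f) :
    IsSuperDiffInfty U W f := by
  -- The closure contains superderivatives of each of its members, as each constructor shows;
  -- coinduction does the rest.
  refine isSuperDiffInfty_of_class (SuperClosure U W) (fun f hf => ?_) hf
  have hV := isOpen_body hU
  induction hf with
  | base h =>
    obtain ⟨F, hF, hF'⟩ := h.exists_superDeriv hU
    exact ⟨h.mapsTo, h.continuousOn hU, F, hF, fun A => .base (hF' A)⟩
  | zero =>
    refine ⟨fun _ _ => zero_mem W, continuousOn_const, fun _ _ => 0, fun X _ H => ?_,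
      fun _ => .zero⟩
    simpa [hasDerivAtZero_iff] using HasCoeffDerivAt.const 0 0
  | @continuation u hu huW =>
    refine ⟨fun X hX => ?_, continuousOn_grassmannContinuation hU hu, _,
      hasSuperDeriv_grassmannContinuation hU hu, fun A => ?_⟩
    · change grassmannContinuation u X.1 ∈ W
      rw [← sub_add_cancel (grassmannContinuation u X.1) (u (evenBody X.1))]
      refine add_mem (mem_of_body_eq_zero hW ?_) (huW ⟨X, hX, rfl⟩)
      simp [grassmannContinuation_apply_empty]
    · rcases A with j | k
      · exact .continuation (hu.superPartialDeriv hV j) (mapsTo_superPartialDeriv hW hV hu huW j)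
      · exact .zero
  | @add f g _ _ ihf ihg =>
    obtain ⟨hf1, hf2, F, hF, hF'⟩ := ihf
    obtain ⟨hg1, hg2, G, hG, hG'⟩ := ihg
    refine ⟨fun X hX => add_mem (hf1 hX) (hg1 hX), hf2.add hg2, fun A X => F A X + G A X,
      fun X hX H => ?_, fun A => .add (hF' A) (hG' A)⟩
    rw [hasDerivAtZero_iff]
    simpa [mul_add, Finset.sum_add_distrib] using (hF.line_zero hX H).add (hG.line_zero hX H)
  | @neg f _ ihf =>
    obtain ⟨hf1, hf2, F, hF, hF'⟩ := ihf
    refine ⟨fun X hX => neg_mem (hf1 hX), hf2.neg, fun A X => -F A X, fun X hX H => ?_,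
      fun A => .neg (hF' A)⟩
    rw [hasDerivAtZero_iff]
    simpa using (hF.line_zero hX H).neg
  | @theta f k hf ihf =>
    obtain ⟨hf1, hf2, F, hF, hF'⟩ := ihf
    refine ⟨fun X hX => mem_of_body_eq_zero hW ?_,
      (continuous_coord (.inr k)).continuousOn.mul hf2, _, hF.theta_mul k, fun A => ?_⟩
    · change ((X.2 k : SuperNumber) * f X) ∅ = 0
      rw [SuperNumber.mul_empty, odd_body (X.2 k).2.2, zero_mul]
    · rcases A with j | l
      · exact .theta k (hF' _)
      · simp only [Sum.elim_inr]
        refine .add ?_ (.neg (.theta k (hF' _)))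
        split_ifs
        · exact hf
        · exact .zero

/-- The ordered product of the `θ_k`, `k ∈ a`, along a list. -/
noncomputable def thetaProd (l : List (Fin n)) (θ : Fin n → realOdd) (a : Finset (Fin n)) :
    SuperNumber := (l.map fun k => if k ∈ a then (θ k : SuperNumber) else 1).prod

theorem thetaProd_cons (k : Fin n) (l : List (Fin n)) (θ : Fin n → realOdd)
    (a : Finset (Fin n)) :
    thetaProd (k :: l) θ a = (if k ∈ a then (θ k : SuperNumber) else 1) * thetaProd l θ a := by
  simp [thetaProd]

theorem thetaPow_eq_thetaProd (θ : Fin n → realOdd) (a : Finset (Fin n)) :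
    thetaPow θ a = thetaProd (List.finRange n) θ a := by
  rw [thetaPow, thetaProd, List.ofFn_eq_map]

theorem SuperClosure.thetaProd_mul {W : Submodule ℝ SuperNumber}
    {f : SuperSpace m n → SuperNumber} (hf : SuperClosure U W f) (a : Finset (Fin n))
    (l : List (Fin n)) : SuperClosure U W fun X => thetaProd l X.2 a * f X := by
  induction l with
  | nil => simpa [thetaProd] using hf
  | cons k l ih =>
    simp only [thetaProd_cons, mul_assoc]
    by_cases hk : k ∈ a
    · simpa [hk] using ih.theta k
    · simpa [hk] using ih

theorem SuperClosure.sum {W : Submodule ℝ SuperNumber} {ι : Type*}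
    {f : ι → SuperSpace m n → SuperNumber} (hf : ∀ i, SuperClosure U W (f i)) (s : Finset ι) :
    SuperClosure U W fun X => ∑ i ∈ s, f i X := by
  classical
  induction s using Finset.induction_on with
  | empty => simpa using SuperClosure.zero
  | insert i s hi ih => simpa [Finset.sum_insert hi] using (hf i).add ih

theorem IsSuperfieldExpansion.isSuperDiffInfty {W : Submodule ℝ SuperNumber}
    (hW : W = ⊤ ∨ W = realBody) (hU : IsOpen U) {f : SuperSpace m n → SuperNumber}
    {u : Finset (Fin n) → (Fin m → ℝ) → SuperNumber} (h : IsSuperfieldExpansion U W f u) :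
    IsSuperDiffInfty U W f := by
  have : SuperClosure U W fun X => ∑ a, thetaPow X.2 a * grassmannContinuation (u a) X.1 := by
    refine SuperClosure.sum (fun a => ?_) _
    simp only [thetaPow_eq_thetaProd]
    exact (SuperClosure.continuation (h.1 a).1 (h.1 a).2).thetaProd_mul a _
  exact (this.isSuperDiffInfty hW hU).congr hU fun X hX => (h.2 X hX).symm

end Continuation

/-! ### Expansion in the odd coordinates. -/

section OddExpansion

variable {m n : ℕ} {U : Set (SuperSpace m n)} {W : Set SuperNumber}
  {f g : SuperSpace m n → SuperNumber}

/-- `f` does not depend on `θ_k`. -/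
def IsConstOdd (U : Set (SuperSpace m n)) (k : Fin n) (f : SuperSpace m n → SuperNumber) : Prop :=
  ∀ X ∈ U, ∀ y : realOdd, X + oddDir k y ∈ U → f (X + oddDir k y) = f X

/-- Since `y y = 0`, the derivative `y G` of `f` along the segment is constant; convexity keeps the
segment in `U`. -/
theorem IsSuperDiffInfty.apply_add_oddDir (h : IsSuperDiffInfty U W f) (hU : IsOpen U)
    (hconv : Convex ℝ U) {X : SuperSpace m n} (hX : X ∈ U) {k : Fin n} {y : realOdd}
    (hy : X + oddDir k y ∈ U) :
    f (X + oddDir k y) = f X + y * _root_.superDeriv U W (.inr k) f X := by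
  set G := _root_.superDeriv U W (.inr k) f with hG
  have hseg : ∀ t ∈ Icc (0 : ℝ) 1, X + t • oddDir k y ∈ U := fun t ht => hconv.add_smul_mem hX hy ht
  have h1 : ∀ t ∈ Icc (0 : ℝ) 1, HasCoeffDerivAt (fun t => y * G (X + t • oddDir k y)) 0 t := by
    intro t ht
    have := (((h.superDeriv hU (.inr k)).hasSuperDeriv hU).line (hseg t ht)).const_mul y
    rw [sum_coord_oddDir k y fun A => _root_.superDeriv U W A G (X + t • oddDir k y), ← mul_assoc,
      odd_mul_self y.2.2, zero_mul] at this
    exact this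
  have h2 : ∀ t ∈ Icc (0 : ℝ) 1, HasCoeffDerivAt (fun t => f (X + t • oddDir k y)) (y * G X) t := by
    intro t ht
    have := (h.hasSuperDeriv hU).line (hseg t ht)
    rw [sum_coord_oddDir k y fun A => _root_.superDeriv U W A f (X + t • oddDir k y),
      HasCoeffDerivAt.eq_of_deriv_zero h1 t ht] at this
    simpa using this
  simpa using HasCoeffDerivAt.sub_eq_of_deriv_const h2

/-- Expanding `f` at `X + y + t σ_i` from `X` and from `X + y` leaves `t σ_i G(X + y) = t σ_i G(X)`,
from which all `σ_i` cancel. -/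
theorem IsSuperDiffInfty.isConstOdd_superDeriv (h : IsSuperDiffInfty U W f) (hU : IsOpen U)
    (hconv : Convex ℝ U) (k : Fin n) : IsConstOdd U k (_root_.superDeriv U W (.inr k) f) := by
  intro X hX y hy
  refine eq_of_sigma_mul fun i => ?_
  -- Openness supplies one nonzero `t` for each `i`, which is all that is needed.
  have he : ∀ᶠ t : ℝ in 𝓝[≠] 0, X + oddDir k y + t • oddDir k (gen i) ∈ U ∧ t ≠ 0 :=
    Filter.Eventually.and
      (nhdsWithin_le_nhds (eventually_line_mem hU (t := 0) (by simpa using hy)))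
      self_mem_nhdsWithin
  obtain ⟨t, ht, ht0⟩ := he.exists
  rw [← oddDir_smul] at ht
  have e1 := h.apply_add_oddDir hU hconv hy ht
  rw [h.apply_add_oddDir hU hconv hX hy] at e1
  rw [add_assoc, ← oddDir_add] at ht
  have e2 := h.apply_add_oddDir hU hconv hX ht
  rw [oddDir_add, ← add_assoc] at e2
  rw [e1] at e2
  have e3 : ((t • gen i : realOdd) : SuperNumber) = (t : ℂ) • sigma {i} := rfl
  simp only [Submodule.coe_add, e3, add_mul, ← add_assoc] at e2
  have e4 := add_left_cancel e2
  simp only [smul_mul_assoc] at e4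
  exact smul_right_injective SuperNumber (Complex.ofReal_ne_zero.2 ht0) e4

theorem IsConstOdd.superDeriv {k : Fin n} (hc : IsConstOdd U k f) (h : IsSuperDiffInfty U W f)
    (hU : IsOpen U) (A : Fin m ⊕ Fin n) : IsConstOdd U k (_root_.superDeriv U W A f) := by
  intro X hX y hy
  refine congrFun (eq_of_sum_coord
    (F := fun A => _root_.superDeriv U W A f (X + oddDir k y))
    (G := fun A => _root_.superDeriv U W A f X) fun H => ?_) A
  refine ((h.hasSuperDeriv hU).line_zero hy H).unique
    (((h.hasSuperDeriv hU).line_zero hX H).congr_of_eventuallyEq ?_)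
  filter_upwards [eventually_line_mem hU (X := X) (H := H) (t := 0) (by simpa using hX),
    eventually_line_mem hU (X := X + oddDir k y) (H := H) (t := 0) (by simpa using hy)] with s h1 h2
  rw [add_right_comm] at h2 ⊢
  exact hc _ h1 y h2

theorem IsConstOdd.superDeriv_eq_zero {k : Fin n} (hc : IsConstOdd U k f)
    (h : IsSuperDiffInfty U W f) (hU : IsOpen U) :
    EqOn (_root_.superDeriv U W (.inr k) f) 0 U := by
  intro X hX
  refine eq_zero_of_sigma_mul fun i => ?_
  have h1 := (h.hasSuperDeriv hU).line_zero hX (oddDir k (gen i))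
  rw [sum_coord_oddDir k (gen i) fun A => _root_.superDeriv U W A f X] at h1
  refine h1.unique ((HasCoeffDerivAt.const (f X) 0).congr_of_eventuallyEq ?_)
  filter_upwards [eventually_line_mem hU (X := X) (H := oddDir k (gen i)) (t := 0)
    (by simpa using hX)] with s hs
  rw [← oddDir_smul] at hs ⊢
  exact hc X hX _ hs

theorem thetaProd_congr {l : List (Fin n)} {θ : Fin n → realOdd} {a b : Finset (Fin n)}
    (h : ∀ k ∈ l, k ∈ a ↔ k ∈ b) : thetaProd l θ a = thetaProd l θ b := by
  unfold thetaProd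
  congr 1
  exact List.map_congr_left fun k hk => by simp [h k hk]

theorem sum_thetaProd_cons {k : Fin n} {l : List (Fin n)} (hk : k ∉ l) (θ : Fin n → realOdd)
    (y : Finset (Fin n) → SuperNumber) :
    ∑ a ∈ (k :: l).toFinset.powerset, thetaProd (k :: l) θ a * y a
      = ∑ a ∈ l.toFinset.powerset, thetaProd l θ a * y a
        + θ k * ∑ a ∈ l.toFinset.powerset, thetaProd l θ a * y (insert k a) := by
  rw [List.toFinset_cons, Finset.sum_powerset_insert (by simpa using hk), Finset.mul_sum]
  congr 1 <;> refine Finset.sum_congr rfl fun a ha => ?_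
  · have hka : k ∉ a := fun h => hk (by simpa using Finset.mem_powerset.1 ha h)
    rw [thetaProd_cons, if_neg hka, one_mul]
  · rw [thetaProd_cons, if_pos (Finset.mem_insert_self _ _), mul_assoc]
    rw [thetaProd_congr (b := a)]
    intro j hj
    have : j ≠ k := by rintro rfl; exact hk hj
    simp [this]

/-- Split `f = g + θ_k G` with `G` the superderivative in `θ_k` and expand `g` and `G` in the
remaining variables. The alternative `IsConstOdd U k f` in the second clause is the induction
invariant: a variable already removed does not reappear. -/
theorem exists_odd_expansion {W : Submodule ℝ SuperNumber} (hW : W = ⊤ ∨ W = realBody)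
    (hU : IsOpen U) (hconv : Convex ℝ U) {l : List (Fin n)} (hl : l.Nodup)
    (hf : IsSuperDiffInfty U W f) :
    ∃ y : Finset (Fin n) → SuperSpace m n → SuperNumber,
      (∀ a, IsSuperDiffInfty U W (y a)) ∧
      (∀ a k, k ∈ l ∨ IsConstOdd U k f → IsConstOdd U k (y a)) ∧
      ∀ X ∈ U, f X = ∑ a ∈ l.toFinset.powerset, thetaProd l X.2 a * y a X := by
  induction l generalizing f with
  | nil => exact ⟨fun _ => f, fun _ => hf, fun _ k hk => hk.resolve_left (by simp), by simp [thetaProd]⟩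
  | cons k l ih =>
    rw [List.nodup_cons] at hl
    set G := superDeriv U W (.inr k) f with hG
    have hGs : IsSuperDiffInfty U W G := hf.superDeriv hU _
    have hGk : IsConstOdd U k G := hf.isConstOdd_superDeriv hU hconv k
    set g : SuperSpace m n → SuperNumber := fun X => f X + -(X.2 k * G X) with hg
    have hgs : IsSuperDiffInfty U W g :=
      (SuperClosure.add (.base hf) (.neg (.theta k (.base hGs)))).isSuperDiffInfty hW hU
    have hgk : IsConstOdd U k g := fun X hX y hy => by
      have e : (((X + oddDir k y).2 k : realOdd) : SuperNumber) = X.2 k + y := by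
        simp [oddDir]
      simp only [hg]
      rw [hGk X hX y hy, hf.apply_add_oddDir hU hconv hX hy, e, add_mul]
      abel
    have hgj : ∀ j, IsConstOdd U j f → IsConstOdd U j g := fun j hj => by
      rcases eq_or_ne j k with rfl | hjk
      · exact hgk
      intro X hX y hy
      have e : (((X + oddDir j y).2 k : realOdd) : SuperNumber) = X.2 k := by
        simp [oddDir, hjk.symm]
      simp only [hg]
      rw [hj X hX y hy, show G (X + oddDir j y) = G X from hj.superDeriv hf hU (.inr k) X hX y hy, e]
    obtain ⟨yg, hyg1, hyg2, hyg3⟩ := ih hl.2 hgs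
    obtain ⟨yG, hyG1, hyG2, hyG3⟩ := ih hl.2 hGs
    refine ⟨fun a => if k ∈ a then yG (a.erase k) else yg a, fun a => ?_, fun a j hj => ?_,
      fun X hX => ?_⟩
    · dsimp only; split_ifs
      exacts [hyG1 _, hyg1 _]
    · rw [List.mem_cons] at hj
      dsimp only
      split_ifs
      · refine hyG2 _ j ?_
        rcases hj with (rfl | hj) | hj
        exacts [.inr hGk, .inl hj, .inr (hj.superDeriv hf hU _)]
      · refine hyg2 _ j ?_
        rcases hj with (rfl | hj) | hj
        exacts [.inr hgk, .inl hj, .inr (hgj j hj)]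
    · rw [sum_thetaProd_cons hl.1 X.2 fun a => (if k ∈ a then yG (a.erase k) else yg a) X]
      have hka : ∀ a ∈ l.toFinset.powerset, k ∉ a := fun a ha h =>
        hl.1 (by simpa using Finset.mem_powerset.1 ha h)
      have e1 : ∑ a ∈ l.toFinset.powerset,
          thetaProd l X.2 a * (if k ∈ a then yG (a.erase k) else yg a) X = g X := by
        rw [hyg3 X hX]
        exact Finset.sum_congr rfl fun a ha => by rw [if_neg (hka a ha)]
      have e2 : ∑ a ∈ l.toFinset.powerset, thetaProd l X.2 a *
          (if k ∈ insert k a then yG ((insert k a).erase k) else yg (insert k a)) X = G X := by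
        rw [hyG3 X hX]
        exact Finset.sum_congr rfl fun a ha => by
          rw [if_pos (Finset.mem_insert_self _ _), Finset.erase_insert (hka a ha)]
      rw [e1, e2]
      simp only [hg]
      abel

end OddExpansion

/-! ### Functions of the even coordinates as Grassmann continuations. -/

section EvenContinuation

variable {m n : ℕ} {U : Set (SuperSpace m n)}

/-- A family of iterated derivatives, in the even directions, of a function which does not depend
on the odd coordinates. -/
structure SuperJet (U : Set (SuperSpace m n)) (h : (Fin m → ℕ) → SuperSpace m n → SuperNumber) :
    Prop where
  cont : ∀ α, ContinuousOn (h α) U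
  deriv : ∀ α, HasSuperDeriv U (h α) (Sum.elim (fun j => h (α + Pi.single j 1)) fun _ => 0)

theorem IsSuperDiffInfty.exists_superJet {W : Set SuperNumber} (hU : IsOpen U)
    {g : SuperSpace m n → SuperNumber} (hg : IsSuperDiffInfty U W g)
    (hc : ∀ k, IsConstOdd U k g) : ∃ h, SuperJet U h ∧ h 0 = g := by
  set D : Fin m → (SuperSpace m n → SuperNumber) → SuperSpace m n → SuperNumber :=
    fun j => _root_.superDeriv U W (.inl j) with hD
  have hops := commutingOperators (n := n) (W := W) hU
  have hmem : ∀ α, IsSuperDiffInfty U W (iterOps D (List.finRange m) α g) :=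
    fun α => hops.iterOps_mem _ α hg
  have hconst : ∀ α k, IsConstOdd U k (iterOps D (List.finRange m) α g) := by
    intro α k
    induction List.finRange m with
    | nil => exact hc k
    | cons i l ih =>
      have hi := hops.iterOps_mem l α hg
      have : ∀ r, IsConstOdd U k ((D i)^[r] (iterOps D l α g)) := by
        intro r
        induction r with
        | zero => exact ih
        | succ r ihr =>
          rw [Function.iterate_succ_apply']
          exact ihr.superDeriv (hops.iterate_mem i hi r) hU _
      exact this _
  refine ⟨fun α => iterOps D (List.finRange m) α g, ⟨fun α => (hmem α).continuousOn hU,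
    fun α => ((hmem α).hasSuperDeriv hU).congr hU (eqOn_refl _ _) fun A => ?_⟩, ?_⟩
  · rcases A with j | k
    · exact hops.iterOps_add_single (List.nodup_finRange m) (List.mem_finRange j) α hg
    · exact (hconst α k).superDeriv_eq_zero (hmem α) hU
  · change iterOps D (List.finRange m) 0 g = g
    induction List.finRange m with
    | nil => rfl
    | cons i l ih => exact ih

/-- `exp(-x_S ∂)` applied to a jet. -/
noncomputable def bodyValue (h : (Fin m → ℕ) → SuperSpace m n → SuperNumber) (α : Fin m → ℕ)
    (X : SuperSpace m n) : SuperNumber :=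
  taylorSum (-fun j => soul (X.1 j)) fun β => h (α + β) X

namespace SuperJet

variable {h : (Fin m → ℕ) → SuperSpace m n → SuperNumber}

theorem neg_soul_body (X : SuperSpace m n) (j : Fin m) :
    (-fun j => soul (X.1 j) : Fin m → SuperNumber) j ∅ = 0 := by
  simp [soul_apply_empty]

theorem continuousOn_bodyValue (hh : SuperJet U h) (α : Fin m → ℕ) :
    ContinuousOn (bodyValue h α) U :=
  continuousOn_taylorSum neg_soul_body
    (fun j => (continuous_soul.comp (continuous_coord (.inl j))).neg.continuousOn)
    fun β => hh.cont (α + β)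

/-- The jet moves with velocity `H_j` and the increment `-x_S` with minus the soul of `H_j`; what
remains is the body of `H_j`. -/
theorem hasCoeffDerivAt_bodyValue (hh : SuperJet U h) (α : Fin m → ℕ) {X H : SuperSpace m n}
    {t : ℝ} (ht : X + t • H ∈ U) :
    HasCoeffDerivAt (fun r => bodyValue h α (X + r • H))
      (∑ j, (body H j : ℂ) • bodyValue h (α + Pi.single j 1) (X + t • H)) t := by
  have key := hasCoeffDerivAt_taylorSum (t := t)
    (s := fun (r : ℝ) => -fun j => soul ((X + r • H).1 j)) (S := fun j => -soul (H.1 j))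
    (c := fun j => H.1 j) (h := fun β r => h (α + β) (X + r • H))
    (fun r j => neg_soul_body _ j) (fun j => neg_mem (soul_mem_evenPart (H.1 j).2.2))
    (fun j => by simp [soul_apply_empty])
    (fun j => by
      have := (HasCoeffDerivAt.line (soul (X.1 j)) (soul (H.1 j)) t).neg
      simpa [soul_add, soul_real_smul] using this)
    (fun β => by
      have := (hh.deriv (α + β)).line ht
      rw [Fintype.sum_sum_type] at this
      simpa [coord, add_assoc] using this)
  convert key using 1
  · rfl
  refine Finset.sum_congr rfl fun j _ => ?_
  have e : (H.1 j : SuperNumber) + -soul (H.1 j) = (body H j : ℂ) • 1 := by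
    nth_rewrite 1 [← evenBody_smul_one_add_soul H.1 j]
    rw [add_neg_cancel_right]; rfl
  rw [e, smul_mul_assoc, one_mul]
  congr 1
  refine taylorSum_congr fun β => ?_
  rw [add_right_comm, add_assoc]

/-- Two points over the same body point are joined by a segment in `U` whose direction has no body,
so the derivative along it is zero. -/
theorem bodyValue_eq_of_body_eq (hh : SuperJet U h) (hconv : Convex ℝ U) (α : Fin m → ℕ)
    {X Y : SuperSpace m n} (hX : X ∈ U) (hY : Y ∈ U) (e : body X = body Y) :
    bodyValue h α Y = bodyValue h α X := by
  have hb : body (Y - X) = 0 := by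
    have : body Y = body (Y - X) + body X := by rw [← body_add, sub_add_cancel]
    rw [e] at this
    simpa using this
  have := HasCoeffDerivAt.eq_of_deriv_zero (fun t ht => by
    simpa [hb] using hh.hasCoeffDerivAt_bodyValue α (hconv.add_smul_sub_mem hX hY ht)) 1
    (right_mem_Icc.2 zero_le_one)
  simpa using this

open Classical in
/-- The functions on the body whose Grassmann continuations form the jet. -/
noncomputable def onBody (U : Set (SuperSpace m n))
    (h : (Fin m → ℕ) → SuperSpace m n → SuperNumber) (α : Fin m → ℕ) (q : Fin m → ℝ) :
    SuperNumber :=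
  if hq : q ∈ body '' U then bodyValue h α hq.choose else 0

theorem onBody_body (hh : SuperJet U h) (hconv : Convex ℝ U) (α : Fin m → ℕ) {X : SuperSpace m n}
    (hX : X ∈ U) : onBody U h α (body X) = bodyValue h α X := by
  have hq : body X ∈ body '' U := ⟨X, hX, rfl⟩
  rw [onBody, dif_pos hq]
  exact (hh.bodyValue_eq_of_body_eq hconv α hq.choose_spec.1 hX hq.choose_spec.2).symm

theorem derivativeFamily (hh : SuperJet U h) (hU : IsOpen U) (hconv : Convex ℝ U)
    (I : Finset ℕ) : DerivativeFamily (body '' U) (fun α q => onBody U h α q I)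
      fun j α => α + Pi.single j 1 := by
  constructor
  · rintro α _ ⟨X, hX, rfl⟩
    refine ContinuousAt.continuousWithinAt ?_
    -- A continuous local section of the body map through `X`, along which `onBody` becomes
    -- `bodyValue`.
    set φ : (Fin m → ℝ) → SuperSpace m n := fun q => X + ofBody (q - body X)
    have hφ : Continuous φ :=
      continuous_const.add (continuous_ofBody.comp (continuous_id.sub continuous_const))
    have h0 : φ (body X) = X := by
      simpa [φ] using ofBody_smul (n := n) 0 (body X)
    have hφb : ∀ q, body (φ q) = q := fun q => by
      simp only [φ]; rw [body_add, body_ofBody]; abel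
    have hφU : ∀ᶠ q in 𝓝 (body X), φ q ∈ U :=
      hφ.continuousAt.eventually_mem (hU.mem_nhds (by rwa [h0]))
    have hc : ContinuousAt (fun q => bodyValue h α (φ q) I) (body X) := by
      have h1 := (hh.continuousOn_bodyValue α).continuousAt (hU.mem_nhds hX)
      rw [← h0] at h1
      exact ((continuous_apply_coeff I).continuousAt.comp h1).comp
        (f := φ) (x := body X) hφ.continuousAt
    refine hc.congr ?_
    filter_upwards [hφU] with q hq
    rw [← hh.onBody_body hconv α hq, hφb]
  · rintro α _ ⟨X, hX, rfl⟩ η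
    have h1 := hh.hasCoeffDerivAt_bodyValue α (X := X) (H := ofBody η) (t := 0) (by simpa using hX) I
    have h2 : (fun t : ℝ => onBody U h α (body X + t • η) I)
        =ᶠ[𝓝 0] fun t => bodyValue h α (X + t • ofBody η) I := by
      filter_upwards [eventually_line_mem hU (X := X) (H := ofBody η) (t := 0)
        (by simpa using hX)] with t ht
      rw [← hh.onBody_body hconv α ht, body_add, body_smul, body_ofBody]
    refine (h1.congr_of_eventuallyEq h2).congr_deriv ?_
    simp [body_ofBody, hh.onBody_body hconv _ hX]

theorem isSmoothOn_onBody (hh : SuperJet U h) (hU : IsOpen U) (hconv : Convex ℝ U) :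
    IsSmoothOn (body '' U) (onBody U h 0) := fun I =>
  (hh.derivativeFamily hU hconv I).contDiffOn (isOpen_body hU) 0

/-- The derivatives of `onBody U h 0` are the `onBody U h α`, whose values are `exp(-x_S ∂)` of the
shifted jet; the continuation applies `exp(x_S ∂)` and inverts this. -/
theorem grassmannContinuation_onBody (hh : SuperJet U h) (hU : IsOpen U) (hconv : Convex ℝ U)
    {X : SuperSpace m n} (hX : X ∈ U) :
    grassmannContinuation (onBody U h 0) X.1 = h 0 X := by
  rw [grassmannContinuation_eq_taylorSum]
  rw [← taylorSum_taylorSum_neg (s := fun j => soul (X.1 j)) (fun j => soul_apply_empty _)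
    (fun j => soul_mem_evenPart (X.1 j).2.2) fun α => h α X]
  refine taylorSum_congr fun α => ?_
  have e1 := hh.onBody_body hconv α hX
  rw [bodyValue] at e1
  rw [← e1]
  ext I
  exact (hh.derivativeFamily hU hconv I).multiDeriv_eqOn (isOpen_body hU) α ⟨X, hX, rfl⟩

end SuperJet

theorem IsSuperDiffInfty.exists_superfieldExpansion {W : Submodule ℝ SuperNumber}
    (hW : W = ⊤ ∨ W = realBody) (hU : IsOpen U) (hconv : Convex ℝ U)
    {f : SuperSpace m n → SuperNumber} (hf : IsSuperDiffInfty U W f) :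
    ∃ u : Finset (Fin n) → (Fin m → ℝ) → SuperNumber, IsSuperfieldExpansion U W f u := by
  obtain ⟨y, hy1, hy2, hy3⟩ := exists_odd_expansion hW hU hconv (List.nodup_finRange n) hf
  choose h hh h0 using fun a => (hy1 a).exists_superJet hU fun k =>
    hy2 a k (.inl (List.mem_finRange k))
  refine ⟨fun a => SuperJet.onBody U (h a) 0, fun a => ⟨(hh a).isSmoothOn_onBody hU hconv, ?_⟩,
    fun X hX => ?_⟩
  · rintro _ ⟨X, hX, rfl⟩
    change SuperJet.onBody U (h a) 0 (body X) ∈ W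
    -- `exp(-x_S ∂)` does not change the body, so the value lies in `W` together with `y a X`.
    rw [(hh a).onBody_body hconv 0 hX, ← sub_add_cancel (bodyValue (h a) 0 X) (y a X)]
    refine add_mem (mem_of_body_eq_zero hW ?_) ((hy1 a).mapsTo hX)
    rw [bodyValue, sub_apply, taylorSum_apply_empty (SuperJet.neg_soul_body X), add_zero, h0,
      sub_self]
  · rw [hy3 X hX]
    have : (List.finRange n).toFinset.powerset = Finset.univ := by ext a; simp
    rw [this]
    refine Finset.sum_congr rfl fun a _ => ?_
    rw [thetaPow_eq_thetaProd, (hh a).grassmannContinuation_onBody hU hconv hX, h0]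

end EvenContinuation

/-! ### Uniqueness of the superfield expansion. -/

section Uniqueness

variable {m n : ℕ} {U : Set (SuperSpace m n)}

theorem thetaProd_add_oddDir {k : Fin n} {l : List (Fin n)} (hk : k ∉ l) (X : SuperSpace m n)
    (y : realOdd) (a : Finset (Fin n)) :
    thetaProd l (X + oddDir k y).2 a = thetaProd l X.2 a := by
  unfold thetaProd
  congr 1
  refine List.map_congr_left fun j hj => ?_
  have : j ≠ k := by rintro rfl; exact hk hj
  simp [oddDir, this]

/-- In `g + θ_k G = 0`, with `g` and `G` free of `θ_k`, a shift of `θ_k` by `t σ_i` leaves `t σ_i G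
= 0` for all `i`; hence `G = 0`, then `g = 0`, and the induction continues with both. -/
theorem odd_expansion_unique (hU : IsOpen U) {l : List (Fin n)} (hl : l.Nodup)
    {y : Finset (Fin n) → SuperSpace m n → SuperNumber}
    (hy : ∀ a, ∀ k ∈ l, IsConstOdd U k (y a))
    (h : ∀ X ∈ U, ∑ a ∈ l.toFinset.powerset, thetaProd l X.2 a * y a X = 0) :
    ∀ a ⊆ l.toFinset, ∀ X ∈ U, y a X = 0 := by
  induction l generalizing y with
  | nil =>
    intro a ha X hX
    obtain rfl : a = ∅ := by simpa using ha
    simpa [thetaProd] using h X hX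
  | cons k l ih =>
    rw [List.nodup_cons] at hl
    have hsum : ∀ z : Finset (Fin n) → SuperSpace m n → SuperNumber,
        (∀ a, IsConstOdd U k (z a)) →
        IsConstOdd U k fun X => ∑ a ∈ l.toFinset.powerset, thetaProd l X.2 a * z a X := by
      intro z hz X hX w hw
      refine Finset.sum_congr rfl fun a _ => ?_
      rw [thetaProd_add_oddDir hl.1, hz a X hX w hw]
    have hg := hsum y fun a => hy a k (by simp)
    have hG := hsum (fun a => y (insert k a)) fun a => hy _ k (by simp)
    simp only [fun X : SuperSpace m n => sum_thetaProd_cons hl.1 X.2 fun a => y a X] at h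
    have hG0 : ∀ X ∈ U, ∑ a ∈ l.toFinset.powerset, thetaProd l X.2 a * y (insert k a) X = 0 := by
      intro X hX
      refine eq_zero_of_sigma_mul fun i => ?_
      have he : ∀ᶠ t : ℝ in 𝓝[≠] 0, X + t • oddDir k (gen i) ∈ U ∧ t ≠ 0 :=
        Filter.Eventually.and
          (nhdsWithin_le_nhds (eventually_line_mem hU (t := 0) (by simpa using hX)))
          self_mem_nhdsWithin
      obtain ⟨t, ht, ht0⟩ := he.exists
      rw [← oddDir_smul] at ht
      have e1 := h _ ht
      have e2 : (((X + oddDir k (t • gen i)).2 k : realOdd) : SuperNumber)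
          = X.2 k + (t : ℂ) • sigma {i} := by
        have : ((t • gen i : realOdd) : SuperNumber) = (t : ℂ) • sigma {i} := rfl
        simp [oddDir, ← this]
      have e3 := hg X hX _ ht
      have e4 := hG X hX _ ht
      dsimp only at e3 e4
      rw [e3, e4, e2, add_mul, ← add_assoc, h X hX, zero_add,
        smul_mul_assoc] at e1
      exact (smul_eq_zero.1 e1).resolve_left (Complex.ofReal_ne_zero.2 ht0)
    have hg0 : ∀ X ∈ U, ∑ a ∈ l.toFinset.powerset, thetaProd l X.2 a * y a X = 0 := by
      intro X hX
      simpa [hG0 X hX] using h X hX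
    intro a ha X hX
    by_cases hka : k ∈ a
    · have := ih hl.2 (y := fun a => y (insert k a)) (fun a j hj => hy _ j (by simp [hj])) hG0
        (a.erase k) (fun j hj => by
          have := ha (Finset.mem_of_mem_erase hj)
          simpa [Finset.ne_of_mem_erase hj] using this) X hX
      rwa [Finset.insert_erase hka] at this
    · refine ih hl.2 (fun a j hj => hy _ j (by simp [hj])) hg0 a (fun j hj => ?_) X hX
      have h1 : j ≠ k := by rintro rfl; exact hka hj
      simpa [h1] using ha hj

/-- Induction on the size of `I`: beyond `u_I` itself, the coefficient of the continuation at `I`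
involves only derivatives of `u_J` with `|J| < |I|`, and these agree because `u_J` and `v_J` agree
on an open set. -/
theorem grassmannContinuation_inj (hU : IsOpen U) {u v : (Fin m → ℝ) → SuperNumber}
    (h : ∀ X ∈ U, grassmannContinuation u X.1 = grassmannContinuation v X.1) :
    EqOn u v (body '' U) := by
  have hV := isOpen_body hU
  have key : ∀ (N : ℕ) (I : Finset ℕ), I.card = N → EqOn (fun q => u q I) (fun q => v q I)
      (body '' U) := by
    intro N
    induction N using Nat.strong_induction_on with
    | _ N ih =>
      rintro I rfl _ ⟨X, hX, rfl⟩
      have h1 := congrFun (h X hX) I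
      rw [grassmannContinuation_eq_taylorSum, grassmannContinuation_eq_taylorSum] at h1
      have h2 := taylorSum_apply_inj (fun j => soul_apply_empty _) (fun α J hJ =>
        multiDeriv_congr hV (ih J.card hJ J rfl) α ⟨X, hX, rfl⟩) h1
      have h3 : ∀ w : (Fin m → ℝ) → SuperNumber, superMultiDeriv 0 w (evenBody X.1) I
          = w (body X) I := by
        intro w
        change (List.finRange m).foldr (fun j h => (partialDeriv j)^[(0 : Fin m → ℕ) j] h)
          (fun q' => w q' I) (body X) = w (body X) I
        induction List.finRange m with
        | nil => rfl
        | cons i l ih => exact ih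
      exact (h3 u).symm.trans (h2.trans (h3 v))
  exact fun q hq => SuperNumber.ext fun I => key _ I rfl hq

theorem IsSuperfieldExpansion.unique (hU : IsOpen U) {W : Set SuperNumber}
    {f : SuperSpace m n → SuperNumber} {u v : Finset (Fin n) → (Fin m → ℝ) → SuperNumber}
    (hu : IsSuperfieldExpansion U W f u) (hv : IsSuperfieldExpansion U W f v)
    (a : Finset (Fin n)) : EqOn (u a) (v a) (body '' U) := by
  refine grassmannContinuation_inj hU fun X hX => ?_
  refine sub_eq_zero.1 (odd_expansion_unique hU (List.nodup_finRange n)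
    (y := fun a X => grassmannContinuation (u a) X.1 - grassmannContinuation (v a) X.1)
    (fun a k _ X _ y _ => by simp [oddDir]) (fun X hX => ?_) a (fun j _ => by simp) X hX)
  have : (List.finRange n).toFinset.powerset = Finset.univ := by ext a; simp
  simp only [this, mul_sub, Finset.sum_sub_distrib, ← thetaPow_eq_thetaProd]
  rw [← hu.2 X hX, ← hv.2 X hX, sub_self]

end Uniqueness

/-! ### From superdifferentiability to Gâteaux smoothness and the Cauchy–Riemann equations. -/

section GateauxSmooth

variable {m n : ℕ} {U : Set (SuperSpace m n)} {W : Set SuperNumber}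
  {f : SuperSpace m n → SuperNumber}

/-- The iterated Gâteaux differentials in terms of the superderivatives. -/
noncomputable def gateauxDiff (U : Set (SuperSpace m n)) (W : Set SuperNumber) :
    (k : ℕ) → (SuperSpace m n → SuperNumber) → SuperSpace m n → (Fin k → SuperSpace m n) →
      SuperNumber
  | 0, f, X, _ => f X
  | k + 1, f, X, y => ∑ A, coord (y 0) A * gateauxDiff U W k (superDeriv U W A f) X (Fin.tail y)

/-- `gateauxDiff` peels off the first direction while differentiation appends a last one, so in the
induction the coordinates of `y 0` are constants. -/
theorem IsSuperDiffInfty.hasCoeffDerivAt_gateauxDiff (hf : IsSuperDiffInfty U W f) (hU : IsOpen U)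
    (k : ℕ) {X : SuperSpace m n} (hX : X ∈ U) (y : Fin (k + 1) → SuperSpace m n) :
    HasCoeffDerivAt (fun t : ℝ => gateauxDiff U W k f (X + t • y (Fin.last k)) (Fin.init y))
      (gateauxDiff U W (k + 1) f X y) 0 := by
  induction k generalizing f with
  | zero => exact (hf.hasSuperDeriv hU).line_zero hX (y 0)
  | succ k ih =>
    refine HasCoeffDerivAt.sum fun A _ => HasCoeffDerivAt.const_mul _ ?_
    have := ih (hf.superDeriv hU A) (Fin.tail y)
    rwa [← Fin.tail_init_eq_init_tail] at this

theorem IsSuperDiffInfty.continuousOn_gateauxDiff (hf : IsSuperDiffInfty U W f) (hU : IsOpen U)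
    (k : ℕ) : ContinuousOn (fun p : SuperSpace m n × (Fin k → SuperSpace m n) =>
      gateauxDiff U W k f p.1 p.2) (U ×ˢ univ) := by
  induction k generalizing f with
  | zero => exact (hf.continuousOn hU).comp continuousOn_fst fun p hp => hp.1
  | succ k ih =>
    refine continuousOn_finsetSum _ fun A _ => ContinuousOn.mul ?_ ?_
    · exact ((continuous_coord A).comp ((continuous_apply 0).comp continuous_snd)).continuousOn
    · have hc : Continuous fun p : SuperSpace m n × (Fin (k + 1) → SuperSpace m n) =>
          (p.1, Fin.tail p.2) :=
        continuous_fst.prodMk (continuous_pi fun i => (continuous_apply i.succ).comp continuous_snd)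
      exact (ih (hf.superDeriv hU A)).comp hc.continuousOn fun p hp => ⟨hp.1, trivial⟩

theorem IsSuperDiffInfty.isGateauxSmooth (hf : IsSuperDiffInfty U W f) (hU : IsOpen U) :
    IsGateauxSmooth U f :=
  ⟨fun k => gateauxDiff U W k f, fun _ _ _ => rfl,
    fun k _ hX y => hasDerivAtZero_iff.2 (hf.hasCoeffDerivAt_gateauxDiff hU k hX y),
    fun k => hf.continuousOn_gateauxDiff hU k⟩

/-- A real directional derivative which is complex linear in the direction is a complex
derivative. -/
theorem hasDerivAtZero_complex (hU : IsOpen U) {e : ℂ → SuperSpace m n} (he : Continuous e)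
    (hlin : ∀ (z h : ℂ) (t : ℝ), e (z + t • h) = e z + t • e h) {c : SuperSpace m n → SuperNumber}
    (hc : ContinuousOn c U)
    (hd : ∀ X ∈ U, ∀ h : ℂ, HasCoeffDerivAt (fun t : ℝ => f (X + t • e h)) (h • c X) 0)
    {X : SuperSpace m n} (hX : X ∈ U) : HasDerivAtZero ℂ (fun z => f (X + e z)) (c X) := by
  have h0 : X + e 0 = X := by
    have := hlin 0 0 1
    simpa using this
  rw [hasDerivAtZero_complex_iff]
  intro I
  set V : Set ℂ := (fun z => X + e z) ⁻¹' U
  have hφ : Continuous fun z => X + e z := continuous_const.add he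
  have hV : IsOpen V := hU.preimage hφ
  have h1 := hasFDerivAt_of_lineDeriv hV (φ := fun z => f (X + e z) I)
    (L := fun z => c (X + e z) I • ContinuousLinearMap.id ℝ ℂ)
    (ContinuousOn.smul ((continuousOn_iff_coeff.1 hc I).comp hφ.continuousOn fun z hz => hz)
      continuousOn_const)
    (fun z hz h => by
      have := hd _ hz h I
      simp only [add_assoc, ← hlin] at this
      simpa [mul_comm] using this)
    (x := 0) (show X + e 0 ∈ U by rwa [h0])
  -- The real Fréchet derivative is multiplication by a complex number, hence a complex derivative.
  have h2 := hasFDerivAt_of_restrictScalars ℝ h1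
    (f' := ContinuousLinearMap.smulRight (1 : ℂ →L[ℂ] ℂ) (c X I)) (by
      ext; simp [h0, mul_comm])
  simpa using h2.hasDerivAt

theorem continuous_smul_sigma (I : Finset ℕ) : Continuous fun z : ℂ => z • sigma I :=
  continuous_id.smul continuous_const

/-- The partial derivatives are `σ^I F_A`; the odd equations then express `σ^K σ^J + σ^J σ^K = 0`.
-/
theorem IsSuperDiffInfty.satisfiesCauchyRiemann (hf : IsSuperDiffInfty U W f) (hU : IsOpen U) :
    SatisfiesCauchyRiemann U f := by
  have hF := hf.hasSuperDeriv hU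
  have hcont : ∀ A I, ContinuousOn (fun X => sigma I * _root_.superDeriv U W A f X) U :=
    fun A I => continuousOn_const.mul ((hf.superDeriv hU A).continuousOn hU)
  refine ⟨fun A I X => sigma I * _root_.superDeriv U W A f X, fun X hX =>
    ⟨fun j => ?_, fun j I hI h0 => ?_, fun k I hI => ?_, fun j I hI => ?_, fun k J K hJ hK => ?_⟩⟩
  · have := hF.line_zero hX (evenDir j ⟨1, one_mem_realEven⟩)
    rw [sum_coord_evenDir j _ fun A => _root_.superDeriv U W A f X] at this
    simp only [← evenDir_smul] at this
    exact hasDerivAtZero_iff.2 this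
  · refine hasDerivAtZero_complex hU
      (e := fun z => evenDir j ⟨z • sigma I, smul_sigma_mem_realEven hI h0 z⟩) ?_ ?_
      (hcont (.inl j) I) (fun X hX h => ?_) hX
    · exact (continuous_evenDir j).comp ((continuous_smul_sigma I).subtype_mk _)
    · intro z h t
      have : (⟨(z + t • h) • sigma I, smul_sigma_mem_realEven hI h0 _⟩ : realEven)
          = ⟨z • sigma I, smul_sigma_mem_realEven hI h0 z⟩
            + t • ⟨h • sigma I, smul_sigma_mem_realEven hI h0 h⟩ := by
        ext J; simp [add_mul, mul_assoc]
      rw [this, evenDir_add, evenDir_smul]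
    · have := hF.line_zero hX (evenDir j ⟨h • sigma I, smul_sigma_mem_realEven hI h0 h⟩)
      rw [sum_coord_evenDir j _ fun A => _root_.superDeriv U W A f X] at this
      simpa [smul_mul_assoc] using this
  · refine hasDerivAtZero_complex hU
      (e := fun z => oddDir k ⟨z • sigma I, smul_sigma_mem_realOdd hI z⟩) ?_ ?_
      (hcont (.inr k) I) (fun X hX h => ?_) hX
    · exact (continuous_oddDir k).comp ((continuous_smul_sigma I).subtype_mk _)
    · intro z h t
      have : (⟨(z + t • h) • sigma I, smul_sigma_mem_realOdd hI _⟩ : realOdd)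
          = ⟨z • sigma I, smul_sigma_mem_realOdd hI z⟩
            + t • ⟨h • sigma I, smul_sigma_mem_realOdd hI h⟩ := by
        ext J; simp [add_mul, mul_assoc]
      rw [this, oddDir_add, oddDir_smul]
    · have := hF.line_zero hX (oddDir k ⟨h • sigma I, smul_sigma_mem_realOdd hI h⟩)
      rw [sum_coord_oddDir k _ fun A => _root_.superDeriv U W A f X] at this
      simpa [smul_mul_assoc] using this
  · change _ = sigma I * (1 * _)
    rw [one_mul]
  · dsimp only
    rw [← mul_assoc, ← mul_assoc, odd_mul_odd (sigma_mem_oddPart hJ) (sigma_mem_oddPart hK),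
      neg_mul, add_neg_cancel]

end GateauxSmooth

/-! ### Decomposition of directions into monomials. -/

section Components

namespace SuperNumber

theorem component_mem_realEven (y : realEven) (I : Finset ℕ) :
    (y : SuperNumber) I • sigma I ∈ realEven := by
  constructor
  · show (((y : SuperNumber) I • sigma I) ∅).im = 0
    rcases eq_or_ne I ∅ with rfl | hI
    · simpa [sigma] using show ((y : SuperNumber) ∅).im = 0 from y.2.1
    · simp [sigma, hI.symm]
  · intro J hJ
    rcases eq_or_ne J I with rfl | hI
    · rw [smul_apply, show (y : SuperNumber) J = 0 from y.2.2 J hJ, zero_mul]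
    · simp [sigma, hI]

theorem component_mem_realOdd (y : realOdd) (I : Finset ℕ) :
    (y : SuperNumber) I • sigma I ∈ realOdd := by
  constructor
  · show (((y : SuperNumber) I • sigma I) ∅).im = 0
    rcases eq_or_ne I ∅ with rfl | hI
    · simpa [sigma] using show ((y : SuperNumber) ∅).im = 0 from y.2.1
    · simp [sigma, hI.symm]
  · intro J hJ
    rcases eq_or_ne J I with rfl | hI
    · rw [smul_apply, show (y : SuperNumber) J = 0 from y.2.2 J hJ, zero_mul]
    · simp [sigma, hI]

/-- Convergence is coefficientwise, and each coefficient has one nonzero term. Through this,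
continuous additive maps are determined by their values on monomials. -/
theorem hasSum_components (X : SuperNumber) : HasSum (fun I => X I • sigma I) X :=
  Pi.hasSum.2 fun J => by
    have := hasSum_single (f := fun I => (X I • sigma I) J) J fun I hI => by
      simp [sigma, hI.symm]
    simpa [sigma] using this

theorem hasSum_components_realEven (y : realEven) :
    HasSum (fun I => (⟨(y : SuperNumber) I • sigma I, component_mem_realEven y I⟩ : realEven)) y :=
  (Topology.IsInducing.subtypeVal.hasSum_iff (g := realEven.subtype) _ _).1
    (hasSum_components (y : SuperNumber))

theorem hasSum_components_realOdd (y : realOdd) :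
    HasSum (fun I => (⟨(y : SuperNumber) I • sigma I, component_mem_realOdd y I⟩ : realOdd)) y :=
  (Topology.IsInducing.subtypeVal.hasSum_iff (g := realOdd.subtype) _ _).1
    (hasSum_components (y : SuperNumber))

/-- The even number `z σ^I`. -/
noncomputable def evenMonomial {I : Finset ℕ} (hI : Even I.card) (h0 : I.Nonempty) (z : ℂ) :
    realEven := ⟨z • sigma I, smul_sigma_mem_realEven hI h0 z⟩

/-- The odd number `z σ^I`. -/
noncomputable def oddMonomial {I : Finset ℕ} (hI : Odd I.card) (z : ℂ) : realOdd :=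
  ⟨z • sigma I, smul_sigma_mem_realOdd hI z⟩

theorem smul_evenMonomial {I : Finset ℕ} (hI : Even I.card) (h0 : I.Nonempty) (z : ℂ) (t : ℝ) :
    t • evenMonomial hI h0 z = evenMonomial hI h0 (t * z) := by
  ext J; simp [evenMonomial, mul_assoc]

theorem smul_oddMonomial {I : Finset ℕ} (hI : Odd I.card) (z : ℂ) (t : ℝ) :
    t • oddMonomial hI z = oddMonomial hI (t * z) := by
  ext J; simp [oddMonomial, mul_assoc]

/-- A generator which does not occur in `I`. -/
noncomputable def freshIndex (I : Finset ℕ) : ℕ := (Infinite.exists_notMem_finset I).choose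

theorem freshIndex_notMem (I : Finset ℕ) : freshIndex I ∉ I :=
  (Infinite.exists_notMem_finset I).choose_spec

end SuperNumber

namespace SuperSpace

variable {m n : ℕ}

theorem eq_sum_dirs (H : SuperSpace m n) :
    H = ∑ j, evenDir j (H.1 j) + ∑ k, oddDir k (H.2 k) := by
  have h1 : ∑ j, (evenDir j (H.1 j) : SuperSpace m n) = (H.1, 0) := by
    ext1
    · rw [Prod.fst_sum]; exact Finset.univ_sum_single H.1
    · rw [Prod.snd_sum]; exact Finset.sum_const_zero
  have h2 : ∑ k, (oddDir k (H.2 k) : SuperSpace m n) = (0, H.2) := by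
    ext1
    · rw [Prod.fst_sum]; exact Finset.sum_const_zero
    · rw [Prod.snd_sum]; exact Finset.univ_sum_single H.2
  rw [h1, h2]; simp

/-- A continuous additive map on superspace vanishes if it vanishes on the directions of the
coefficients. -/
theorem addMonoidHom_eq_zero {Δ : SuperSpace m n →+ SuperNumber} (hc : Continuous Δ)
    (heven : ∀ (j : Fin m) (y : realEven) (I : Finset ℕ),
      Δ (evenDir j ⟨(y : SuperNumber) I • sigma I, component_mem_realEven y I⟩) = 0)
    (hodd : ∀ (k : Fin n) (y : realOdd) (I : Finset ℕ),
      Δ (oddDir k ⟨(y : SuperNumber) I • sigma I, component_mem_realOdd y I⟩) = 0)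
    (H : SuperSpace m n) : Δ H = 0 := by
  rw [eq_sum_dirs H, map_add, map_sum, map_sum]
  have e1 : ∀ j, Δ (evenDir j (H.1 j)) = 0 := fun j => by
    have := ((hasSum_components_realEven (H.1 j)).map
      (AddMonoidHom.mk' (evenDir j) (evenDir_add j)) (continuous_evenDir j)).map Δ hc
    refine this.unique ?_
    convert hasSum_zero with I
    exact heven j _ I
  have e2 : ∀ k, Δ (oddDir k (H.2 k)) = 0 := fun k => by
    have := ((hasSum_components_realOdd (H.2 k)).map
      (AddMonoidHom.mk' (oddDir k) (oddDir_add k)) (continuous_oddDir k)).map Δ hc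
    refine this.unique ?_
    convert hasSum_zero with I
    exact hodd k _ I
  simp [e1, e2]

end SuperSpace

end Components

/-! ### From the Cauchy–Riemann equations to superdifferentiability. -/

section Gateaux

variable {m n : ℕ} {U : Set (SuperSpace m n)}

/-- A jointly continuous Gâteaux differential is linear in the direction. -/
theorem gateaux_linear (hU : IsOpen U) {φ : SuperSpace m n → SuperNumber}
    {D : SuperSpace m n → SuperSpace m n → SuperNumber}
    (hd : ∀ X ∈ U, ∀ H, HasCoeffDerivAt (fun t : ℝ => φ (X + t • H)) (D X H) 0)
    (hc : ∀ H, ContinuousOn (fun X => D X H) U) {X : SuperSpace m n} (hX : X ∈ U)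
    (a b : ℝ) (H K : SuperSpace m n) :
    D X (a • H + b • K) = (a : ℂ) • D X H + (b : ℂ) • D X K := by
  ext I
  set p : ℝ × ℝ → SuperSpace m n := fun v => X + v.1 • H + v.2 • K with hp
  have hpc : Continuous p := (continuous_const.add (continuous_fst.smul continuous_const)).add
    (continuous_snd.smul continuous_const)
  have hp0 : p (0, 0) = X := by simp [hp]
  have hev : ∀ᶠ v in 𝓝 ((0, 0) : ℝ × ℝ), p v ∈ U :=
    hpc.continuousAt.eventually_mem (hU.mem_nhds (by rwa [hp0]))
  have hcont : ∀ L, ContinuousAt (fun v => D (p v) L I) (0, 0) := fun L => by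
    have h1 : ContinuousAt (fun X => D X L I) (p (0, 0)) := by
      rw [hp0]; exact (continuousOn_iff_coeff.1 (hc L) I).continuousAt (hU.mem_nhds hX)
    exact h1.comp (f := p) hpc.continuousAt
  have hline : ∀ Y ∈ U, ∀ L, HasDerivAt (fun t : ℝ => φ (Y + t • L) I) (D Y L I) 0 :=
    fun Y hY L => hd Y hY L I
  have hclm : Continuous fun c : ℂ => ContinuousLinearMap.smulRight (1 : ℝ →L[ℝ] ℝ) c :=
    (ContinuousLinearMap.smulRightL ℝ ℝ ℂ 1).continuous
  -- On the plane `X + s H + t K` the partial derivatives `D · H` and `D · K` are continuous at the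
  -- origin, so the restriction is differentiable there; its derivative along `(a, b)` is the claim.
  have key := hasStrictFDerivAt_uncurry_coprod (𝕜 := ℝ) (u := ((0, 0) : ℝ × ℝ))
    (f := fun s t => φ (p (s, t)) I)
    (f₁ := fun s t => ContinuousLinearMap.smulRight (1 : ℝ →L[ℝ] ℝ) (D (p (s, t)) H I))
    (f₂ := fun s t => ContinuousLinearMap.smulRight (1 : ℝ →L[ℝ] ℝ) (D (p (s, t)) K I))
    (by
      filter_upwards [hev] with v hv
      have h1 := hline _ hv H
      have h2 : HasDerivAt (fun s => φ (p (s, v.2)) I) (D (p v) H I) v.1 := by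
        have h3 := HasDerivAt.comp_sub_const v.1 v.1 (by rwa [sub_self])
        refine h3.congr_of_eventuallyEq (Eventually.of_forall fun s => ?_)
        refine congrArg (fun Y => φ Y I) ?_
        simp only [hp, sub_smul]
        abel
      exact h2.hasFDerivAt)
    (by
      filter_upwards [hev] with v hv
      have h1 := hline _ hv K
      have h2 : HasDerivAt (fun t => φ (p (v.1, t)) I) (D (p v) K I) v.2 := by
        have h3 := HasDerivAt.comp_sub_const v.2 v.2 (by rwa [sub_self])
        refine h3.congr_of_eventuallyEq (Eventually.of_forall fun s => ?_)
        refine congrArg (fun Y => φ Y I) ?_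
        simp only [hp, sub_smul]
        abel
      exact h2.hasFDerivAt)
    (hclm.continuousAt.comp (hcont H)) (hclm.continuousAt.comp (hcont K))
  have h1 := key.hasFDerivAt.hasLineDerivAt (a, b)
  rw [HasLineDerivAt] at h1
  have h2 : HasDerivAt (fun t : ℝ => φ (X + t • (a • H + b • K)) I)
      (a • D X H I + b • D X K I) 0 := by
    refine HasDerivAt.congr_deriv (h1.congr_of_eventuallyEq (Eventually.of_forall fun t => ?_)) ?_
    · refine congrArg (fun Y => φ Y I) ?_
      simp [hp, smul_smul, add_assoc]
    · simp [Function.HasUncurry.uncurry, hp0]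
  simpa using (hline X hX _).unique h2

/-- Iterated Gâteaux differentials which satisfy the Cauchy–Riemann equations. -/
structure CauchyRiemannTower (U : Set (SuperSpace m n))
    (D : (k : ℕ) → SuperSpace m n → (Fin k → SuperSpace m n) → SuperNumber) : Prop where
  deriv : ∀ k, ∀ X ∈ U, ∀ (y : Fin k → SuperSpace m n) (H : SuperSpace m n),
    HasCoeffDerivAt (fun t : ℝ => D k (X + t • H) y) (D (k + 1) X (Fin.snoc y H)) 0
  cont : ∀ k, ContinuousOn (fun p : SuperSpace m n × (Fin k → SuperSpace m n) => D k p.1 p.2)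
    (U ×ˢ univ)
  -- Both equations have the form `L₁ * D 1 X H₁ + L₂ * D 1 X H₂ = 0` to which `relation` applies;
  -- hence the factor `1`.
  even : ∀ X ∈ U, ∀ (j : Fin m) (I : Finset ℕ) (hI : Even I.card) (h0 : I.Nonempty) (z : ℂ),
    1 * D 1 X (fun _ => evenDir j (evenMonomial hI h0 z))
      + -(z • sigma I) * D 1 X (fun _ => evenDir j ⟨1, one_mem_realEven⟩) = 0
  odd : ∀ X ∈ U, ∀ (k : Fin n) (J K : Finset ℕ) (hJ : Odd J.card) (hK : Odd K.card) (z : ℂ),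
    sigma K * D 1 X (fun _ => oddDir k (oddMonomial hJ z))
      + z • sigma J * D 1 X (fun _ => oddDir k (oddMonomial hK 1)) = 0

namespace CauchyRiemannTower

variable {D E : (k : ℕ) → SuperSpace m n → (Fin k → SuperSpace m n) → SuperNumber}

theorem snoc_elim0 (H : SuperSpace m n) :
    (Fin.snoc (Fin.elim0 : Fin 0 → SuperSpace m n) H : Fin 1 → SuperSpace m n) = fun _ => H := by
  funext i
  obtain rfl : i = Fin.last 0 := Fin.fin_one_eq_zero i
  exact Fin.snoc_last _ _

theorem cons_elim0 (H : SuperSpace m n) :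
    (Fin.cons H (Fin.elim0 : Fin 0 → SuperSpace m n) : Fin 1 → SuperSpace m n) = fun _ => H := by
  funext i
  obtain rfl : i = 0 := Fin.fin_one_eq_zero i
  exact Fin.cons_zero _ _

theorem continuousOn_fixed (h : CauchyRiemannTower U D) (k : ℕ) (y : Fin k → SuperSpace m n) :
    ContinuousOn (fun X => D k X y) U :=
  (h.cont k).comp (continuous_id.prodMk continuous_const).continuousOn fun _ hX => ⟨hX, trivial⟩

theorem deriv_zero (h : CauchyRiemannTower U D) {X : SuperSpace m n} (hX : X ∈ U)
    (H : SuperSpace m n) :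
    HasCoeffDerivAt (fun t : ℝ => D 0 (X + t • H) Fin.elim0) (D 1 X fun _ => H) 0 := by
  have := h.deriv 0 X hX Fin.elim0 H
  rwa [snoc_elim0] at this

theorem linear (h : CauchyRiemannTower U D) (hU : IsOpen U) {X : SuperSpace m n} (hX : X ∈ U)
    {k : ℕ} (y : Fin k → SuperSpace m n) (a b : ℝ) (H K : SuperSpace m n) :
    D (k + 1) X (Fin.snoc y (a • H + b • K))
      = (a : ℂ) • D (k + 1) X (Fin.snoc y H) + (b : ℂ) • D (k + 1) X (Fin.snoc y K) :=
  gateaux_linear hU (φ := fun X => D k X y) (D := fun X H => D (k + 1) X (Fin.snoc y H))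
    (fun X hX H => h.deriv k X hX y H) (fun _ => h.continuousOn_fixed _ _) hX a b H K

/-- Second Gâteaux differentials are symmetric. -/
theorem symm (h : CauchyRiemannTower U D) (hU : IsOpen U) {X : SuperSpace m n} (hX : X ∈ U)
    (H K : SuperSpace m n) :
    D 2 X (Fin.snoc (fun _ : Fin 1 => H) K) = D 2 X (Fin.snoc (fun _ : Fin 1 => K) H) := by
  ext I
  set p : (Fin 2 → ℝ) → SuperSpace m n := fun q => X + (q 0 • H + q 1 • K) with hp
  have hpc : Continuous p := continuous_const.add
    (((continuous_apply 0).smul continuous_const).add ((continuous_apply 1).smul continuous_const))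
  have hp0 : p 0 = X := by simp [hp]
  set e : Fin 2 → SuperSpace m n := ![H, K]
  have hfam : DerivativeFamily (p ⁻¹' U)
      (fun (a : Σ k, Fin k → SuperSpace m n) q => D a.1 (p q) a.2 I)
      (fun j a => ⟨a.1 + 1, Fin.snoc a.2 (e j)⟩) := by
    constructor
    · intro a
      exact (continuousOn_iff_coeff.1 (h.continuousOn_fixed a.1 a.2) I).comp hpc.continuousOn
        fun q hq => hq
    · intro a q hq η
      have h1 := h.deriv a.1 (p q) hq a.2 (η 0 • H + η 1 • K) I
      rw [h.linear hU hq] at h1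
      refine HasDerivAt.congr_deriv (h1.congr_of_eventuallyEq
        (Eventually.of_forall fun t => ?_)) ?_
      · have : p (q + t • η) = p q + t • (η 0 • H + η 1 • K) := by
          simp only [hp, Pi.add_apply, Pi.smul_apply, smul_eq_mul, add_smul, smul_add, smul_smul]
          abel
        simp only [this]
      · simp [Fin.sum_univ_two, e]
  have := hfam.comm (hU.preimage hpc) ⟨0, Fin.elim0⟩ 1 0 (show p 0 ∈ U by rwa [hp0])
  simpa [hp0, snoc_elim0, e] using this

/-- Linear relations between first differentials are inherited by the superderivatives. -/
theorem relation (h : CauchyRiemannTower U D) (hU : IsOpen U)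
    (hE : ∀ X ∈ U, ∀ H : SuperSpace m n,
      HasCoeffDerivAt (fun t : ℝ => E 0 (X + t • H) Fin.elim0) (E 1 X fun _ => H) 0)
    {κ : SuperNumber} {K : SuperSpace m n}
    (hκ : ∀ X ∈ U, D 1 X (fun _ => K) = κ * E 0 X Fin.elim0) {L₁ L₂ : SuperNumber}
    {H₁ H₂ : SuperSpace m n}
    (hrel : ∀ X ∈ U, L₁ * D 1 X (fun _ => H₁) + L₂ * D 1 X (fun _ => H₂) = 0) :
    ∀ X ∈ U, L₁ * (κ * E 1 X fun _ => H₁) + L₂ * (κ * E 1 X fun _ => H₂) = 0 := by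
  intro X hX
  -- Differentiating `hκ` along `H` gives the second differential at `K`, `H`. After swapping, the
  -- claim is the derivative of `hrel` along `K`.
  have e1 : ∀ H, κ * E 1 X (fun _ => H) = D 2 X (Fin.snoc (fun _ : Fin 1 => H) K) := by
    intro H
    rw [h.symm hU hX]
    refine ((hE X hX H).const_mul κ).unique
      ((h.deriv 1 X hX (fun _ => K) H).congr_of_eventuallyEq ?_)
    filter_upwards [eventually_line_mem hU (X := X) (H := H) (t := 0) (by simpa using hX)] with t ht
    exact (hκ _ ht).symm
  rw [e1, e1]
  refine (((h.deriv 1 X hX (fun _ => H₁) K).const_mul L₁).add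
    ((h.deriv 1 X hX (fun _ => H₂) K).const_mul L₂)).unique
    ((HasCoeffDerivAt.const 0 0).congr_of_eventuallyEq ?_)
  filter_upwards [eventually_line_mem hU (X := X) (H := K) (t := 0) (by simpa using hX)] with t ht
  exact hrel _ ht

/-- The differentials of the superderivatives. -/
noncomputable def derivTower
    (D : (k : ℕ) → SuperSpace m n → (Fin k → SuperSpace m n) → SuperNumber) :
    Fin m ⊕ Fin n → (k : ℕ) → SuperSpace m n → (Fin k → SuperSpace m n) → SuperNumber
  | .inl j => fun k X y => D (k + 1) X (Fin.cons (evenDir j ⟨1, one_mem_realEven⟩) y)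
  -- The quotient by generators from `exists_eq_sigma_mul`. Each coefficient uses one coefficient of
  -- one differential in a fixed direction, so continuity and differentiability are inherited from
  -- `D`.
  | .inr l => fun k X y I => sign {freshIndex I} I *
      D (k + 1) X (Fin.cons (oddDir l (gen (freshIndex I))) y) ({freshIndex I} ∪ I)

theorem derivTower_deriv (h : CauchyRiemannTower U D) (A : Fin m ⊕ Fin n) (k : ℕ)
    {X : SuperSpace m n} (hX : X ∈ U) (y : Fin k → SuperSpace m n) (H : SuperSpace m n) :
    HasCoeffDerivAt (fun t : ℝ => derivTower D A k (X + t • H) y)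
      (derivTower D A (k + 1) X (Fin.snoc y H)) 0 := by
  have key : ∀ K : SuperSpace m n, HasCoeffDerivAt (fun t : ℝ => D (k + 1) (X + t • H) (Fin.cons K y))
      (D (k + 1 + 1) X (Fin.cons K (Fin.snoc y H))) 0 := by
    intro K
    have := h.deriv (k + 1) X hX (Fin.cons K y) H
    rwa [← Fin.cons_snoc_eq_snoc_cons] at this
  rcases A with j | l
  · exact key _
  · intro I
    exact (key _ _).const_mul _

theorem derivTower_cont (h : CauchyRiemannTower U D) (A : Fin m ⊕ Fin n) (k : ℕ) :
    ContinuousOn (fun p : SuperSpace m n × (Fin k → SuperSpace m n) => derivTower D A k p.1 p.2)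
      (U ×ˢ univ) := by
  have key : ∀ K : SuperSpace m n, ContinuousOn
      (fun p : SuperSpace m n × (Fin k → SuperSpace m n) => D (k + 1) p.1 (Fin.cons K p.2))
      (U ×ˢ univ) := by
    intro K
    have hc : Continuous fun p : SuperSpace m n × (Fin k → SuperSpace m n) =>
        (p.1, (Fin.cons K p.2 : Fin (k + 1) → SuperSpace m n)) := by
      refine continuous_fst.prodMk (continuous_pi fun i => ?_)
      refine Fin.cases ?_ (fun i => ?_) i
      · exact continuous_const
      · exact (continuous_apply i).comp continuous_snd
    exact (h.cont (k + 1)).comp hc.continuousOn fun p hp => ⟨hp.1, trivial⟩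
  rcases A with j | l
  · exact key _
  · rw [continuousOn_iff_coeff]
    intro I
    exact continuousOn_const.mul (continuousOn_iff_coeff.1 (key _) _)

theorem gen_eq_oddMonomial (i : ℕ) : gen i = oddMonomial (I := {i}) (by simp) 1 := by
  ext J; simp [gen, oddMonomial]

theorem apply_gen (h : CauchyRiemannTower U D) {X : SuperSpace m n} (hX : X ∈ U) (l : Fin n)
    (i : ℕ) : D 1 X (fun _ => oddDir l (gen i))
      = sigma {i} * derivTower D (.inr l) 0 X Fin.elim0 := by
  have := exists_eq_sigma_mul freshIndex freshIndex_notMem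
    (fun i => D 1 X (fun _ => oddDir l (gen i))) (fun i j => by
      have := h.odd X hX l {i} {j} (by simp) (by simp) 1
      rwa [← gen_eq_oddMonomial, ← gen_eq_oddMonomial, one_smul] at this) i
  rw [this]
  congr 1
  funext I
  simp only [derivTower, cons_elim0]

theorem derivTower_inl (j : Fin m) (X : SuperSpace m n) :
    derivTower D (.inl j) 0 X Fin.elim0
      = D 1 X (fun _ => evenDir j ⟨1, one_mem_realEven⟩) := by
  simp only [derivTower, cons_elim0]

/-- The odd equation with `K = {i}` reduces a general monomial to the generators, after which `σ_i`
cancels. -/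
theorem apply_oddMonomial (h : CauchyRiemannTower U D) {X : SuperSpace m n} (hX : X ∈ U)
    (l : Fin n) {J : Finset ℕ} (hJ : Odd J.card) (z : ℂ) :
    D 1 X (fun _ => oddDir l (oddMonomial hJ z))
      = z • sigma J * derivTower D (.inr l) 0 X Fin.elim0 := by
  refine eq_of_sigma_mul fun i => ?_
  have h1 := h.odd X hX l J {i} hJ (by simp) z
  rw [← gen_eq_oddMonomial, h.apply_gen hX] at h1
  rw [eq_neg_of_add_eq_zero_left h1, ← mul_assoc, ← mul_assoc, smul_mul_assoc, mul_smul_comm,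
    odd_mul_odd (sigma_mem_oddPart hJ) (sigma_mem_oddPart (I := {i}) (by simp))]
  simp

/-- Both sides are additive and continuous in `H`, so it suffices to compare them on monomials: real
linearity covers the body component, the Cauchy–Riemann equations cover the others. -/
theorem hasSuperDeriv (h : CauchyRiemannTower U D) (hU : IsOpen U) :
    HasSuperDeriv U (fun X => D 0 X Fin.elim0) fun A X => derivTower D A 0 X Fin.elim0 := by
  intro X hX H
  rw [hasDerivAtZero_iff]
  suffices e : D 1 X (fun _ => H) = ∑ A, coord H A * derivTower D A 0 X Fin.elim0 by
    rw [← e]; exact h.deriv_zero hX H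
  have hadd : ∀ H K : SuperSpace m n,
      D 1 X (fun _ => H + K) = D 1 X (fun _ => H) + D 1 X (fun _ => K) := by
    intro H K
    have := h.linear hU hX Fin.elim0 1 1 H K
    simpa [snoc_elim0] using this
  have h1 : ∀ j (y : realEven) (I : Finset ℕ),
      D 1 X (fun _ => evenDir j ⟨(y : SuperNumber) I • sigma I, component_mem_realEven y I⟩)
        = (y : SuperNumber) I • sigma I * derivTower D (.inl j) 0 X Fin.elim0 := by
    intro j y I
    rw [derivTower_inl]
    rcases I.eq_empty_or_nonempty with rfl | h0
    · have hy : (((y : SuperNumber) ∅).re : ℂ) = (y : SuperNumber) ∅ :=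
        Complex.ext rfl (by simpa using y.2.1.symm)
      have e1 : (⟨(y : SuperNumber) ∅ • sigma ∅, component_mem_realEven y ∅⟩ : realEven)
          = ((y : SuperNumber) ∅).re • ⟨1, one_mem_realEven⟩ := by
        ext J
        change (y : SuperNumber) ∅ * sigma ∅ J = (((y : SuperNumber) ∅).re : ℂ) * sigma ∅ J
        rw [hy]
      have := h.linear hU hX Fin.elim0 ((y : SuperNumber) ∅).re 0
        (evenDir j ⟨1, one_mem_realEven⟩) 0
      rw [snoc_elim0, snoc_elim0, snoc_elim0, smul_zero, add_zero] at this
      rw [e1, evenDir_smul, this, hy, show sigma ∅ = 1 from rfl]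
      simp
    · rcases Nat.even_or_odd I.card with hI | hI
      · have := h.even X hX j I hI h0 ((y : SuperNumber) I)
        rw [one_mul, neg_mul, ← sub_eq_add_neg] at this
        exact sub_eq_zero.1 this
      · have hy : (y : SuperNumber) I = 0 := y.2.2 I hI
        have e1 : (⟨(y : SuperNumber) I • sigma I, component_mem_realEven y I⟩ : realEven) = 0 := by
          ext J; simp [hy]
        have e2 := hadd 0 0
        rw [add_zero] at e2
        rw [e1, hy, zero_smul, zero_mul]
        have e3 : (evenDir j 0 : SuperSpace m n) = 0 := by simp [evenDir]
        rw [e3]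
        exact left_eq_add.1 e2
  have h2 : ∀ k (y : realOdd) (I : Finset ℕ),
      D 1 X (fun _ => oddDir k ⟨(y : SuperNumber) I • sigma I, component_mem_realOdd y I⟩)
        = (y : SuperNumber) I • sigma I * derivTower D (.inr k) 0 X Fin.elim0 := by
    intro k y I
    rcases Nat.even_or_odd I.card with hI | hI
    · have hy : (y : SuperNumber) I = 0 := y.2.2 I hI
      have e1 : (⟨(y : SuperNumber) I • sigma I, component_mem_realOdd y I⟩ : realOdd) = 0 := by
        ext J; simp [hy]
      have e2 := hadd 0 0
      rw [add_zero] at e2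
      rw [e1, hy, zero_smul, zero_mul]
      have e3 : (oddDir k 0 : SuperSpace m n) = 0 := by simp [oddDir]
      rw [e3]
      exact left_eq_add.1 e2
    · exact h.apply_oddMonomial hX k hI _
  set Δ : SuperSpace m n →+ SuperNumber := AddMonoidHom.mk'
    (fun H => D 1 X (fun _ => H) - ∑ A, coord H A * derivTower D A 0 X Fin.elim0) (fun H K => by
      simp only [hadd, coord_add, add_mul, Finset.sum_add_distrib]; abel) with hΔ
  have hc : Continuous Δ := by
    refine Continuous.sub ?_ (continuous_finsetSum _ fun A _ =>
      (continuous_coord A).mul continuous_const)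
    have := (h.cont 1).comp_continuous (f := fun H : SuperSpace m n => (X, fun _ : Fin 1 => H))
      (continuous_const.prodMk (continuous_pi fun _ => continuous_id)) fun H => ⟨hX, trivial⟩
    exact this
  refine sub_eq_zero.1 (addMonoidHom_eq_zero hc (fun j y I => ?_) (fun k y I => ?_) H)
  · simp only [hΔ, AddMonoidHom.mk'_apply]
    rw [h1, sum_coord_evenDir j _ fun A => derivTower D A 0 X Fin.elim0, sub_self]
  · simp only [hΔ, AddMonoidHom.mk'_apply]
    rw [h2, sum_coord_oddDir k _ fun A => derivTower D A 0 X Fin.elim0, sub_self]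

/-- For an even coordinate `A`, `relation` with `κ = 1` is the claim. For an odd one it gives the
claim with `σ_i` inside each term; pulling `σ_i` to the front costs nothing in the even equations
and a common sign in the odd ones, and then all `σ_i` cancel. -/
theorem derivTower_tower (h : CauchyRiemannTower U D) (hU : IsOpen U) (A : Fin m ⊕ Fin n) :
    CauchyRiemannTower U (derivTower D A) := by
  have hE : ∀ X ∈ U, ∀ H : SuperSpace m n, HasCoeffDerivAt
      (fun t : ℝ => derivTower D A 0 (X + t • H) Fin.elim0) (derivTower D A 1 X fun _ => H) 0 := by
    intro X hX H
    have := h.derivTower_deriv A 0 hX Fin.elim0 H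
    rwa [snoc_elim0] at this
  refine ⟨fun k X hX y H => h.derivTower_deriv A k hX y H, h.derivTower_cont A,
    fun X hX j I hI h0 z => ?_, fun X hX k J K hJ hK z => ?_⟩
  · have hz : -(z • sigma I) ∈ evenPart := neg_mem (smul_sigma_mem_realEven hI h0 z).2
    rcases A with i | l
    · have := h.relation hU hE (κ := 1) (fun X _ => by rw [one_mul, derivTower_inl])
        (fun X hX => h.even X hX j I hI h0 z) X hX
      simpa only [one_mul] using this
    · refine eq_zero_of_sigma_mul fun i => ?_
      have := h.relation hU hE (κ := sigma {i}) (fun X hX => h.apply_gen hX l i)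
        (fun X hX => h.even X hX j I hI h0 z) X hX
      rw [← mul_assoc (-(z • sigma I)), even_mul_comm hz, one_mul] at this
      rw [mul_add, one_mul, ← mul_assoc]
      exact this
  · rcases A with i | l
    · have := h.relation hU hE (κ := 1) (fun X _ => by rw [one_mul, derivTower_inl])
        (fun X hX => h.odd X hX k J K hJ hK z) X hX
      simpa only [one_mul] using this
    · refine eq_zero_of_sigma_mul fun i => ?_
      have := h.relation hU hE (κ := sigma {i}) (fun X hX => h.apply_gen hX l i)
        (fun X hX => h.odd X hX k J K hJ hK z) X hX
      have hi : sigma {i} ∈ oddPart := sigma_mem_oddPart (by simp)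
      rw [← mul_assoc, ← mul_assoc, odd_mul_odd (sigma_mem_oddPart hK) hi,
        odd_mul_odd (smul_sigma_mem_realOdd hJ z).2 hi, neg_mul, neg_mul, ← neg_add,
        neg_eq_zero] at this
      rw [mul_add, ← mul_assoc, ← mul_assoc]
      exact this

theorem isSuperDiffInfty (h : CauchyRiemannTower U D) (hU : IsOpen U) :
    IsSuperDiffInfty U univ fun X => D 0 X Fin.elim0 := by
  refine isSuperDiffInfty_of_class
    (fun f => ∃ D, CauchyRiemannTower U D ∧ f = fun X => D 0 X Fin.elim0) ?_ ⟨D, h, rfl⟩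
  rintro _ ⟨D, h, rfl⟩
  exact ⟨fun _ _ => trivial, h.continuousOn_fixed 0 _, _, h.hasSuperDeriv hU,
    fun A => ⟨_, h.derivTower_tower hU A, rfl⟩⟩

end CauchyRiemannTower

/-- A complex derivative gives the real directional derivatives. -/
theorem HasDerivAtZero.real_line {g : ℂ → SuperNumber} {P : SuperNumber}
    (h : HasDerivAtZero ℂ g P) (z : ℂ) : HasCoeffDerivAt (fun t : ℝ => g (t * z)) (z • P) 0 := by
  intro I
  have h1 := hasDerivAtZero_complex_iff.1 h I
  have h2 : HasDerivAt (fun t : ℝ => (t : ℂ) * z) z 0 := by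
    simpa using ((hasDerivAt_id (0 : ℝ)).ofReal_comp).mul_const z
  have := HasDerivAt.comp (0 : ℝ) (h₂ := fun z => g z I) (by simpa using h1) h2
  rw [mul_comm] at this
  exact this

theorem IsGateauxSmooth.isSuperDiffInfty {f : SuperSpace m n → SuperNumber}
    (hf : IsGateauxSmooth U f) (hcr : SatisfiesCauchyRiemann U f) (hU : IsOpen U) :
    IsSuperDiffInfty U univ f := by
  obtain ⟨D, hD0, hD1, hD2⟩ := hf
  obtain ⟨P, hP⟩ := hcr
  have hd : ∀ k, ∀ X ∈ U, ∀ (y : Fin k → SuperSpace m n) (H : SuperSpace m n),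
      HasCoeffDerivAt (fun t : ℝ => D k (X + t • H) y) (D (k + 1) X (Fin.snoc y H)) 0 := by
    intro k X hX y H
    have := hasDerivAtZero_iff.1 (hD1 k X hX (Fin.snoc y H))
    rwa [Fin.snoc_last, Fin.init_snoc] at this
  -- Uniqueness of derivatives identifies the first differential with the partial derivatives `P`,
  -- turning the equations for `P` into relations for `D 1`.
  have hd1 : ∀ X ∈ U, ∀ (H : SuperSpace m n) (v : SuperNumber),
      HasCoeffDerivAt (fun t : ℝ => f (X + t • H)) v 0 → D 1 X (fun _ => H) = v := by
    intro X hX H v hv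
    have h1 := hd 0 X hX Fin.elim0 H
    rw [CauchyRiemannTower.snoc_elim0] at h1
    refine h1.unique (hv.congr_of_eventuallyEq ?_)
    filter_upwards [eventually_line_mem hU (X := X) (H := H) (t := 0) (by simpa using hX)] with t ht
    exact hD0 _ ht _
  have hone : ∀ X ∈ U, ∀ j, D 1 X (fun _ => evenDir j ⟨1, one_mem_realEven⟩) = P (.inl j) ∅ X := by
    intro X hX j
    refine hd1 X hX _ _ ?_
    simp only [← evenDir_smul]
    exact hasDerivAtZero_iff.1 ((hP X hX).1 j)
  have heven : ∀ X ∈ U, ∀ (j : Fin m) (I : Finset ℕ) (hI : Even I.card) (h0 : I.Nonempty) (z : ℂ),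
      D 1 X (fun _ => evenDir j (evenMonomial hI h0 z)) = z • P (.inl j) I X := by
    intro X hX j I hI h0 z
    refine hd1 X hX _ _ ?_
    simp only [← evenDir_smul, smul_evenMonomial]
    exact ((hP X hX).2.1 j I hI h0).real_line z
  have hodd : ∀ X ∈ U, ∀ (k : Fin n) (I : Finset ℕ) (hI : Odd I.card) (z : ℂ),
      D 1 X (fun _ => oddDir k (oddMonomial hI z)) = z • P (.inr k) I X := by
    intro X hX k I hI z
    refine hd1 X hX _ _ ?_
    simp only [← oddDir_smul, smul_oddMonomial]
    exact ((hP X hX).2.2.1 k I hI).real_line z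
  have ht : CauchyRiemannTower U D := by
    refine ⟨hd, hD2, fun X hX j I hI h0 z => ?_, fun X hX k J K hJ hK z => ?_⟩
    · rw [heven X hX, hone X hX, (hP X hX).2.2.2.1 j I hI, one_mul, neg_mul, smul_mul_assoc,
        add_neg_cancel]
    · rw [hodd X hX, hodd X hX, one_smul, mul_smul_comm, smul_mul_assoc, ← smul_add,
        (hP X hX).2.2.2.2 k J K hJ hK, smul_zero]
  exact (ht.isSuperDiffInfty hU).congr hU fun X hX => hD0 X hX _

end Gateaux

theorem mainTheorem2 (m n : ℕ) (U : Set (SuperSpace m n)) (hU : IsOpen U) (hconv : Convex ℝ U)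
    (f : SuperSpace m n → SuperNumber) :
    List.TFAE
      [IsSuperDiffInfty U univ f,
       IsGateauxSmooth U f ∧ SatisfiesCauchyRiemann U f,
       ∃ u : Finset (Fin n) → (Fin m → ℝ) → SuperNumber, IsSuperfieldExpansion U univ f u] ∧
    (IsSuperDiffInfty U realBody f ↔
      ∃ u : Finset (Fin n) → (Fin m → ℝ) → SuperNumber, IsSuperfieldExpansion U realBody f u) ∧
    (∀ u v : Finset (Fin n) → (Fin m → ℝ) → SuperNumber,
      IsSuperfieldExpansion U univ f u → IsSuperfieldExpansion U univ f v →
      ∀ a, EqOn (u a) (v a) (body '' U)) := by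
  have htop : ((⊤ : Submodule ℝ SuperNumber) : Set SuperNumber) = univ := rfl
  refine ⟨?_, ⟨fun h => h.exists_superfieldExpansion (.inr rfl) hU hconv,
    fun ⟨u, hu⟩ => hu.isSuperDiffInfty (.inr rfl) hU⟩, fun u v hu hv a => hu.unique hU hv a⟩
  tfae_have 1 → 2 := fun h => ⟨h.isGateauxSmooth hU, h.satisfiesCauchyRiemann hU⟩
  tfae_have 2 → 1 := fun h => h.1.isSuperDiffInfty h.2 hU
  tfae_have 1 → 3 := fun h => by
    rw [← htop] at h ⊢
    exact h.exists_superfieldExpansion (.inl rfl) hU hconv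
  tfae_have 3 → 1 := fun ⟨u, hu⟩ => by
    rw [← htop] at hu ⊢
    exact hu.isSuperDiffInfty (.inl rfl) hU
  tfae_finish
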